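/- Let $F$ be a nonarchimedean local field with ring of integers $\mathfrak o_F$, maximal ideal $\mathfrak p_F$ and residue field of order $q$. Let $G=GL(2,F)$, let $Z$ be its center, $K=GL(2,\mathfrak o_F)$, and normalize Haar measure on $G/Z$ by $\mathrm{vol}(ZK/Z)=\frac12(q-1)$. Put $\mathcal M=M_2(\mathfrak o_F)$ and $\mathcal J=\begin{pmatrix}\mathfrak o_F&\mathfrak o_F\\ \mathfrak p_F&\mathfrak o_F\end{pmatrix}$; for $\mathcal U\in\{\mathcal M,\mathcal J\}$ let $U_{\mathcal U}=\mathcal U^\times$, let $\mathfrak P$ be the Jacobson radical of $\mathcal U$, and let $U_{\mathcal U}^i=1+\mathfrak P^i$ for $i\ge 1$. Let $E/F$ be a field extension of degree $2$, embedded in $M_2(F)$ as an $F$-algebra, such that $E^\times$ normalizes $U_{\mathcal U}$, where $\mathcal U=\mathcal M$ if $E/F$ is unramified and $\mathcal U=\mathcal J$ if $E/F$ is ramified. Let $n\ge1$ be an integer, odd if $E/F$ is ramified, let $i=\lfloor (n+1)/2\rfloor$ and $J=E^\times U_{\mathcal U}^i$. Then $$\mathrm{vol}(J/Z)=\begin{cases}\frac12\,q^{-(2i-1)}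 & E/F \text{ unramified},\\[2pt] \frac1{q+1}\,q^{-(i-1)} & E/F\text{ ramified}.\end{cases}$$ Moreover, let $\Lambda$ be a finite-dimensional irreducible smooth complex representation of $J$, of dimension $q$ if $E/F$ is unramified and $n$ is even, and of dimension $1$ otherwise, such that the compactly induced representation $\text{c-Ind}_J^G\Lambda$ is irreducible. Let $(\pi,\mathcal H)$ be a unitary completion of $\text{c-Ind}_J^G\Lambda$, that is, a continuous unitary representation of $G$ on a Hilbert space in which $\text{c-Ind}_J^G\Lambda$ embeds $G$-equivariantly with dense image. Then $\pi$ is square-integrable modulo $Z$, and its formal dimension is $$d_\pi=\begin{cases}2q^{2i} & E/F\text{ unramified},\ n\text{ even},\\ 2q^{2i-1} & E/F\text{ unramified},\ n\text{ odd},\\ (q+1)q^{i-1} & E/F\text{ ramified},\ n\text{ odd},\end{cases}$$ that is, for all $u,v,u',v'\in\mathcal H$ the function $g\mapsto(\pi(g)u,v)\overline{(\pi(g)u',v')}$ on $G/Z$ is integrable and $$\int_{G/Z}(\pi(g)u,v)\overline{(\pi(g)u',v')}\,d\dot g=\frac1{d_\pi}(u,u')\overline{(v,v')}.$$ -/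

import Mathlib

open scoped ValuativeRel Pointwise InnerProductSpace

universe uF uE uW uH

noncomputable section

namespace PadicGLTwo

/-! ### Smooth representations, compact induction, unitary completions, formal dimension -/

section Representations

universe u v w

variable {G : Type u} [Group G] [TopologicalSpace G]

/-- A complex representation is smooth if every vector is fixed by some open subgroup. -/
def IsSmoothRep {V : Type v} [AddCommGroup V] [Module ℂ V] (ρ : Representation ℂ G V) : Prop :=
  ∀ x : V, ∃ K : Subgroup G, IsOpen (K : Set G) ∧ ∀ k ∈ K, ρ k x = x

/-- The space of the compactly induced representation `c-Ind_J^G Λ`: the functions `f : G → W`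
such that `f (j g) = Λ(j) f(g)` for `j ∈ J`, which are invariant under right translation by some
open subgroup of `G`, and whose support is compact modulo `J`. -/
def cIndSpace [IsTopologicalGroup G] (J : Subgroup G) {W : Type w} [AddCommGroup W] [Module ℂ W]
    (Λ : Representation ℂ J W) : Submodule ℂ (G → W) where
  carrier := {f | (∀ (j : J) (g : G), f (j * g) = Λ j (f g)) ∧
    (∃ K : Subgroup G, IsOpen (K : Set G) ∧ ∀ g, ∀ k ∈ K, f (g * k) = f g) ∧
    ∃ C : Set G, IsCompact C ∧ Function.support f ⊆ (J : Set G) * C}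
  zero_mem' := ⟨by simp, ⟨⊤, isOpen_univ, by simp⟩, ⟨∅, isCompact_empty, by simp⟩⟩
  add_mem' := by
    rintro f f' ⟨h1, ⟨K, hK, h2⟩, C, hC, h3⟩ ⟨h1', ⟨K', hK', h2'⟩, C', hC', h3'⟩
    refine ⟨fun j g => by simp [h1, h1'], ⟨K ⊓ K', hK.inter hK', fun g k hk => ?_⟩,
      C ∪ C', hC.union hC', ?_⟩
    · simp [h2 g k hk.1, h2' g k hk.2]
    · rw [Set.mul_union]
      exact (Function.support_add f f').trans (Set.union_subset_union h3 h3')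
  smul_mem' := by
    rintro c f ⟨h1, ⟨K, hK, h2⟩, C, hC, h3⟩
    refine ⟨fun j g => by simp [h1], ⟨K, hK, fun g k hk => by simp [h2 g k hk]⟩, C, hC, ?_⟩
    exact (Function.support_const_smul_subset c f).trans h3

/-- The compactly induced representation `c-Ind_J^G Λ`: `G` acts on `cIndSpace J Λ` by right
translation. -/
def cInd [IsTopologicalGroup G] (J : Subgroup G) {W : Type w} [AddCommGroup W] [Module ℂ W]
    (Λ : Representation ℂ J W) : Representation ℂ G (cIndSpace J Λ) where
  toFun x :=
    { toFun := fun f => ⟨fun g => f.1 (g * x), by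
        obtain ⟨f, h1, ⟨K, hK, h2⟩, C, hC, h3⟩ := f
        refine ⟨fun j g => by simp [mul_assoc, h1],
          ⟨K.comap (MulAut.conj x⁻¹).toMonoidHom, ?_, fun g k hk => ?_⟩,
          C * {x⁻¹}, hC.mul isCompact_singleton, ?_⟩
        · have hc : Continuous fun k : G => x⁻¹ * k * x := by fun_prop
          have := hK.preimage hc
          convert this using 1
          ext k
          simp
        · have hk' : x⁻¹ * k * x ∈ K := by simpa using hk
          have := h2 (g * x) _ hk'
          simpa [mul_assoc] using this
        · intro g hg
          have hg' : g * x ∈ (J : Set G) * C := h3 hg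
          rw [← mul_assoc]
          exact ⟨g * x, hg', x⁻¹, rfl, by simp⟩⟩
      map_add' := fun _ _ => rfl
      map_smul' := fun _ _ => rfl }
  map_one' := by
    ext f g
    simp
  map_mul' x y := by
    ext f g
    simp [mul_assoc]

/-- The unitary representation `π` of `G` on the Hilbert space `H` is a completion of the
representation `ρ` on the complex vector space `V`: it is (strongly) continuous and `V` embeds
`G`-equivariantly onto a dense subspace of `H`. -/
structure IsUnitaryCompletion {V : Type v} [AddCommGroup V] [Module ℂ V]
    (ρ : Representation ℂ G V) {H : Type w} [NormedAddCommGroup H] [InnerProductSpace ℂ H]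
    (π : G →* (H ≃ₗᵢ[ℂ] H)) : Prop where
  continuous : ∀ x : H, Continuous fun g => π g x
  exists_embedding : ∃ ι : V →ₗ[ℂ] H, Function.Injective ι ∧ DenseRange ι ∧
    ∀ (g : G) (x : V), ι (ρ g x) = π g (ι x)

/-- The unitary representation `π` of `G` is square-integrable modulo the center `Z` of `G` with
formal dimension `d > 0` with respect to the measure `μ` on `G/Z`: Schur's relations
`∫_{G/Z} (π(g)x, y) conj (π(g)x', y') dμ = d⁻¹ (x, x') conj (y, y')` hold. In particular the
integrand is a function `f` on `G/Z` and it is integrable.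
(Mathlib's `⟪a, b⟫_ℂ` is linear in `b`, so that `(a, b)` is `⟪b, a⟫_ℂ`.) -/
def HasFormalDimension [MeasurableSpace (G ⧸ Subgroup.center G)]
    (μ : MeasureTheory.Measure (G ⧸ Subgroup.center G))
    {H : Type w} [NormedAddCommGroup H] [InnerProductSpace ℂ H]
    (π : G →* (H ≃ₗᵢ[ℂ] H)) (d : ℝ) : Prop :=
  0 < d ∧ ∀ x y x' y' : H, ∃ f : G ⧸ Subgroup.center G → ℂ,
    (∀ g : G, f (g : G ⧸ Subgroup.center G) =
      ⟪y, π g x⟫_ℂ * (starRingEnd ℂ) ⟪y', π g x'⟫_ℂ) ∧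
    MeasureTheory.Integrable f μ ∧
    ∫ z, f z ∂μ = ((1 / d : ℝ) : ℂ) * (⟪x', x⟫_ℂ * (starRingEnd ℂ) ⟪y', y⟫_ℂ)

/-- The volume of (the image of) `J` in `G/Z`, where `Z` is the center of `G`. -/
def volModCenter [MeasurableSpace (G ⧸ Subgroup.center G)]
    (μ : MeasureTheory.Measure (G ⧸ Subgroup.center G)) (J : Subgroup G) : ENNReal :=
  μ ((fun g : G => (g : G ⧸ Subgroup.center G)) '' (J : Set G))

/-- Let `Λ` be any irreducible smooth representation of `J` of dimension `m` such that
`c-Ind_J^G Λ` is irreducible. Then every unitary completion of `c-Ind_J^G Λ` is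
square-integrable modulo the center, of formal dimension `d`. -/
def InducedFormalDimension [IsTopologicalGroup G] [MeasurableSpace (G ⧸ Subgroup.center G)]
    (μ : MeasureTheory.Measure (G ⧸ Subgroup.center G)) (J : Subgroup G) (m : ℕ) (d : ℝ) : Prop :=
  ∀ (W : Type v) [AddCommGroup W] [Module ℂ W] [FiniteDimensional ℂ W]
    (Λ : Representation ℂ J W),
    IsSmoothRep Λ → Λ.IsIrreducible → Module.finrank ℂ W = m → (cInd J Λ).IsIrreducible →
    ∀ (H : Type w) [NormedAddCommGroup H] [InnerProductSpace ℂ H] [CompleteSpace H]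
      (π : G →* (H ≃ₗᵢ[ℂ] H)),
      IsUnitaryCompletion (cInd J Λ) π → HasFormalDimension μ π d

end Representations

/-! ### Chain orders in `M₂(F)` and quadratic extensions of `F` -/

section ChainOrders

variable (F : Type*) [Field F] [ValuativeRel F]

/-- The chain order `𝓜 = M₂(𝔬_F)`. -/
def orderM : Subalgebra 𝒪[F] (Matrix (Fin 2) (Fin 2) F) where
  carrier := {x | ∀ i j, x i j ∈ 𝒪[F]}
  mul_mem' := by
    intro x y hx hy i j
    rw [Matrix.mul_apply]
    exact sum_mem fun k _ => mul_mem (hx i k) (hy k j)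
  add_mem' := by
    intro x y hx hy i j
    exact add_mem (hx i j) (hy i j)
  algebraMap_mem' := by
    intro r i j
    rw [Matrix.algebraMap_matrix_apply]
    split_ifs
    · exact r.2
    · exact zero_mem _

/-- The chain order `𝓙` of the matrices with entries in `𝔬_F` and lower left entry in `𝔭_F`. -/
def orderJ : Subalgebra 𝒪[F] (Matrix (Fin 2) (Fin 2) F) where
  carrier := {x | (∀ i j, x i j ∈ 𝒪[F]) ∧ ValuativeRel.valuation F (x 1 0) < 1}
  mul_mem' := by
    rintro x y ⟨hx, hx'⟩ ⟨hy, hy'⟩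
    refine ⟨(orderM F).mul_mem hx hy, ?_⟩
    rw [Matrix.mul_apply, Fin.sum_univ_two]
    refine Valuation.map_add_lt _ ?_ ?_
    · rw [map_mul]
      exact mul_lt_one_of_nonneg_of_lt_one_left zero_le hx' (hy 0 0)
    · rw [map_mul]
      exact mul_lt_one_of_nonneg_of_lt_one_right (hx 1 1) zero_le hy'
  add_mem' := by
    rintro x y ⟨hx, hx'⟩ ⟨hy, hy'⟩
    exact ⟨(orderM F).add_mem hx hy, Valuation.map_add_lt _ hx' hy'⟩
  algebraMap_mem' := by
    intro r
    refine ⟨(orderM F).algebraMap_mem r, ?_⟩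
    rw [Matrix.algebraMap_matrix_apply]
    simp

variable {F}

/-- The Jacobson radical `𝔓` of an order `𝔘`, as an `𝔬_F`-submodule of `M₂(F)`. -/
def radical (𝔘 : Subalgebra 𝒪[F] (Matrix (Fin 2) (Fin 2) F)) :
    Submodule 𝒪[F] (Matrix (Fin 2) (Fin 2) F) :=
  ((Ring.jacobson 𝔘).restrictScalars 𝒪[F]).map 𝔘.val.toLinearMap

/-- The unit group `U_𝔘 = 𝔘ˣ` of an order `𝔘`, as a subgroup of `GL₂(F)`. -/
def unitGroup (𝔘 : Subalgebra 𝒪[F] (Matrix (Fin 2) (Fin 2) F)) : Subgroup (GL (Fin 2) F) where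
  carrier := {g | g.val ∈ 𝔘 ∧ (g⁻¹).val ∈ 𝔘}
  one_mem' := by simp [one_mem]
  mul_mem' := by
    rintro a b ⟨ha, ha'⟩ ⟨hb, hb'⟩
    refine ⟨?_, ?_⟩
    · rw [Units.val_mul]
      exact mul_mem ha hb
    · rw [mul_inv_rev, Units.val_mul]
      exact mul_mem hb' ha'
  inv_mem' := by
    rintro a ⟨ha, ha'⟩
    exact ⟨ha', by simpa using ha⟩

/-- The group `U_𝔘^i` of the units `g ∈ U_𝔘` with `g - 1 ∈ 𝔓^i`. For `i ≥ 1` this is `1 + 𝔓^i`,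
because `𝔘 𝔓^i = 𝔓^i` and because `1 + x` is a unit of `𝔘` for all `x ∈ 𝔓`. For `i = 0` it is
`U_𝔘`: the zeroth power of `𝔓` is to be read as `𝔘`, which is why the powers are multiplied
by `𝔘`. -/
def unitFiltration (𝔘 : Subalgebra 𝒪[F] (Matrix (Fin 2) (Fin 2) F)) (i : ℕ) :
    Subgroup (GL (Fin 2) F) where
  carrier := {g | g ∈ unitGroup 𝔘 ∧ g.val - 1 ∈ Subalgebra.toSubmodule 𝔘 * radical 𝔘 ^ i}
  one_mem' := ⟨one_mem _, by simp⟩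
  mul_mem' := by
    rintro a b ⟨ha, ha'⟩ ⟨hb, hb'⟩
    refine ⟨mul_mem ha hb, ?_⟩
    have h : a.val * (b.val - 1) ∈
        Subalgebra.toSubmodule 𝔘 * (Subalgebra.toSubmodule 𝔘 * radical 𝔘 ^ i) :=
      Submodule.mul_mem_mul ha.1 hb'
    rw [← mul_assoc, 𝔘.isIdempotentElem_toSubmodule.eq] at h
    have e : (a * b).val - 1 = a.val * (b.val - 1) + (a.val - 1) := by
      rw [Units.val_mul, mul_sub, mul_one, sub_add_sub_cancel]
    rw [e]
    exact add_mem h ha'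
  inv_mem' := by
    rintro a ⟨ha, ha'⟩
    refine ⟨inv_mem ha, ?_⟩
    have h : (a⁻¹).val * (a.val - 1) ∈
        Subalgebra.toSubmodule 𝔘 * (Subalgebra.toSubmodule 𝔘 * radical 𝔘 ^ i) :=
      Submodule.mul_mem_mul ha.2 ha'
    rw [← mul_assoc, 𝔘.isIdempotentElem_toSubmodule.eq] at h
    have e : (a⁻¹).val - 1 = -((a⁻¹).val * (a.val - 1)) := by
      rw [mul_sub, Units.inv_mul, mul_one, neg_sub]
    rw [e]
    exact neg_mem h

/-- The image of `Eˣ` in `GL₂(F)` under an embedding of the `F`-algebra `E` in `M₂(F)`. -/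
def fieldUnits {E : Type*} [Field E] [Algebra F E]
    (φ : E →ₐ[F] Matrix (Fin 2) (Fin 2) F) : Subgroup (GL (Fin 2) F) :=
  (Units.map (φ : E →* Matrix (Fin 2) (Fin 2) F)).range

/-- The group `Eˣ U_𝔘^i`, i.e. the subgroup of `GL₂(F)` generated by `Eˣ` and `U_𝔘^i`. It is the
set of the products `x u` with `x ∈ Eˣ`, `u ∈ U_𝔘^i` when `Eˣ` normalizes `U_𝔘`. -/
def inducingGroup {E : Type*} [Field E] [Algebra F E]
    (φ : E →ₐ[F] Matrix (Fin 2) (Fin 2) F)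
    (𝔘 : Subalgebra 𝒪[F] (Matrix (Fin 2) (Fin 2) F)) (i : ℕ) : Subgroup (GL (Fin 2) F) :=
  fieldUnits φ ⊔ unitFiltration 𝔘 i

variable (F) in
/-- The extension `E/F` of local fields (of finite degree) is unramified: `𝔭_F` generates the
maximal ideal of the ring of integers of `E`, which is the integral closure of `𝔬_F` in `E`.
(The residue fields are finite, so that the residue extension is separable.) -/
def IsUnramifiedExt [TopologicalSpace F] [IsNonarchimedeanLocalField F]
    (E : Type*) [Field E] [Algebra F E] : Prop :=
  (Ideal.map (algebraMap 𝒪[F] (integralClosure 𝒪[F] E)) 𝓂[F]).IsMaximal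

end ChainOrders

end PadicGLTwo

end

open PadicGLTwo

/-! The formal dimension of a unitary completion of an irreducible c-Ind_J^G Λ is dim Λ / vol(J/Z)
(`inducedFormalDimension_of_volModCenter`). This holds for any open J containing the center, of
finite volume modulo the center and with G/J countable. What remains is the volume of J/Z.

Formal dimension. Let δ : W → c-Ind_J^G Λ be the embedding of Λ as the functions supported on J.
Nothing is known about the inner product on c-Ind except its invariance, and admissibility is not
available. But c-Ind is irreducible of countable dimension, so Schur's lemma holds for it in
Dixmier's form (`exists_eq_smul_of_rank_le_aleph0`). With Frobenius reciprocity it follows that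
invariant sesquilinear forms are multiples of the inner product (`exists_eq_mul_inner_single`,
`exists_eq_mul_inner`). Hence δ(W) is orthogonal to the functions vanishing at 1
(`inner_single_eq`), and the matrix coefficients of vectors of δ(W) vanish off J. So all
coefficients of c-Ind are square-integrable modulo Z, and the integral of a product of two of them
is an invariant form in either pair of variables, hence a constant times the product of the inner
products. The constant is found by summing over an orthonormal basis of δ(W): by Parseval the sum of
the |(π(g)δw₀, e_k)|² is ‖δw₀‖² on J and 0 elsewhere (`schur_relations_cInd`). Fatou's lemma and
continuity extend the relations to the whole Hilbert space (`schur_relations_of_denseRange`).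

Volume. Let K = GL₂(𝔬). Comparing J and ZK in G/Z gives vol(J/Z)·[K : J ∩ K] = [J : J ∩
ZK]·vol(ZK/Z) (`volModCenter_mul_relIndex`). The index [J : J ∩ ZK] is 1 if 𝔘 = 𝓜 and 2 if 𝔘 = 𝓙,
where the parity of the valuation of the determinant separates the cosets. For [K : J ∩ K] one
chooses t ∈ Eˣ whose image generates the radical of 𝔘: a uniformizer ϖ of F for 𝓜, and any t whose
norm is a uniformizer of F for 𝓙. Such a t exists because E/F is not unramified
(`exists_valuation_det_eq`). Then J ∩ U_𝔘 is the product of the units of the order of E by U_𝔘^i,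
and the indices in the unit filtrations of 𝔘 and of E are powers of additive indices, which are
counted in the residue field (`IsFieldUniformizer.relIndex_inducingGroup`). -/

namespace PadicGLTwo

/-! ### Schur's lemma in countable dimension -/

section Schur

variable {G V : Type*} [Group G] [AddCommGroup V] [Module ℂ V] {ρ : Representation ℂ G V}

theorem eq_bot_or_eq_top_of_isIrreducible (hρ : ρ.IsIrreducible) (N : Submodule ℂ V)
    (hN : ∀ g, ∀ v ∈ N, ρ g v ∈ N) : N = ⊥ ∨ N = ⊤ := by
  rcases hρ.eq_bot_or_eq_top ⟨N, fun g v hv => hN g v hv⟩ with h | h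
  · left
    exact congrArg Subrepresentation.toSubmodule h
  · right
    exact congrArg Subrepresentation.toSubmodule h

theorem nontrivial_of_isIrreducible (hρ : ρ.IsIrreducible) : Nontrivial V := by
  by_contra h
  rw [not_nontrivial_iff_subsingleton] at h
  obtain ⟨a, b, hab⟩ := hρ.toNontrivial
  apply hab
  have : a.toSubmodule = b.toSubmodule := Subsingleton.elim _ _
  cases a; cases b; simp_all

/-- A nonzero endomorphism of an irreducible representation is bijective. -/
theorem bijective_of_isIrreducible (hρ : ρ.IsIrreducible) (T : V →ₗ[ℂ] V)
    (hT : ∀ g v, T (ρ g v) = ρ g (T v)) (h0 : T ≠ 0) : Function.Bijective T := by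
  constructor
  · rw [← LinearMap.ker_eq_bot]
    refine (eq_bot_or_eq_top_of_isIrreducible hρ (LinearMap.ker T) ?_).resolve_right ?_
    · intro g v hv
      rw [LinearMap.mem_ker] at hv ⊢
      rw [hT, hv, map_zero]
    · rwa [LinearMap.ker_eq_top]
  · rw [← LinearMap.range_eq_top]
    refine (eq_bot_or_eq_top_of_isIrreducible hρ (LinearMap.range T) ?_).resolve_left ?_
    · rintro g _ ⟨v, rfl⟩
      exact ⟨ρ g v, hT g v⟩
    · rwa [LinearMap.range_eq_bot]

-- Dixmier's argument: if T is not a scalar, every T - a is bijective, so every nonzero polynomial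
-- in T is injective. Then for v ≠ 0 the vectors (T - a)⁻¹ v with a ∈ ℂ are linearly independent,
-- and there are uncountably many of them.
open Polynomial in
theorem exists_eq_smul_of_rank_le_aleph0 (hρ : ρ.IsIrreducible)
    (hV : Module.rank ℂ V ≤ Cardinal.aleph0) (T : V →ₗ[ℂ] V)
    (hT : ∀ g v, T (ρ g v) = ρ g (T v)) : ∃ c : ℂ, ∀ v, T v = c • v := by
  by_contra! hc
  have hne : ∀ a : ℂ, T - algebraMap ℂ (Module.End ℂ V) a ≠ 0 := by
    intro a h
    obtain ⟨v, hv⟩ := hc a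
    apply hv
    have := LinearMap.congr_fun h v
    simpa [sub_eq_zero, Module.algebraMap_end_apply] using this
  have hbij : ∀ a : ℂ, Function.Bijective (T - algebraMap ℂ (Module.End ℂ V) a) := by
    intro a
    refine bijective_of_isIrreducible hρ _ ?_ (hne a)
    intro g v
    simp [hT, Module.algebraMap_end_apply]
  have hpoly : ∀ p : ℂ[X], p ≠ 0 → Function.Injective (aeval T p) := by
    intro p hp
    rw [(IsAlgClosed.splits p).eq_prod_roots]
    have h1 : ∀ s : Multiset ℂ, Function.Injective
        (aeval T (s.map (fun a => X - C a)).prod) := by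
      intro s
      induction s using Multiset.induction_on with
      | empty =>
        rw [Multiset.map_zero, Multiset.prod_zero, map_one]
        exact Function.injective_id
      | cons a s ih =>
        rw [Multiset.map_cons, Multiset.prod_cons, map_mul]
        have : (aeval T (X - C a)) = T - algebraMap ℂ (Module.End ℂ V) a := by simp
        rw [this]
        exact (hbij a).1.comp ih
    intro x y hxy
    simp only [map_mul, aeval_C, Module.End.mul_apply, Module.algebraMap_end_apply] at hxy
    have := smul_right_injective V (leadingCoeff_ne_zero.2 hp) hxy
    exact h1 _ this
  obtain ⟨v, hv⟩ := @exists_ne V (nontrivial_of_isIrreducible hρ) 0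
  choose R hR using fun a => (hbij a).2 v
  have hli : LinearIndependent ℂ R := by
    classical
    refine linearIndependent_iff'.2 fun s m hm i hi => ?_
    by_contra hmi
    -- This is the numerator of ∑ m_i / (X - i), so p(T) v is the product of the T - j applied to ∑
    -- m_i R_i = 0. At i only one summand of p survives.
    let p : ℂ[X] := ∑ i ∈ s, C (m i) * ∏ j ∈ s.erase i, (X - C j)
    have hpi : p.eval i ≠ 0 := by
      simp only [p, eval_finsetSum, eval_mul, eval_C, eval_prod, eval_sub, eval_X]
      rw [Finset.sum_eq_single i]
      · refine mul_ne_zero hmi (Finset.prod_ne_zero_iff.2 fun j hj => ?_)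
        rw [sub_ne_zero]
        exact (Finset.ne_of_mem_erase hj).symm
      · intro j hj hji
        rw [Finset.prod_eq_zero (Finset.mem_erase.2 ⟨hji.symm, hi⟩) (sub_self i), mul_zero]
      · intro h
        exact absurd hi h
    have hp : p ≠ 0 := by
      rintro h
      simp [h] at hpi
    refine hv (hpoly p hp ?_)
    rw [map_zero]
    have h2 := congrArg (aeval T (∏ j ∈ s, (X - C j))) hm
    rw [map_zero, map_sum] at h2
    rw [← h2]
    simp only [p, map_sum, LinearMap.sum_apply]
    refine Finset.sum_congr rfl fun i hi => ?_
    rw [map_mul, map_smul, aeval_C, Module.End.mul_apply, Module.algebraMap_end_apply,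
      ← Finset.prod_erase_mul _ _ hi, map_mul, Module.End.mul_apply]
    congr 2
    have := hR i
    simpa using this.symm
  have h3 := hli.cardinal_lift_le_rank
  rw [Cardinal.mk_complex, Cardinal.lift_continuum] at h3
  have h4 := h3.trans (Cardinal.lift_le.2 hV)
  rw [Cardinal.lift_aleph0] at h4
  exact absurd h4 (not_le.2 Cardinal.aleph0_lt_continuum)

end Schur

/-! ### Compact induction and Frobenius reciprocity -/

section Induction

universe u v

variable {G : Type u} [Group G] [TopologicalSpace G] [IsTopologicalGroup G] {J : Subgroup G}
  {W : Type v} [AddCommGroup W] [Module ℂ W] {Λ : Representation ℂ J W}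

@[simp]
theorem cInd_apply (x : G) (f : cIndSpace J Λ) (g : G) : (cInd J Λ x f).1 g = f.1 (g * x) := rfl

theorem cIndSpace_left (f : cIndSpace J Λ) (j : J) (g : G) : f.1 (j * g) = Λ j (f.1 g) :=
  f.2.1 j g

open Classical in
/-- The embedding of `Λ` in `c-Ind_J^G Λ` as the space of the functions supported on `J`. -/
noncomputable def cIndSingle (hJ : IsOpen (J : Set G)) (hΛ : IsSmoothRep Λ) :
    W →ₗ[ℂ] cIndSpace J Λ where
  toFun w := ⟨fun g => if h : g ∈ J then Λ ⟨g, h⟩ w else 0, by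
    refine ⟨fun j g => ?_, ?_, {1}, isCompact_singleton, ?_⟩
    · dsimp only
      by_cases h : g ∈ J
      · rw [dif_pos h, dif_pos (mul_mem j.2 h), ← Module.End.mul_apply, ← map_mul]
        rfl
      · rw [dif_neg h, dif_neg (by rwa [Subgroup.mul_mem_cancel_left J j.2]), map_zero]
    · obtain ⟨K, hK, hKw⟩ := hΛ w
      refine ⟨K.map J.subtype, ?_, ?_⟩
      · rw [Subgroup.coe_map]
        exact hJ.isOpenMap_subtype_val _ hK
      · rintro g _ ⟨k, hk, rfl⟩
        dsimp only
        by_cases h : g ∈ J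
        · have h' : g * J.subtype k ∈ J := mul_mem h k.2
          rw [dif_pos h, dif_pos h', show (⟨g * J.subtype k, h'⟩ : J) = ⟨g, h⟩ * k from rfl,
            map_mul, Module.End.mul_apply, hKw k hk]
        · rw [dif_neg h, dif_neg]
          rwa [Subgroup.subtype_apply, Subgroup.mul_mem_cancel_right J k.2]
    · intro g hg
      rw [Set.mul_singleton]
      refine ⟨g, ?_, mul_one g⟩
      by_contra h
      exact hg (dif_neg h)⟩
  map_add' a b := by
    ext g
    by_cases h : g ∈ J <;> simp [h]
  map_smul' a b := by
    ext g
    by_cases h : g ∈ J <;> simp [h]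

variable (hJ : IsOpen (J : Set G)) (hΛ : IsSmoothRep Λ)

theorem cIndSingle_apply_of_mem (w : W) {g : G} (h : g ∈ J) :
    (cIndSingle hJ hΛ w).1 g = Λ ⟨g, h⟩ w := dif_pos h

theorem cIndSingle_apply_of_notMem (w : W) {g : G} (h : g ∉ J) :
    (cIndSingle hJ hΛ w).1 g = 0 := dif_neg h

@[simp]
theorem cIndSingle_apply_one (w : W) : (cIndSingle hJ hΛ w).1 1 = w := by
  rw [cIndSingle_apply_of_mem hJ hΛ w (one_mem J)]
  have : (⟨1, one_mem J⟩ : J) = 1 := rfl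
  rw [this, map_one, Module.End.one_apply]

theorem cIndSingle_injective : Function.Injective (cIndSingle hJ hΛ) := by
  intro a b h
  rw [← cIndSingle_apply_one hJ hΛ a, h, cIndSingle_apply_one]

theorem cInd_cIndSingle (j : J) (w : W) :
    cInd J Λ j (cIndSingle hJ hΛ w) = cIndSingle hJ hΛ (Λ j w) := by
  ext g
  rw [cInd_apply]
  by_cases h : g ∈ J
  · have h' : g * j ∈ J := mul_mem h j.2
    rw [cIndSingle_apply_of_mem _ _ _ h, cIndSingle_apply_of_mem _ _ _ h',
      show (⟨g * j, h'⟩ : J) = ⟨g, h⟩ * j from rfl, map_mul, Module.End.mul_apply]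
  · rw [cIndSingle_apply_of_notMem _ _ _ h, cIndSingle_apply_of_notMem]
    rwa [Subgroup.mul_mem_cancel_right J j.2]

theorem exists_ne_zero_of_isIrreducible_cInd (h : (cInd J Λ).IsIrreducible) :
    ∃ w : W, w ≠ 0 := by
  obtain ⟨f, hf⟩ := @exists_ne _ (nontrivial_of_isIrreducible h) 0
  by_contra! hw
  exact hf (Subtype.ext (funext fun g => hw _))

theorem span_translates_eq_top (h : (cInd J Λ).IsIrreducible) :
    Submodule.span ℂ {f | ∃ g w, cInd J Λ g (cIndSingle hJ hΛ w) = f} = ⊤ := by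
  refine (eq_bot_or_eq_top_of_isIrreducible h _ ?_).resolve_left ?_
  · intro g v hv
    induction hv using Submodule.span_induction with
    | mem x hx =>
      obtain ⟨g', w, rfl⟩ := hx
      exact Submodule.subset_span ⟨g * g', w, by rw [map_mul]; rfl⟩
    | zero => simp
    | add x y _ _ hx hy => rw [map_add]; exact add_mem hx hy
    | smul a x _ hx => rw [map_smul]; exact Submodule.smul_mem _ _ hx
  · obtain ⟨w, hw⟩ := exists_ne_zero_of_isIrreducible_cInd h
    intro h0
    have : cInd J Λ 1 (cIndSingle hJ hΛ w) ∈
        Submodule.span ℂ {f | ∃ g w, cInd J Λ g (cIndSingle hJ hΛ w) = f} :=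
      Submodule.subset_span ⟨1, w, rfl⟩
    rw [h0, Submodule.mem_bot, map_one, Module.End.one_apply] at this
    exact hw (cIndSingle_injective hJ hΛ (by rw [this, map_zero]))

/-- The translates of δ(W) span, and since δ is J-equivariant one translate for each coset in the
countable set G/J is enough. -/
theorem rank_cIndSpace_le (hJ : IsOpen (J : Set G)) (hΛ : IsSmoothRep Λ) [Countable (G ⧸ J)]
    [FiniteDimensional ℂ W]
    (h : (cInd J Λ).IsIrreducible) :
    Module.rank ℂ (cIndSpace J Λ) ≤ Cardinal.aleph0 := by
  let b := Module.finBasis ℂ W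
  let S : Set (cIndSpace J Λ) := Set.range fun p : (G ⧸ J) × Fin (Module.finrank ℂ W) =>
    cInd J Λ p.1.out (cIndSingle hJ hΛ (b p.2))
  have hS : Submodule.span ℂ S = ⊤ := by
    rw [eq_top_iff, ← span_translates_eq_top hJ hΛ h, Submodule.span_le]
    rintro _ ⟨g, w, rfl⟩
    obtain ⟨j, hj⟩ := QuotientGroup.mk_out_eq_mul J g
    have hg : g = (g : G ⧸ J).out * (j⁻¹ : J) := by rw [hj]; simp
    rw [hg, map_mul, Module.End.mul_apply, cInd_cIndSingle]
    generalize (Λ j⁻¹) w = w'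
    rw [← b.sum_repr w', map_sum, map_sum]
    refine sum_mem fun k _ => ?_
    rw [map_smul, map_smul]
    exact Submodule.smul_mem _ _ (Submodule.subset_span ⟨(_, k), rfl⟩)
  rw [← rank_top, ← hS]
  exact (rank_span_le S).trans (Cardinal.mk_le_aleph0_iff.2 (Set.countable_range _).to_subtype)

/-- If the support lies in JC with C compact, the image of C⁻¹ in the discrete space G/J is compact,
hence finite. The inverse appears because f transforms under J on the left, while G/J consists of
left cosets. -/
theorem finite_support_cInd (hJ : IsOpen (J : Set G)) (f : cIndSpace J Λ) :
    {x : G ⧸ J | f.1 x.out⁻¹ ≠ 0}.Finite := by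
  obtain ⟨f, -, -, C, hC, hf⟩ := f
  have : DiscreteTopology (G ⧸ J) := QuotientGroup.discreteTopology hJ
  have h1 : IsCompact ((fun g : G => (g : G ⧸ J)) '' C⁻¹) :=
    hC.inv.image QuotientGroup.continuous_mk
  refine h1.finite_of_discrete.subset ?_
  intro x hx
  obtain ⟨j, hj, c, hc, hjc⟩ := hf hx
  refine ⟨c⁻¹, by simpa using hc, ?_⟩
  rw [← QuotientGroup.out_eq' x]
  apply QuotientGroup.eq.2
  have : x.out = c⁻¹ * j⁻¹ := by
    rw [← inv_inj]
    simpa using hjc.symm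
  rw [this]
  simpa using hj

/-- Frobenius reciprocity. -/
theorem exists_cInd_hom (hJ : IsOpen (J : Set G)) (hΛ : IsSmoothRep Λ)
    (A : W →ₗ[ℂ] cIndSpace J Λ)
    (hA : ∀ (j : J) w, A (Λ j w) = cInd J Λ j (A w)) :
    ∃ T : cIndSpace J Λ →ₗ[ℂ] cIndSpace J Λ, (∀ g f, T (cInd J Λ g f) = cInd J Λ g (T f)) ∧
      ∀ w, T (cIndSingle hJ hΛ w) = A w := by
  -- The extension of A is f ↦ ∑ x·A(f(x⁻¹)) over x ∈ G/J; the summand depends only on the coset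
  -- because A is J-equivariant.
  let t : cIndSpace J Λ → G → cIndSpace J Λ := fun f g => cInd J Λ g (A (f.1 g⁻¹))
  have ht : ∀ f g, ∀ j ∈ J, t f (g * j) = t f g := by
    intro f g j hj
    have h1 : f.1 (g * j)⁻¹ = Λ (⟨j, hj⟩⁻¹ : J) (f.1 g⁻¹) := by
      rw [← cIndSpace_left]
      simp
    simp only [t]
    rw [h1, hA, map_mul, Module.End.mul_apply, ← Module.End.mul_apply, ← Module.End.mul_apply,
      ← map_mul, ← map_mul]
    congr 3
    simp
  have ht' : ∀ f g, t f (QuotientGroup.mk (s := J) g).out = t f g := by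
    intro f g
    obtain ⟨j, hj⟩ := QuotientGroup.mk_out_eq_mul J g
    rw [hj, ht f g j j.2]
  have hfin : ∀ f, (Function.support fun x : G ⧸ J => t f x.out).Finite := by
    intro f
    refine (finite_support_cInd hJ f).subset ?_
    intro x hx h0
    apply hx
    simp [t, h0]
  let T : cIndSpace J Λ →ₗ[ℂ] cIndSpace J Λ :=
    { toFun := fun f => ∑ᶠ x : G ⧸ J, t f x.out
      map_add' := by
        intro f f'
        rw [← finsum_add_distrib (hfin f) (hfin f')]
        refine finsum_congr fun x => ?_
        simp [t]
      map_smul' := by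
        intro a f
        rw [RingHom.id_apply, smul_finsum]
        refine finsum_congr fun x => ?_
        simp [t] }
  have hTapp : ∀ f, T f = ∑ᶠ x : G ⧸ J, t f x.out := fun f => rfl
  refine ⟨T, ?_, ?_⟩
  · intro g f
    rw [hTapp, hTapp]
    have e1 : cInd J Λ g (∑ᶠ x : G ⧸ J, t f x.out) = ∑ᶠ x : G ⧸ J, cInd J Λ g (t f x.out) :=
      (cInd J Λ g).toAddMonoidHom.map_finsum (hfin f)
    rw [e1, ← finsum_comp_equiv (MulAction.toPerm g : Equiv.Perm (G ⧸ J))]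
    refine finsum_congr fun x => ?_
    have h2 : (MulAction.toPerm g : Equiv.Perm (G ⧸ J)) x = ((g * x.out : G) : G ⧸ J) := by
      conv_lhs => rw [← QuotientGroup.out_eq' x]
      rfl
    rw [h2, ht']
    simp only [t]
    rw [← Module.End.mul_apply, ← map_mul, cInd_apply]
    congr 3
    simp
  · intro w
    rw [hTapp, finsum_eq_single _ ((1 : G) : G ⧸ J)]
    · rw [ht']
      simp only [t]
      rw [inv_one, cIndSingle_apply_one, map_one, Module.End.one_apply]
    · intro x hx
      have : x.out ∉ J := by
        intro h
        apply hx
        rw [← QuotientGroup.out_eq' x]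
        apply QuotientGroup.eq.2
        simpa using h
      simp only [t]
      rw [cIndSingle_apply_of_notMem, map_zero, map_zero]
      simpa using this

end Induction


/-! ### Indices of open subgroups from Haar measure -/

section Index

open MeasureTheory

variable {Q : Type*} [Group Q] [TopologicalSpace Q] [IsTopologicalGroup Q] [MeasurableSpace Q]
  [BorelSpace Q] (μ : Measure Q) [μ.IsMulLeftInvariant] [μ.IsOpenPosMeasure]

/-- An open subgroup has finite index in every larger subgroup of finite measure. -/
theorem relIndex_ne_zero_and_measure_eq {H J : Subgroup Q} (hHJ : H ≤ J)
    (hH : IsOpen (H : Set Q)) (hfin : μ J ≠ ⊤ ∨ H.relIndex J ≠ 0) :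
    H.relIndex J ≠ 0 ∧ μ J = H.relIndex J * μ H := by
  let C : J ⧸ H.subgroupOf J → Set Q := fun x => (x.out : Q) • (H : Set Q)
  have hμC : ∀ x, μ (C x) = μ H := fun x => measure_smul _ _ _
  have hmeas : ∀ x, MeasurableSet (C x) := fun x => (hH.smul _).measurableSet
  have hdisj : Pairwise (Function.onFun Disjoint C) := by
    intro x y hxy
    refine Set.disjoint_left.2 ?_
    rintro _ ⟨a, ha, rfl⟩ ⟨b, hb, hab⟩
    apply hxy
    rw [← QuotientGroup.out_eq' x, ← QuotientGroup.out_eq' y]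
    apply QuotientGroup.eq.2
    rw [Subgroup.mem_subgroupOf]
    have h1 : (y.out : Q) * b = x.out * a := hab
    have h2 : ((x.out⁻¹ * y.out : J) : Q) = a * b⁻¹ := by
      rw [Subgroup.coe_mul, Subgroup.coe_inv, eq_mul_inv_iff_mul_eq, mul_assoc, h1,
        inv_mul_cancel_left]
    rw [h2]
    exact mul_mem ha (inv_mem hb)
  have hunion : ⋃ x, C x = J := by
    ext g
    simp only [Set.mem_iUnion]
    constructor
    · rintro ⟨x, a, ha, rfl⟩
      exact mul_mem x.out.2 (hHJ ha)
    · intro hg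
      obtain ⟨h, hh⟩ := QuotientGroup.mk_out_eq_mul (H.subgroupOf J) ⟨g, hg⟩
      refine ⟨QuotientGroup.mk ⟨g, hg⟩, (h : J)⁻¹, inv_mem h.2, ?_⟩
      simp [hh]
  have hpos : 0 < μ H := hH.measure_pos μ ⟨1, one_mem H⟩
  -- A set of finite measure contains only finitely many disjoint translates of H, since they all
  -- have the same positive measure.
  have hf : Finite (J ⧸ H.subgroupOf J) := by
    obtain hfin | hfin := hfin
    · have := Measure.finite_const_le_meas_of_disjoint_iUnion μ hpos hmeas hdisj
        (by rwa [hunion])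
      simp only [hμC, le_refl, Set.ofPred_true] at this
      exact Set.finite_univ_iff.1 this
    · exact (Nat.card_ne_zero.1 hfin).2
  refine ⟨?_, ?_⟩
  · have : (H.subgroupOf J).FiniteIndex := Subgroup.finiteIndex_of_finite_quotient
    exact this.index_ne_zero
  · rw [← hunion, measure_iUnion hdisj hmeas]
    simp only [hμC]
    rw [ENNReal.tsum_const, ENat.card_eq_coe_natCard]
    rfl

end Index

theorem volModCenter_eq {G : Type*} [Group G]
    [MeasurableSpace (G ⧸ Subgroup.center G)]
    (μ : MeasureTheory.Measure (G ⧸ Subgroup.center G)) (J : Subgroup G) :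
    volModCenter μ J = μ (J.map (QuotientGroup.mk' (Subgroup.center G)) : Set _) := rfl

theorem isOpen_map_mk {G : Type*} [Group G] [TopologicalSpace G]
    [IsTopologicalGroup G] {K : Subgroup G} (hK : IsOpen (K : Set G)) :
    IsOpen (K.map (QuotientGroup.mk' (Subgroup.center G)) : Set (G ⧸ Subgroup.center G)) :=
  QuotientGroup.isOpenMap_coe _ hK

theorem inner_map_left {G H : Type*} [Group G] [NormedAddCommGroup H] [InnerProductSpace ℂ H]
    (π : G →* (H ≃ₗᵢ[ℂ] H)) (g : G) (x y : H) :
    ⟪π g x, y⟫_ℂ = ⟪x, π g⁻¹ y⟫_ℂ := by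
  rw [← LinearIsometryEquiv.inner_map_map (π g) x (π g⁻¹ y), map_inv,
    LinearIsometryEquiv.inv_def, LinearIsometryEquiv.apply_symm_apply]

/-! ### Uniqueness of the invariant inner product on c-Ind -/

section Hilbert

universe u v w

variable {G : Type u} [Group G] [TopologicalSpace G] [IsTopologicalGroup G] {J : Subgroup G}
  {W : Type v} [AddCommGroup W] [Module ℂ W] [FiniteDimensional ℂ W] {Λ : Representation ℂ J W}

theorem cInd_center_smul [Countable (G ⧸ J)] (hJ : IsOpen (J : Set G)) (hΛ : IsSmoothRep Λ)
    (h : (cInd J Λ).IsIrreducible) (z : G) (hz : z ∈ Subgroup.center G) :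
    ∃ c : ℂ, ∀ f, cInd J Λ z f = c • f := by
  refine exists_eq_smul_of_rank_le_aleph0 h (rank_cIndSpace_le hJ hΛ h) _ fun g v => ?_
  rw [← Module.End.mul_apply, ← Module.End.mul_apply, ← map_mul, ← map_mul,
    Subgroup.mem_center_iff.1 hz g]

variable [MeasurableSpace (G ⧸ Subgroup.center G)] [BorelSpace (G ⧸ Subgroup.center G)]
  (μ : MeasureTheory.Measure (G ⧸ Subgroup.center G)) [μ.IsHaarMeasure]

/-- This replaces admissibility. The vector f is fixed by an open subgroup K, and the center acts by
scalars, so Z(K ∩ J) acts on f by scalars. As J/Z has finite volume, finitely many J-translates of f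
span a J-stable space. -/
theorem exists_finiteDimensional_stable [Countable (G ⧸ J)] (hJ : IsOpen (J : Set G))
    (hΛ : IsSmoothRep Λ) (h : (cInd J Λ).IsIrreducible) (hfin : volModCenter μ J ≠ ⊤)
    (f : cIndSpace J Λ) :
    ∃ N : Submodule ℂ (cIndSpace J Λ), FiniteDimensional ℂ N ∧ f ∈ N ∧
      ∀ j ∈ J, ∀ v ∈ N, cInd J Λ j v ∈ N := by
  obtain ⟨-, ⟨K, hK, hKf⟩, -⟩ := f.2
  let p := QuotientGroup.mk' (Subgroup.center G)
  let L : Subgroup G := ((K ⊓ J).map p).comap p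
  have hL : ∀ l ∈ L, ∃ c : ℂ, cInd J Λ l f = c • f := by
    rintro l ⟨k, hk, hkl⟩
    have hz : k⁻¹ * l ∈ Subgroup.center G := QuotientGroup.eq.1 hkl
    obtain ⟨c, hc⟩ := cInd_center_smul hJ hΛ h _ hz
    refine ⟨c, ?_⟩
    rw [← mul_inv_cancel_left k l, map_mul, Module.End.mul_apply, hc, map_smul]
    congr 1
    ext g
    exact hKf g k hk.1
  have hfi : L.relIndex J ≠ 0 := by
    rw [Subgroup.relIndex_comap]
    exact (relIndex_ne_zero_and_measure_eq μ (Subgroup.map_mono inf_le_right)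
      (isOpen_map_mk (hK.inter hJ)) (Or.inl hfin)).1
  have : (L.subgroupOf J).FiniteIndex := ⟨hfi⟩
  let S : Set (cIndSpace J Λ) :=
    Set.range fun x : J ⧸ L.subgroupOf J => cInd J Λ (x.out : J) f
  have hS : ∀ j ∈ J, cInd J Λ j f ∈ Submodule.span ℂ S := by
    intro j hj
    obtain ⟨l, hl⟩ := QuotientGroup.mk_out_eq_mul (L.subgroupOf J) ⟨j, hj⟩
    obtain ⟨c, hc⟩ := hL ((l : J)⁻¹ : J) (inv_mem (Subgroup.mem_subgroupOf.1 l.2))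
    have hjj : j = (Quotient.out (QuotientGroup.mk (s := L.subgroupOf J) ⟨j, hj⟩) : J) *
        ((l : J)⁻¹ : J) := by
      rw [hl]
      simp
    rw [hjj, map_mul, Module.End.mul_apply, hc, map_smul]
    exact Submodule.smul_mem _ _ (Submodule.subset_span ⟨_, rfl⟩)
  refine ⟨Submodule.span ℂ S, FiniteDimensional.span_of_finite ℂ (Set.finite_range _), ?_, ?_⟩
  · simpa using hS 1 (one_mem J)
  · intro j hj v hv
    induction hv using Submodule.span_induction with
    | mem x hx =>
      obtain ⟨x, rfl⟩ := hx
      dsimp only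
      rw [← Module.End.mul_apply, ← map_mul]
      exact hS _ (mul_mem hj x.out.2)
    | zero => simp
    | add x y _ _ hx hy => rw [map_add]; exact add_mem hx hy
    | smul a x _ hx => rw [map_smul]; exact Submodule.smul_mem _ _ hx

variable {H : Type w} [NormedAddCommGroup H] [InnerProductSpace ℂ H]

/-- Riesz representation on a finite-dimensional subspace. -/
theorem exists_mem_inner_eq {V : Type*} [AddCommGroup V] [Module ℂ V] {ι : V →ₗ[ℂ] H}
    (hι : Function.Injective ι) (N : Submodule ℂ V) [FiniteDimensional ℂ N] (l : V →ₗ[ℂ] ℂ) :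
    ∃ a ∈ N, ∀ v ∈ N, ⟪ι a, ι v⟫_ℂ = l v := by
  let e : N ≃ₗ[ℂ] N.map ι := Submodule.equivMapOfInjective ι hι N
  have : FiniteDimensional ℂ (N.map ι) := e.finiteDimensional
  have : CompleteSpace (N.map ι) := FiniteDimensional.complete ℂ _
  let l' : StrongDual ℂ (N.map ι) :=
    LinearMap.toContinuousLinearMap (l ∘ₗ N.subtype ∘ₗ e.symm.toLinearMap)
  let a := (InnerProductSpace.toDual ℂ (N.map ι)).symm l'
  refine ⟨e.symm a, (e.symm a).2, fun v hv => ?_⟩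
  have h1 : ⟪a, e ⟨v, hv⟩⟫_ℂ = l' (e ⟨v, hv⟩) := InnerProductSpace.toDual_symm_apply
  have h2 : l' (e ⟨v, hv⟩) = l v := by simp [l']
  have h3 : ((e (e.symm a) : N.map ι) : H) = ι (e.symm a) :=
    Submodule.coe_equivMapOfInjective_apply ι hι N _
  rw [← h2, ← h1, ← h3, LinearEquiv.apply_symm_apply]
  rfl

variable [Countable (G ⧸ J)] (hJ : IsOpen (J : Set G)) (hΛ : IsSmoothRep Λ)
  (hirr : (cInd J Λ).IsIrreducible) (hfin : volModCenter μ J ≠ ⊤)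
  {π : G →* (H ≃ₗᵢ[ℂ] H)} {ι : cIndSpace J Λ →ₗ[ℂ] H} (hι : Function.Injective ι)
  (hπ : ∀ g f, ι (cInd J Λ g f) = π g (ι f))

include hJ hΛ hirr hfin hι hπ

/-- On a finite-dimensional J-stable space N containing δ(W) and v, Riesz turns S into a J-map from
W to N. Frobenius reciprocity extends it to an endomorphism of c-Ind, which is a scalar by Schur's
lemma. -/
theorem exists_eq_mul_inner_single (S : W → cIndSpace J Λ →ₗ[ℂ] ℂ)
    (hadd : ∀ w w' v, S (w + w') v = S w v + S w' v)
    (hsmul : ∀ (c : ℂ) w v, S (c • w) v = (starRingEnd ℂ) c * S w v)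
    (hinv : ∀ (j : J) w v, S (Λ j w) (cInd J Λ j v) = S w v) :
    ∃ c : ℂ, ∀ w v, S w v = c * ⟪ι (cIndSingle hJ hΛ w), ι v⟫_ℂ := by
  obtain ⟨w₀, hw₀⟩ := exists_ne_zero_of_isIrreducible_cInd hirr
  set δ := cIndSingle hJ hΛ with hδ
  have hne : ⟪ι (δ w₀), ι (δ w₀)⟫_ℂ ≠ 0 := by
    rw [Ne, inner_self_eq_zero, map_eq_zero_iff ι hι,
      map_eq_zero_iff _ (cIndSingle_injective hJ hΛ)]
    exact hw₀
  -- The scalar could depend on v through N. Requiring it to work at δ w₀ as well forces the scalars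
  -- for all v to agree.
  suffices hs : ∀ v, ∃ c : ℂ, ∀ w, S w v = c * ⟪ι (δ w), ι v⟫_ℂ ∧
      S w (δ w₀) = c * ⟪ι (δ w), ι (δ w₀)⟫_ℂ by
    obtain ⟨c, hc⟩ := hs (δ w₀)
    refine ⟨c, fun w v => ?_⟩
    obtain ⟨c', hc'⟩ := hs v
    have : c = c' := mul_right_cancel₀ hne ((hc w₀).2.symm.trans (hc' w₀).2)
    rw [this]
    exact (hc' w).1
  intro v
  obtain ⟨N₁, hN₁, hv, hN₁J⟩ := exists_finiteDimensional_stable μ hJ hΛ hirr hfin v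
  let N := N₁ ⊔ LinearMap.range δ
  have hNJ : ∀ j ∈ J, ∀ v ∈ N, cInd J Λ j v ∈ N := by
    intro j hj v hv
    obtain ⟨a, ha, _, ⟨w, rfl⟩, rfl⟩ := Submodule.mem_sup.1 hv
    rw [map_add]
    refine add_mem (Submodule.mem_sup_left (hN₁J j hj a ha)) (Submodule.mem_sup_right ?_)
    exact ⟨Λ ⟨j, hj⟩ w, (cInd_cIndSingle hJ hΛ ⟨j, hj⟩ w).symm⟩
  choose A hAN hA using fun w => exists_mem_inner_eq hι N (S w)
  have huniq : ∀ a ∈ N, ∀ b ∈ N, (∀ v ∈ N, ⟪ι a, ι v⟫_ℂ = ⟪ι b, ι v⟫_ℂ) → a = b := by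
    intro a ha b hb hab
    rw [← sub_eq_zero, ← map_eq_zero_iff ι hι, ← inner_self_eq_zero (𝕜 := ℂ), map_sub,
      inner_sub_left, ← map_sub, hab _ (sub_mem ha hb), sub_self]
  let A' : W →ₗ[ℂ] cIndSpace J Λ :=
    { toFun := A
      map_add' := fun a b => huniq _ (hAN _) _ (add_mem (hAN _) (hAN _)) fun v hv => by
        rw [hA _ v hv, hadd, map_add, inner_add_left, hA _ v hv, hA _ v hv]
      map_smul' := fun c a => huniq _ (hAN _) _ (Submodule.smul_mem _ _ (hAN _)) fun v hv => by
        rw [hA _ v hv, hsmul, map_smul, inner_smul_left, hA _ v hv, RingHom.id_apply] }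
  obtain ⟨T, hT, hTA⟩ := exists_cInd_hom hJ hΛ A' (by
    intro j w
    refine huniq _ (hAN _) _ (hNJ _ j.2 _ (hAN _)) fun v hv => ?_
    rw [hA _ v hv, hπ, inner_map_left, ← hπ]
    have h1 : cInd J Λ (j : G)⁻¹ v ∈ N := hNJ _ (inv_mem j.2) _ hv
    have h2 : ⟪ι (A' w), ι (cInd J Λ (j : G)⁻¹ v)⟫_ℂ = S w (cInd J Λ (j : G)⁻¹ v) := hA w _ h1
    rw [h2, ← hinv j w, ← Module.End.mul_apply, ← map_mul]
    simp)
  obtain ⟨c, hc⟩ := exists_eq_smul_of_rank_le_aleph0 hirr (rank_cIndSpace_le hJ hΛ hirr) T hT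
  have key : ∀ w, ∀ u ∈ N, S w u = (starRingEnd ℂ) c * ⟪ι (δ w), ι u⟫_ℂ := by
    intro w u hu
    have h1 : A w = c • δ w := by rw [← hc, hTA]; rfl
    rw [← hA w u hu, h1, map_smul, inner_smul_left]
  exact ⟨_, fun w => ⟨key w v (Submodule.mem_sup_left hv),
    key w _ (Submodule.mem_sup_right ⟨w₀, rfl⟩)⟩⟩

/-- The J-invariant form (w, v) ↦ ⟨δ w, δ(v(1))⟩ is a multiple of ⟨δ w, v⟩, and both have the same
nonzero value for w = w₀, v = δ w₀. In particular δ(W) is orthogonal to every function vanishing at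
1. -/
theorem inner_single_eq (w : W) (v : cIndSpace J Λ) :
    ⟪ι (cIndSingle hJ hΛ w), ι v⟫_ℂ =
      ⟪ι (cIndSingle hJ hΛ w), ι (cIndSingle hJ hΛ (v.1 1))⟫_ℂ := by
  obtain ⟨w₀, hw₀⟩ := exists_ne_zero_of_isIrreducible_cInd hirr
  let ev : cIndSpace J Λ →ₗ[ℂ] W := LinearMap.proj (1 : G) ∘ₗ (cIndSpace J Λ).subtype
  have hev : ∀ v, ev v = v.1 1 := fun _ => rfl
  obtain ⟨c, hc⟩ := exists_eq_mul_inner_single μ hJ hΛ hirr hfin hι hπ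
    (fun w => (innerSL ℂ (ι (cIndSingle hJ hΛ w))).toLinearMap ∘ₗ ι ∘ₗ cIndSingle hJ hΛ ∘ₗ ev)
    (by intro w w' v; simp) (by intro c w v; simp)
    (by
      intro j w v
      have : ev (cInd J Λ j v) = Λ j (ev v) := by
        rw [hev, hev, cInd_apply, one_mul, ← cIndSpace_left, mul_one]
      simp only [LinearMap.comp_apply]
      rw [this, ← cInd_cIndSingle, ← cInd_cIndSingle, hπ, hπ]
      simp)
  simp only [LinearMap.comp_apply, hev, ContinuousLinearMap.coe_coe, innerSL_apply_apply] at hc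
  have h1 := hc w₀ (cIndSingle hJ hΛ w₀)
  rw [cIndSingle_apply_one] at h1
  have hne : ⟪ι (cIndSingle hJ hΛ w₀), ι (cIndSingle hJ hΛ w₀)⟫_ℂ ≠ 0 := by
    rw [Ne, inner_self_eq_zero, map_eq_zero_iff ι hι,
      map_eq_zero_iff _ (cIndSingle_injective hJ hΛ)]
    exact hw₀
  have h2 : c = 1 := mul_right_cancel₀ hne (by rw [← h1, one_mul])
  rw [hc, h2, one_mul]

theorem inner_single_translate_eq_zero (w w' : W) {g : G} (hg : g ∉ J) :
    ⟪ι (cIndSingle hJ hΛ w), π g (ι (cIndSingle hJ hΛ w'))⟫_ℂ = 0 := by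
  rw [← hπ, inner_single_eq μ hJ hΛ hirr hfin hι hπ, cInd_apply, one_mul,
    cIndSingle_apply_of_notMem hJ hΛ w' hg, map_zero, map_zero, inner_zero_right]

/-- Two invariant sesquilinear forms on an irreducible `c-Ind_J^G Λ` are proportional. -/
theorem exists_eq_mul_inner (S : cIndSpace J Λ → cIndSpace J Λ →ₗ[ℂ] ℂ)
    (hadd : ∀ u u' v, S (u + u') v = S u v + S u' v)
    (hsmul : ∀ (c : ℂ) u v, S (c • u) v = (starRingEnd ℂ) c * S u v)
    (hinv : ∀ g u v, S (cInd J Λ g u) (cInd J Λ g v) = S u v) :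
    ∃ c : ℂ, ∀ u v, S u v = c * ⟪ι u, ι v⟫_ℂ := by
  obtain ⟨c, hc⟩ := exists_eq_mul_inner_single μ hJ hΛ hirr hfin hι hπ
    (fun w => S (cIndSingle hJ hΛ w)) (fun w w' v => by rw [map_add, hadd])
    (fun c w v => by rw [map_smul, hsmul]) (fun j w v => by rw [← cInd_cIndSingle, hinv])
  refine ⟨c, fun u v => ?_⟩
  have hu : u ∈ Submodule.span ℂ {f | ∃ g w, cInd J Λ g (cIndSingle hJ hΛ w) = f} := by
    rw [span_translates_eq_top hJ hΛ hirr]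
    trivial
  induction hu using Submodule.span_induction with
  | mem x hx =>
    obtain ⟨g, w, rfl⟩ := hx
    have hv : v = cInd J Λ g (cInd J Λ g⁻¹ v) := by
      rw [← Module.End.mul_apply, ← map_mul]
      simp
    rw [hπ, inner_map_left, ← hπ, ← hc, ← hinv g (cIndSingle hJ hΛ w), ← hv]
  | zero =>
    have := hsmul 0 0 v
    rw [zero_smul, map_zero, zero_mul] at this
    rw [this, map_zero, inner_zero_left, mul_zero]
  | add x y _ _ hx hy => rw [hadd, hx, hy, map_add, inner_add_left, mul_add]
  | smul a x _ hx =>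
    rw [hsmul, hx, map_smul, inner_smul_left]
    ring

end Hilbert


/-- An additive bounded function that vanishes on a dense set vanishes. -/
theorem eq_zero_of_denseRange {V H : Type*} [NormedAddCommGroup H] {ι : V → H}
    (hι : DenseRange ι) {f : H → ℂ}
    (hadd : ∀ a b, f (a + b) = f a + f b) {C : ℝ} (hC : ∀ a, ‖f a‖ ≤ C * ‖a‖)
    (h0 : ∀ v, f (ι v) = 0) (a : H) : f a = 0 := by
  have hsub : ∀ a b, f (a - b) = f a - f b := by
    intro a b
    rw [eq_sub_iff_add_eq, ← hadd, sub_add_cancel]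
  have hcont : Continuous f := by
    refine continuous_iff_continuousAt.2 fun b => ?_
    rw [ContinuousAt, tendsto_iff_norm_sub_tendsto_zero]
    have h1 : Filter.Tendsto (fun a => C * ‖a - b‖) (nhds b) (nhds 0) := by
      have : Continuous fun a => C * ‖a - b‖ := by fun_prop
      simpa using this.tendsto b
    exact squeeze_zero (fun _ => norm_nonneg _) (fun a => by rw [← hsub]; exact hC _) h1
  exact congrFun (hι.equalizer hcont continuous_const (funext h0)) a

/-! ### Matrix coefficients modulo the center -/

section Coefficients

open MeasureTheory ComplexConjugate

variable {G H : Type*} [Group G] [NormedAddCommGroup H] [InnerProductSpace ℂ H]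

/-- The product of a matrix coefficient of `π` with the conjugate of another one. -/
noncomputable def coeffProd (π : G →* (H ≃ₗᵢ[ℂ] H)) (y y' x x' : H)
    (z : G ⧸ Subgroup.center G) : ℂ :=
  ⟪y, π z.out x⟫_ℂ * conj ⟪y', π z.out x'⟫_ℂ

/-- The center acts by scalars. -/
def HasCentralCharacter (π : G →* (H ≃ₗᵢ[ℂ] H)) : Prop :=
  ∀ z ∈ Subgroup.center G, ∃ c : ℂ, ∀ x, π z x = c • x

variable {π : G →* (H ≃ₗᵢ[ℂ] H)}

/-- The chosen representative differs from g by a central element acting through a scalar c. If x ≠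
0 then |c| = 1, and c cancels against its conjugate. -/
theorem coeffProd_mk (hZ : HasCentralCharacter π) (y y' x x' : H) (g : G) :
    coeffProd π y y' x x' (g : G ⧸ Subgroup.center G) =
      ⟪y, π g x⟫_ℂ * conj ⟪y', π g x'⟫_ℂ := by
  obtain ⟨z, hz⟩ := QuotientGroup.mk_out_eq_mul (Subgroup.center G) g
  obtain ⟨c, hc⟩ := hZ z z.2
  rw [coeffProd, hz, map_mul, LinearIsometryEquiv.coe_mul, Function.comp_apply,
    Function.comp_apply, hc, hc, map_smul, map_smul, inner_smul_right, inner_smul_right, map_mul]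
  by_cases hx : x = 0
  · simp [hx]
  have h1 : ‖c‖ = 1 := by
    have := (π z).norm_map x
    rw [hc, norm_smul] at this
    exact mul_right_cancel₀ (norm_ne_zero_iff.2 hx) (by rw [this, one_mul])
  have h2 : c * conj c = 1 := by rw [Complex.mul_conj', h1]; norm_num
  linear_combination (⟪y, π g x⟫_ℂ * conj ⟪y', π g x'⟫_ℂ) * h2

theorem norm_coeffProd_le (y y' x x' : H) (z : G ⧸ Subgroup.center G) :
    ‖coeffProd π y y' x x' z‖ ≤ ‖y‖ * ‖x‖ * (‖y'‖ * ‖x'‖) := by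
  rw [coeffProd, norm_mul, RCLike.norm_conj]
  refine mul_le_mul ?_ ?_ (norm_nonneg _) (by positivity)
  · simpa using norm_inner_le_norm (𝕜 := ℂ) y (π z.out x)
  · simpa using norm_inner_le_norm (𝕜 := ℂ) y' (π z.out x')

theorem norm_coeffProd_self (y x : H) (z : G ⧸ Subgroup.center G) :
    ‖coeffProd π y y x x z‖ = ‖⟪y, π z.out x⟫_ℂ‖ ^ 2 := by
  rw [coeffProd, norm_mul, RCLike.norm_conj, sq]

theorem coeffProd_add_right (y y' x₁ x₂ x' : H) :
    coeffProd π y y' (x₁ + x₂) x' = coeffProd π y y' x₁ x' + coeffProd π y y' x₂ x' := by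
  ext z
  simp only [coeffProd, map_add, inner_add_right, Pi.add_apply]
  ring

theorem coeffProd_add_right' (y y' x x₁ x₂ : H) :
    coeffProd π y y' x (x₁ + x₂) = coeffProd π y y' x x₁ + coeffProd π y y' x x₂ := by
  ext z
  simp only [coeffProd, map_add, inner_add_right, Pi.add_apply]
  ring

theorem coeffProd_add_left (y₁ y₂ y' x x' : H) :
    coeffProd π (y₁ + y₂) y' x x' = coeffProd π y₁ y' x x' + coeffProd π y₂ y' x x' := by
  ext z
  simp only [coeffProd, inner_add_left, Pi.add_apply]
  ring

theorem coeffProd_add_left' (y y₁ y₂ x x' : H) :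
    coeffProd π y (y₁ + y₂) x x' = coeffProd π y y₁ x x' + coeffProd π y y₂ x x' := by
  ext z
  simp only [coeffProd, map_add, inner_add_left, Pi.add_apply]
  ring

theorem coeffProd_smul_right (c : ℂ) (y y' x x' : H) :
    coeffProd π y y' (c • x) x' = c • coeffProd π y y' x x' := by
  ext z
  simp only [coeffProd, map_smul, inner_smul_right, Pi.smul_apply, smul_eq_mul]
  ring

theorem coeffProd_smul_right' (c : ℂ) (y y' x x' : H) :
    coeffProd π y y' x (c • x') = conj c • coeffProd π y y' x x' := by
  ext z
  simp only [coeffProd, map_smul, inner_smul_right, Pi.smul_apply, smul_eq_mul, map_mul]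
  ring

theorem coeffProd_smul_left (c : ℂ) (y y' x x' : H) :
    coeffProd π (c • y) y' x x' = conj c • coeffProd π y y' x x' := by
  ext z
  simp only [coeffProd, inner_smul_left, Pi.smul_apply, smul_eq_mul]
  ring

theorem coeffProd_smul_left' (c : ℂ) (y y' x x' : H) :
    coeffProd π y (c • y') x x' = c • coeffProd π y y' x x' := by
  ext z
  simp only [coeffProd, inner_smul_left, Pi.smul_apply, smul_eq_mul, map_mul, Complex.conj_conj]
  ring

theorem coeffProd_map_right (hZ : HasCentralCharacter π) (y y' x x' : H) (a : G)
    (z : G ⧸ Subgroup.center G) :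
    coeffProd π y y' (π a x) (π a x') z = coeffProd π y y' x x' (z * a) := by
  obtain ⟨g, rfl⟩ := QuotientGroup.mk_surjective z
  rw [← QuotientGroup.mk_mul, coeffProd_mk hZ, coeffProd_mk hZ, map_mul]
  rfl

theorem coeffProd_map_left (hZ : HasCentralCharacter π) (y y' x x' : H) (a : G)
    (z : G ⧸ Subgroup.center G) :
    coeffProd π (π a y) (π a y') x x' z =
      coeffProd π y y' x x' (((a⁻¹ : G) : G ⧸ Subgroup.center G) * z) := by
  obtain ⟨g, rfl⟩ := QuotientGroup.mk_surjective z
  rw [← QuotientGroup.mk_mul, coeffProd_mk hZ, coeffProd_mk hZ, map_mul, inner_map_left,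
    inner_map_left]
  rfl

variable [TopologicalSpace G] (hZ : HasCentralCharacter π)
  (hcont : ∀ x : H, Continuous fun g => π g x)

include hZ hcont in
theorem continuous_coeffProd (y y' x x' : H) : Continuous (coeffProd π y y' x x') := by
  refine (QuotientGroup.isQuotientMap_mk _).continuous_iff.2 ?_
  have : coeffProd π y y' x x' ∘ (QuotientGroup.mk : G → G ⧸ Subgroup.center G) =
      fun g => ⟪y, π g x⟫_ℂ * conj ⟪y', π g x'⟫_ℂ := funext fun g => coeffProd_mk hZ _ _ _ _ g
  rw [this]
  have h1 := hcont x
  have h2 := hcont x'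
  exact (continuous_const.inner h1).mul (Complex.continuous_conj.comp (continuous_const.inner h2))

variable [MeasurableSpace (G ⧸ Subgroup.center G)] [BorelSpace (G ⧸ Subgroup.center G)]
  (μ : Measure (G ⧸ Subgroup.center G))

variable (π) in
/-- Square-integrability of the matrix coefficient of `x` and `y`. -/
def SqIntegrable (x y : H) : Prop := Integrable (coeffProd π y y x x) μ

variable {μ}

-- A product of two coefficients is dominated by the sum of their squared absolute values.
include hZ hcont in
theorem SqIntegrable.integrable_coeffProd {x x' y y' : H} (h : SqIntegrable π μ x y)
    (h' : SqIntegrable π μ x' y') : Integrable (coeffProd π y y' x x') μ := by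
  refine (h.norm.add h'.norm).mono' (continuous_coeffProd hZ hcont _ _ _ _).aestronglyMeasurable
    (Filter.Eventually.of_forall fun z => ?_)
  rw [Pi.add_apply, norm_coeffProd_self, norm_coeffProd_self, coeffProd, norm_mul,
    RCLike.norm_conj]
  nlinarith [sq_nonneg (‖⟪y, π z.out x⟫_ℂ‖ - ‖⟪y', π z.out x'⟫_ℂ‖),
    sq_nonneg (‖⟪y, π z.out x⟫_ℂ‖), sq_nonneg ‖⟪y', π z.out x'⟫_ℂ‖]

include hZ hcont in
theorem SqIntegrable.add_left {x₁ x₂ y : H} (h₁ : SqIntegrable π μ x₁ y)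
    (h₂ : SqIntegrable π μ x₂ y) : SqIntegrable π μ (x₁ + x₂) y := by
  rw [SqIntegrable, coeffProd_add_right, coeffProd_add_right', coeffProd_add_right']
  exact ((h₁.integrable_coeffProd hZ hcont h₁).add (h₁.integrable_coeffProd hZ hcont h₂)).add
    ((h₂.integrable_coeffProd hZ hcont h₁).add (h₂.integrable_coeffProd hZ hcont h₂))

include hZ hcont in
theorem SqIntegrable.add_right {x y₁ y₂ : H} (h₁ : SqIntegrable π μ x y₁)
    (h₂ : SqIntegrable π μ x y₂) : SqIntegrable π μ x (y₁ + y₂) := by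
  rw [SqIntegrable, coeffProd_add_left, coeffProd_add_left', coeffProd_add_left']
  exact ((h₁.integrable_coeffProd hZ hcont h₁).add (h₁.integrable_coeffProd hZ hcont h₂)).add
    ((h₂.integrable_coeffProd hZ hcont h₁).add (h₂.integrable_coeffProd hZ hcont h₂))

omit [TopologicalSpace G] [BorelSpace (G ⧸ Subgroup.center G)] in
theorem SqIntegrable.smul_left {x y : H} (c : ℂ) (h : SqIntegrable π μ x y) :
    SqIntegrable π μ (c • x) y := by
  rw [SqIntegrable, coeffProd_smul_right, coeffProd_smul_right']
  exact Integrable.smul _ (Integrable.smul _ h)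

omit [TopologicalSpace G] [BorelSpace (G ⧸ Subgroup.center G)] in
theorem SqIntegrable.smul_right {x y : H} (c : ℂ) (h : SqIntegrable π μ x y) :
    SqIntegrable π μ x (c • y) := by
  rw [SqIntegrable, coeffProd_smul_left, coeffProd_smul_left']
  exact Integrable.smul _ (Integrable.smul _ h)

include hZ in
theorem SqIntegrable.map_left [IsTopologicalGroup G] [μ.IsMulRightInvariant] {x y : H} (a : G)
    (h : SqIntegrable π μ x y) : SqIntegrable π μ (π a x) y := by
  have : coeffProd π y y (π a x) (π a x) = fun z => coeffProd π y y x x (z * a) :=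
    funext fun z => coeffProd_map_right hZ _ _ _ _ _ _
  rw [SqIntegrable, this]
  exact Integrable.comp_mul_right h _

include hZ in
theorem SqIntegrable.map_right [IsTopologicalGroup G] [μ.IsMulLeftInvariant] {x y : H} (a : G)
    (h : SqIntegrable π μ x y) : SqIntegrable π μ x (π a y) := by
  have : coeffProd π (π a y) (π a y) x x =
      fun z => coeffProd π y y x x (((a⁻¹ : G) : G ⧸ Subgroup.center G) * z) :=
    funext fun z => coeffProd_map_left hZ _ _ _ _ _ _
  rw [SqIntegrable, this]
  exact Integrable.comp_mul_left h _

include hZ hcont in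
/-- Schur's relations extend from a dense subspace. -/
theorem schur_relations_of_denseRange {V : Type*} {ι : V → H} (hι : DenseRange ι) {C : ℝ}
    (hint : ∀ x y, SqIntegrable π μ (ι x) (ι y))
    (hS : ∀ x x' y y', ∫ z, coeffProd π (ι y) (ι y') (ι x) (ι x') z ∂μ =
      C * (⟪ι x', ι x⟫_ℂ * conj ⟪ι y', ι y⟫_ℂ)) (x x' y y' : H) :
    Integrable (coeffProd π y y' x x') μ ∧ ∫ z, coeffProd π y y' x x' z ∂μ =
      C * (⟪x', x⟫_ℂ * conj ⟪y', y⟫_ℂ) := by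
  -- Fatou's lemma along sequences from the dense subspace bounds the L² norm of every coefficient,
  -- and so makes all integrals below converge.
  have hl : ∀ x y : H, ∫⁻ z, ‖coeffProd π y y x x z‖ₑ ∂μ ≤
      ENNReal.ofReal (C * (‖x‖ ^ 2 * ‖y‖ ^ 2)) := by
    have hV : ∀ x y, ∫⁻ z, ‖coeffProd π (ι y) (ι y) (ι x) (ι x) z‖ₑ ∂μ =
        ENNReal.ofReal (C * (‖ι x‖ ^ 2 * ‖ι y‖ ^ 2)) := by
      intro x y
      rw [← ofReal_integral_norm_eq_lintegral_enorm (hint x y)]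
      congr 1
      have h1 := hS x x y y
      have h2 : ∀ z, coeffProd π (ι y) (ι y) (ι x) (ι x) z =
          ((‖coeffProd π (ι y) (ι y) (ι x) (ι x) z‖ : ℝ) : ℂ) := by
        intro z
        rw [norm_coeffProd_self, coeffProd, Complex.mul_conj']
        push_cast
        rfl
      rw [integral_congr_ae (Filter.Eventually.of_forall h2), integral_complex_ofReal,
        inner_self_eq_norm_sq_to_K, inner_self_eq_norm_sq_to_K] at h1
      have h3 : ((∫ z, ‖coeffProd π (ι y) (ι y) (ι x) (ι x) z‖ ∂μ : ℝ) : ℂ) =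
          ((C * (‖ι x‖ ^ 2 * ‖ι y‖ ^ 2) : ℝ) : ℂ) := by
        rw [h1]
        simp
      exact_mod_cast h3
    intro x y
    obtain ⟨a, ha, hax⟩ := mem_closure_iff_seq_limit.1 (hι x)
    obtain ⟨b, hb, hby⟩ := mem_closure_iff_seq_limit.1 (hι y)
    choose a' ha' using ha
    choose b' hb' using hb
    have hlim : ∀ z, Filter.Tendsto (fun n => ‖coeffProd π (b n) (b n) (a n) (a n) z‖ₑ)
        Filter.atTop (nhds ‖coeffProd π y y x x z‖ₑ) := by
      intro z
      have h1 : Filter.Tendsto (fun n => π z.out (a n)) Filter.atTop (nhds (π z.out x)) :=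
        ((π z.out).continuous.tendsto x).comp hax
      exact ((hby.inner h1).mul ((Complex.continuous_conj.tendsto _).comp
        (hby.inner h1))).enorm
    have hlim2 : Filter.Tendsto (fun n => ENNReal.ofReal (C * (‖a n‖ ^ 2 * ‖b n‖ ^ 2)))
        Filter.atTop (nhds (ENNReal.ofReal (C * (‖x‖ ^ 2 * ‖y‖ ^ 2)))) :=
      ENNReal.tendsto_ofReal (((hax.norm.pow 2).mul (hby.norm.pow 2)).const_mul C)
    calc ∫⁻ z, ‖coeffProd π y y x x z‖ₑ ∂μ
        = ∫⁻ z, Filter.liminf (fun n => ‖coeffProd π (b n) (b n) (a n) (a n) z‖ₑ)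
            Filter.atTop ∂μ := lintegral_congr fun z => (hlim z).liminf_eq.symm
      _ ≤ Filter.liminf (fun n => ∫⁻ z, ‖coeffProd π (b n) (b n) (a n) (a n) z‖ₑ ∂μ)
            Filter.atTop := lintegral_liminf_le fun n =>
              (continuous_coeffProd hZ hcont _ _ _ _).measurable.enorm
      _ = ENNReal.ofReal (C * (‖x‖ ^ 2 * ‖y‖ ^ 2)) := by
          rw [← hlim2.liminf_eq]
          congr 1
          ext n
          rw [← ha', ← hb', hV]
  have hint' : ∀ x y : H, SqIntegrable π μ x y := fun x y =>
    ⟨(continuous_coeffProd hZ hcont _ _ _ _).aestronglyMeasurable,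
      (hl x y).trans_lt ENNReal.ofReal_lt_top⟩
  have hI : ∀ x x' y y' : H, Integrable (coeffProd π y y' x x') μ := fun x x' y y' =>
    (hint' x y).integrable_coeffProd hZ hcont (hint' x' y')
  refine ⟨hI x x' y y', ?_⟩
  have hn : ∀ x y : H, ∫ z, ‖coeffProd π y y x x z‖ ∂μ ≤ |C| * (‖x‖ ^ 2 * ‖y‖ ^ 2) := by
    intro x y
    rw [integral_norm_eq_lintegral_enorm
      (continuous_coeffProd hZ hcont _ _ _ _).aestronglyMeasurable]
    refine ENNReal.toReal_le_of_le_ofReal (by positivity) ((hl x y).trans ?_)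
    refine ENNReal.ofReal_le_ofReal ?_
    exact mul_le_mul_of_nonneg_right (le_abs_self C) (by positivity)
  have hB1 : ∀ x x' y y' : H, ‖∫ z, coeffProd π y y' x x' z ∂μ‖ ≤
      |C| * (‖x‖ ^ 2 * ‖y‖ ^ 2) + |C| * (‖x'‖ ^ 2 * ‖y'‖ ^ 2) := by
    intro x x' y y'
    refine (norm_integral_le_integral_norm _).trans ?_
    refine le_trans ?_ (add_le_add (hn x y) (hn x' y'))
    rw [← integral_add (hint' x y).norm (hint' x' y').norm]
    refine integral_mono (hI _ _ _ _).norm ((hint' x y).norm.add (hint' x' y').norm) fun z => ?_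
    simp only [norm_coeffProd_self]
    rw [coeffProd, norm_mul, RCLike.norm_conj]
    nlinarith [sq_nonneg (‖⟪y, π z.out x⟫_ℂ‖ - ‖⟪y', π z.out x'⟫_ℂ‖),
      sq_nonneg (‖⟪y, π z.out x⟫_ℂ‖), sq_nonneg ‖⟪y', π z.out x'⟫_ℂ‖]
  -- Φ is the defect in Schur's relation. It is additive in each variable and, with the other three
  -- fixed, bounded on unit vectors; so it can be shown to vanish one variable at a time by density.
  let Φ : H → H → H → H → ℂ := fun x x' y y' =>
    ∫ z, coeffProd π y y' x x' z ∂μ - C * (⟪x', x⟫_ℂ * conj ⟪y', y⟫_ℂ)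
  let K : H → H → H → H → ℝ := fun x x' y y' =>
    |C| * (‖x‖ ^ 2 * ‖y‖ ^ 2) + |C| * (‖x'‖ ^ 2 * ‖y'‖ ^ 2) +
      |C| * (‖x'‖ * ‖x‖ * (‖y'‖ * ‖y‖))
  have hΦK : ∀ x x' y y', ‖Φ x x' y y'‖ ≤ K x x' y y' := by
    intro x x' y y'
    refine (norm_sub_le _ _).trans (add_le_add (hB1 x x' y y') ?_)
    rw [norm_mul, norm_mul, RCLike.norm_conj, Complex.norm_real, Real.norm_eq_abs]
    gcongr
    · exact norm_inner_le_norm _ _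
    · exact norm_inner_le_norm _ _
  -- The bound K is not homogeneous in a single variable. Scaling by a real number to norm one
  -- converts it into a linear bound.
  have hscale : ∀ f : H → ℂ, (∀ (c : ℝ) a, ‖f ((c : ℂ) • a)‖ = |c| * ‖f a‖) → ∀ M : ℝ,
      (∀ a, ‖a‖ = 1 → ‖f a‖ ≤ M) → ∀ a, ‖f a‖ ≤ M * ‖a‖ := by
    intro f hf M hM a
    by_cases ha : a = 0
    · have := hf 0 0
      simp only [Complex.ofReal_zero, zero_smul, abs_zero, zero_mul] at this
      rw [ha, this, norm_zero, mul_zero]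
    · have hna : 0 < ‖a‖ := norm_pos_iff.2 ha
      have h1 := hM (((‖a‖⁻¹ : ℝ) : ℂ) • a) (by
        rw [norm_smul, Complex.norm_real, norm_inv, norm_norm, inv_mul_cancel₀ hna.ne'])
      rw [hf, abs_of_pos (inv_pos.2 hna), inv_mul_le_iff₀ hna] at h1
      linarith
  have e1 : ∀ x x' y y', (∀ v, Φ (ι v) x' y y' = 0) → Φ x x' y y' = 0 := by
    intro x x' y y' h
    refine eq_zero_of_denseRange hι (f := fun x => Φ x x' y y') ?_ (hscale _ ?_
      (|C| * (1 ^ 2 * ‖y‖ ^ 2) + |C| * (‖x'‖ ^ 2 * ‖y'‖ ^ 2) +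
      |C| * (‖x'‖ * 1 * (‖y'‖ * ‖y‖))) ?_) h x
    · intro a b
      simp only [Φ]
      rw [coeffProd_add_right, integral_add' (hI _ _ _ _) (hI _ _ _ _), inner_add_right]
      ring
    · intro c a
      have : Φ ((c : ℂ) • a) x' y y' = c * Φ a x' y y' := by
        simp only [Φ]
        rw [coeffProd_smul_right, inner_smul_right]
        simp only [Pi.smul_apply]
        rw [integral_smul, smul_eq_mul]
        ring
      rw [this, norm_mul, Complex.norm_real, Real.norm_eq_abs]
    · intro a ha
      have := hΦK a x' y y'
      simp only [K, ha] at this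
      exact this
  have e2 : ∀ x x' y y', (∀ v, Φ x (ι v) y y' = 0) → Φ x x' y y' = 0 := by
    intro x x' y y' h
    refine eq_zero_of_denseRange hι (f := fun x' => Φ x x' y y') ?_ (hscale _ ?_
      (|C| * (‖x‖ ^ 2 * ‖y‖ ^ 2) + |C| * (1 ^ 2 * ‖y'‖ ^ 2) +
      |C| * (1 * ‖x‖ * (‖y'‖ * ‖y‖))) ?_) h x'
    · intro a b
      simp only [Φ]
      rw [coeffProd_add_right', integral_add' (hI _ _ _ _) (hI _ _ _ _), inner_add_left]
      ring
    · intro c a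
      have : Φ x ((c : ℂ) • a) y y' = c * Φ x a y y' := by
        simp only [Φ]
        rw [coeffProd_smul_right', inner_smul_left, Complex.conj_ofReal]
        simp only [Pi.smul_apply]
        rw [integral_smul, smul_eq_mul]
        ring
      rw [this, norm_mul, Complex.norm_real, Real.norm_eq_abs]
    · intro a ha
      have := hΦK x a y y'
      simp only [K, ha] at this
      exact this
  have e3 : ∀ x x' y y', (∀ v, Φ x x' (ι v) y' = 0) → Φ x x' y y' = 0 := by
    intro x x' y y' h
    refine eq_zero_of_denseRange hι (f := fun y => Φ x x' y y') ?_ (hscale _ ?_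
      (|C| * (‖x‖ ^ 2 * 1 ^ 2) + |C| * (‖x'‖ ^ 2 * ‖y'‖ ^ 2) +
      |C| * (‖x'‖ * ‖x‖ * (‖y'‖ * 1))) ?_) h y
    · intro a b
      simp only [Φ]
      rw [coeffProd_add_left, integral_add' (hI _ _ _ _) (hI _ _ _ _), inner_add_right, map_add]
      ring
    · intro c a
      have : Φ x x' ((c : ℂ) • a) y' = c * Φ x x' a y' := by
        simp only [Φ]
        rw [coeffProd_smul_left, inner_smul_right, map_mul, Complex.conj_ofReal]
        simp only [Pi.smul_apply]
        rw [integral_smul, smul_eq_mul]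
        ring
      rw [this, norm_mul, Complex.norm_real, Real.norm_eq_abs]
    · intro a ha
      have := hΦK x x' a y'
      simp only [K, ha] at this
      exact this
  have e4 : ∀ x x' y y', (∀ v, Φ x x' y (ι v) = 0) → Φ x x' y y' = 0 := by
    intro x x' y y' h
    refine eq_zero_of_denseRange hι (f := fun y' => Φ x x' y y') ?_ (hscale _ ?_
      (|C| * (‖x‖ ^ 2 * ‖y‖ ^ 2) + |C| * (‖x'‖ ^ 2 * 1 ^ 2) +
      |C| * (‖x'‖ * ‖x‖ * (1 * ‖y‖))) ?_) h y'
    · intro a b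
      simp only [Φ]
      rw [coeffProd_add_left', integral_add' (hI _ _ _ _) (hI _ _ _ _), inner_add_left, map_add]
      ring
    · intro c a
      have : Φ x x' y ((c : ℂ) • a) = c * Φ x x' y a := by
        simp only [Φ]
        rw [coeffProd_smul_left', inner_smul_left, map_mul, Complex.conj_conj]
        simp only [Pi.smul_apply]
        rw [integral_smul, smul_eq_mul]
        ring
      rw [this, norm_mul, Complex.norm_real, Real.norm_eq_abs]
    · intro a ha
      have := hΦK x x' y a
      simp only [K, ha] at this
      exact this
  have : Φ x x' y y' = 0 := e1 _ _ _ _ fun a => e2 _ _ _ _ fun a' => e3 _ _ _ _ fun b =>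
    e4 _ _ _ _ fun b' => sub_eq_zero.2 (hS a a' b b')
  exact sub_eq_zero.1 this

end Coefficients


/-! ### Schur's relations on c-Ind and the value of the formal dimension -/

section FormalDimension

open MeasureTheory ComplexConjugate

universe u v w

variable {G : Type u} [Group G] [TopologicalSpace G] [IsTopologicalGroup G] {J : Subgroup G}
  {W : Type v} [AddCommGroup W] [Module ℂ W] [FiniteDimensional ℂ W] {Λ : Representation ℂ J W}
  [MeasurableSpace (G ⧸ Subgroup.center G)] [BorelSpace (G ⧸ Subgroup.center G)]
  (μ : MeasureTheory.Measure (G ⧸ Subgroup.center G)) [μ.IsHaarMeasure] [μ.IsMulRightInvariant]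
  {H : Type w} [NormedAddCommGroup H] [InnerProductSpace ℂ H]
  [Countable (G ⧸ J)] (hJ : IsOpen (J : Set G)) (hΛ : IsSmoothRep Λ)
  (hirr : (cInd J Λ).IsIrreducible) (hfin : volModCenter μ J ≠ ⊤)
  {π : G →* (H ≃ₗᵢ[ℂ] H)} {ι : cIndSpace J Λ →ₗ[ℂ] H} (hι : Function.Injective ι)
  (hπ : ∀ g f, ι (cInd J Λ g f) = π g (ι f)) (hcont : ∀ x : H, Continuous fun g => π g x)
  (hZ : HasCentralCharacter π) (hZJ : Subgroup.center G ≤ J)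

omit [IsTopologicalGroup G] [MeasurableSpace (G ⧸ Subgroup.center G)]
  [TopologicalSpace G] [BorelSpace (G ⧸ Subgroup.center G)] [Countable (G ⧸ J)] in
include hZJ in
theorem mk_mem_map_iff (g : G) :
    (g : G ⧸ Subgroup.center G) ∈ J.map (QuotientGroup.mk' (Subgroup.center G)) ↔ g ∈ J := by
  constructor
  · rintro ⟨j, hj, hjg⟩
    have := hZJ (QuotientGroup.eq.1 hjg)
    exact (Subgroup.mul_mem_cancel_left J (inv_mem hj)).1 this
  · intro hg
    exact ⟨g, hg, rfl⟩

omit [FiniteDimensional ℂ W] [MeasurableSpace (G ⧸ Subgroup.center G)]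
  [BorelSpace (G ⧸ Subgroup.center G)] in
theorem hasCentralCharacter_of_denseRange [FiniteDimensional ℂ W] (hJ : IsOpen (J : Set G))
    (hΛ : IsSmoothRep Λ) (hirr : (cInd J Λ).IsIrreducible)
    (hπ : ∀ g f, ι (cInd J Λ g f) = π g (ι f)) (hd : DenseRange ι) :
    HasCentralCharacter π := by
  intro z hz
  obtain ⟨c, hc⟩ := cInd_center_smul hJ hΛ hirr z hz
  refine ⟨c, fun x => ?_⟩
  refine congrFun (hd.equalizer (π z).continuous (continuous_const_smul c) (funext fun f => ?_)) x
  simp only [Function.comp_apply]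
  rw [← hπ, hc, map_smul]

include hJ hΛ hirr hfin hι hπ hcont hZ hZJ

-- The coefficient is bounded and vanishes outside the image of J, which has finite volume.
omit [μ.IsMulRightInvariant] in
theorem sqIntegrable_single (w w' : W) :
    SqIntegrable π μ (ι (cIndSingle hJ hΛ w)) (ι (cIndSingle hJ hΛ w')) := by
  rw [SqIntegrable]
  set s : Set (G ⧸ Subgroup.center G) :=
    (J.map (QuotientGroup.mk' (Subgroup.center G)) : Set (G ⧸ Subgroup.center G)) with hs
  have hsupp : Function.support (coeffProd π (ι (cIndSingle hJ hΛ w')) (ι (cIndSingle hJ hΛ w'))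
      (ι (cIndSingle hJ hΛ w)) (ι (cIndSingle hJ hΛ w))) ⊆ s := by
    intro z hz
    obtain ⟨g, rfl⟩ := QuotientGroup.mk_surjective z
    by_contra hg
    rw [hs, SetLike.mem_coe, mk_mem_map_iff hZJ] at hg
    apply hz
    rw [coeffProd_mk hZ, inner_single_translate_eq_zero μ hJ hΛ hirr hfin hι hπ _ _ hg, zero_mul]
  rw [← integrableOn_iff_integrable_of_support_subset hsupp]
  refine Measure.integrableOn_of_bounded
    (M := ‖ι (cIndSingle hJ hΛ w')‖ * ‖ι (cIndSingle hJ hΛ w)‖ *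
    (‖ι (cIndSingle hJ hΛ w')‖ * ‖ι (cIndSingle hJ hΛ w)‖)) hfin
    (continuous_coeffProd hZ hcont _ _ _ _).aestronglyMeasurable
    (Filter.Eventually.of_forall fun z => norm_coeffProd_le _ _ _ _ _)

/-- Square-integrability passes from δ(W) to its translates by the left and right invariance of μ,
and then to their span, first in one variable and then in the other. -/
theorem sqIntegrable_cInd (f f' : cIndSpace J Λ) : SqIntegrable π μ (ι f) (ι f') := by
  have hmem : ∀ f, f ∈ Submodule.span ℂ {f | ∃ g w, cInd J Λ g (cIndSingle hJ hΛ w) = f} := by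
    intro f
    rw [span_translates_eq_top hJ hΛ hirr]
    trivial
  have h0 : ∀ w, SqIntegrable π μ (ι f) (ι (cIndSingle hJ hΛ w)) := by
    intro w
    have hs := sqIntegrable_single μ hJ hΛ hirr hfin hι hπ hcont hZ hZJ
    induction hmem f using Submodule.span_induction with
    | mem x hx =>
      obtain ⟨g, w', rfl⟩ := hx
      rw [hπ]
      exact (hs w' w).map_left hZ g
    | zero => simpa using (hs 0 w)
    | add x y _ _ hx hy => rw [map_add]; exact hx.add_left hZ hcont hy
    | smul a x _ hx => rw [map_smul]; exact hx.smul_left a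
  induction hmem f' using Submodule.span_induction with
  | mem x hx =>
    obtain ⟨g, w', rfl⟩ := hx
    rw [hπ]
    exact (h0 w').map_right hZ g
  | zero => simpa using (h0 0)
  | add x y _ _ hx hy => rw [map_add]; exact hx.add_right hZ hcont hy
  | smul a x _ hx => rw [map_smul]; exact hx.smul_right a

/-- The integral is an invariant form in (f', f) for fixed h, h', and in (h, h') for f = f' = δ w₀.
Both are multiples of the inner product, so a single constant is left to determine. -/
theorem schur_relations_cInd (f f' h h' : cIndSpace J Λ) :
    ∫ z, coeffProd π (ι h) (ι h') (ι f) (ι f') z ∂μ =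
      (((volModCenter μ J).toReal / Module.finrank ℂ W : ℝ) : ℂ) *
        (⟪ι f', ι f⟫_ℂ * conj ⟪ι h', ι h⟫_ℂ) := by
  obtain ⟨w₀, hw₀⟩ := exists_ne_zero_of_isIrreducible_cInd hirr
  set δ := cIndSingle hJ hΛ with hδ
  have hne : ⟪ι (δ w₀), ι (δ w₀)⟫_ℂ ≠ 0 := by
    rw [Ne, inner_self_eq_zero, map_eq_zero_iff ι hι,
      map_eq_zero_iff _ (cIndSingle_injective hJ hΛ)]
    exact hw₀
  have hI : ∀ f f' h h', Integrable (coeffProd π (ι h) (ι h') (ι f) (ι f')) μ :=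
    fun f f' h h' => SqIntegrable.integrable_coeffProd hZ hcont
      (sqIntegrable_cInd μ hJ hΛ hirr hfin hι hπ hcont hZ hZJ f h)
      (sqIntegrable_cInd μ hJ hΛ hirr hfin hι hπ hcont hZ hZJ f' h')
  have c1 : ∀ h h', ∃ c : ℂ, ∀ f' f, ∫ z, coeffProd π (ι h) (ι h') (ι f) (ι f') z ∂μ =
      c * ⟪ι f', ι f⟫_ℂ := by
    intro h h'
    refine exists_eq_mul_inner μ hJ hΛ hirr hfin hι hπ (fun f' =>
      { toFun := fun f => ∫ z, coeffProd π (ι h) (ι h') (ι f) (ι f') z ∂μ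
        map_add' := fun a b => ?_
        map_smul' := fun c a => ?_ }) (fun a b v => ?_) (fun c a v => ?_) (fun g u v => ?_)
    · rw [map_add, coeffProd_add_right, integral_add' (hI _ _ _ _) (hI _ _ _ _)]
    · rw [map_smul, coeffProd_smul_right, RingHom.id_apply, ← integral_smul]
      rfl
    · simp only [LinearMap.coe_mk, AddHom.coe_mk]
      rw [map_add, coeffProd_add_right', integral_add' (hI _ _ _ _) (hI _ _ _ _)]
    · simp only [LinearMap.coe_mk, AddHom.coe_mk]
      rw [map_smul, coeffProd_smul_right', ← smul_eq_mul, ← integral_smul]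
      rfl
    · simp only [LinearMap.coe_mk, AddHom.coe_mk, hπ]
      simp only [coeffProd_map_right hZ]
      exact integral_mul_right_eq_self _ _
  choose c hc using c1
  obtain ⟨d, hd⟩ : ∃ d : ℂ, ∀ h h', ∫ z, coeffProd π (ι h) (ι h') (ι (δ w₀)) (ι (δ w₀)) z ∂μ =
      d * ⟪ι h, ι h'⟫_ℂ := by
    refine exists_eq_mul_inner μ hJ hΛ hirr hfin hι hπ (fun h =>
      { toFun := fun h' => ∫ z, coeffProd π (ι h) (ι h') (ι (δ w₀)) (ι (δ w₀)) z ∂μ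
        map_add' := fun a b => ?_
        map_smul' := fun c a => ?_ }) (fun a b v => ?_) (fun c a v => ?_) (fun g u v => ?_)
    · rw [map_add, coeffProd_add_left', integral_add' (hI _ _ _ _) (hI _ _ _ _)]
    · rw [map_smul, coeffProd_smul_left', RingHom.id_apply, ← integral_smul]
      rfl
    · simp only [LinearMap.coe_mk, AddHom.coe_mk]
      rw [map_add, coeffProd_add_left, integral_add' (hI _ _ _ _) (hI _ _ _ _)]
    · simp only [LinearMap.coe_mk, AddHom.coe_mk]
      rw [map_smul, coeffProd_smul_left, ← smul_eq_mul, ← integral_smul]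
      rfl
    · simp only [LinearMap.coe_mk, AddHom.coe_mk, hπ]
      simp only [coeffProd_map_left hZ]
      exact integral_mul_left_eq_self _ _
  let M := LinearMap.range (ι ∘ₗ δ)
  have hM : Module.finrank ℂ M = Module.finrank ℂ W :=
    LinearMap.finrank_range_of_inj (hι.comp (cIndSingle_injective hJ hΛ))
  let b := stdOrthonormalBasis ℂ M
  have hb : ∀ k, ∃ w, ι (δ w) = b k := fun k => (b k).2
  choose e he using hb
  -- Summing over h = h' in an orthonormal basis of δ(W) produces d once for each dimension of W.
  have hsum : ∫ z, ∑ k, coeffProd π (ι (δ (e k))) (ι (δ (e k))) (ι (δ w₀)) (ι (δ w₀)) z ∂μ =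
      Module.finrank ℂ W * d := by
    rw [integral_finsetSum _ fun k _ => hI _ _ _ _]
    rw [Finset.sum_congr rfl fun k _ => hd (δ (e k)) (δ (e k))]
    simp only [he]
    have : ∀ k, ⟪(b k : H), (b k : H)⟫_ℂ = 1 := by
      intro k
      rw [← Submodule.coe_inner, inner_self_eq_norm_sq_to_K, b.orthonormal.1 k]
      simp
    simp only [this, mul_one]
    rw [Finset.sum_const, Finset.card_univ, Fintype.card_fin, hM, nsmul_eq_mul]
  -- For g ∈ J the vector π(g) δ w₀ stays in δ(W), and Parseval gives its squared norm; for g ∉ J it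
  -- is orthogonal to δ(W).
  have hsum2 : ∀ z, ∑ k, coeffProd π (ι (δ (e k))) (ι (δ (e k))) (ι (δ w₀)) (ι (δ w₀)) z =
      Set.indicator (J.map (QuotientGroup.mk' (Subgroup.center G)) : Set (G ⧸ Subgroup.center G))
        (fun _ => ⟪ι (δ w₀), ι (δ w₀)⟫_ℂ) z := by
    intro z
    obtain ⟨g, rfl⟩ := QuotientGroup.mk_surjective z
    simp only [coeffProd_mk hZ]
    by_cases hg : g ∈ J
    · rw [Set.indicator_of_mem (by rwa [SetLike.mem_coe, mk_mem_map_iff hZJ])]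
      have h1 : π g (ι (δ w₀)) = ι (δ (Λ ⟨g, hg⟩ w₀)) := by
        rw [← hπ]
        exact congrArg ι (cInd_cIndSingle hJ hΛ ⟨g, hg⟩ w₀)
      let m : M := ⟨ι (δ (Λ ⟨g, hg⟩ w₀)), ⟨_, rfl⟩⟩
      have h2 := b.sum_sq_norm_inner_right m
      have h3 : ‖m‖ = ‖ι (δ w₀)‖ := by
        change ‖ι (δ (Λ ⟨g, hg⟩ w₀))‖ = _
        rw [← h1, LinearIsometryEquiv.norm_map]
      rw [inner_self_eq_norm_sq_to_K, ← h3, h1]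
      simp only [Complex.mul_conj', he]
      have h4 : ∀ k, ⟪(b k : H), ι (δ (Λ ⟨g, hg⟩ w₀))⟫_ℂ = ⟪b k, m⟫_ℂ := fun k => rfl
      simp only [h4]
      have h5 := congrArg Complex.ofReal h2
      push_cast at h5
      exact h5
    · rw [Set.indicator_of_notMem (by rwa [SetLike.mem_coe, mk_mem_map_iff hZJ])]
      refine Finset.sum_eq_zero fun k _ => ?_
      rw [inner_single_translate_eq_zero μ hJ hΛ hirr hfin hι hπ _ _ hg, zero_mul]
  have hvol : Module.finrank ℂ W * d = (volModCenter μ J).toReal * ⟪ι (δ w₀), ι (δ w₀)⟫_ℂ := by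
    rw [← hsum, integral_congr_ae (Filter.Eventually.of_forall hsum2),
      integral_indicator (isOpen_map_mk hJ).measurableSet, setIntegral_const, Complex.real_smul]
    rfl
  have hm : (Module.finrank ℂ W : ℂ) ≠ 0 := by
    have : Nontrivial W := ⟨w₀, 0, hw₀⟩
    exact_mod_cast Module.finrank_pos.ne'
  have hd' : d = ((volModCenter μ J).toReal / Module.finrank ℂ W : ℝ) *
      ⟪ι (δ w₀), ι (δ w₀)⟫_ℂ := by
    push_cast
    field_simp
    linear_combination hvol
  have h1 := hc h h' (δ w₀) (δ w₀)
  rw [hd, hd'] at h1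
  rw [hc, inner_conj_symm]
  have h2 : c h h' = (((volModCenter μ J).toReal / Module.finrank ℂ W : ℝ) : ℂ) *
      ⟪ι h, ι h'⟫_ℂ := mul_right_cancel₀ hne (by rw [← h1]; ring)
  rw [h2]
  ring

end FormalDimension

section FormalDimension

universe u v w

/-- Formal dimension of a unitary completion of an irreducible compactly induced
representation. -/
theorem inducedFormalDimension_of_volModCenter {G : Type u} [Group G] [TopologicalSpace G]
    [IsTopologicalGroup G] {J : Subgroup G} [MeasurableSpace (G ⧸ Subgroup.center G)]
    [BorelSpace (G ⧸ Subgroup.center G)] (μ : MeasureTheory.Measure (G ⧸ Subgroup.center G))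
    [μ.IsHaarMeasure] [μ.IsMulRightInvariant] [Countable (G ⧸ J)] (hJ : IsOpen (J : Set G))
    (hZJ : Subgroup.center G ≤ J) {v d : ℝ} (hv : volModCenter μ J = ENNReal.ofReal v)
    {m : ℕ} (hd : d * v = m) : InducedFormalDimension.{u, v, w} μ J m d := by
  intro W _ _ _ Λ hΛ _ hm hirr H _ _ _ π hπ
  obtain ⟨ι, hι, hdense, hιπ⟩ := hπ.exists_embedding
  have hZ := hasCentralCharacter_of_denseRange hJ hΛ hirr hιπ hdense
  have hfin : volModCenter μ J ≠ ⊤ := by rw [hv]; exact ENNReal.ofReal_ne_top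
  have hpos : 0 < volModCenter μ J := by
    rw [volModCenter_eq]
    exact (isOpen_map_mk hJ).measure_pos μ ⟨1, one_mem _⟩
  have hv0 : 0 < v := by
    rw [hv] at hpos
    exact ENNReal.ofReal_pos.1 hpos
  have hm0 : 0 < m := by
    obtain ⟨w₀, hw₀⟩ := exists_ne_zero_of_isIrreducible_cInd hirr
    have : Nontrivial W := ⟨w₀, 0, hw₀⟩
    rw [← hm]
    exact Module.finrank_pos
  have hd0 : 0 < d := by
    by_contra! h
    have h1 : d * v ≤ 0 := mul_nonpos_of_nonpos_of_nonneg h hv0.le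
    rw [hd] at h1
    have : (0 : ℝ) < m := by exact_mod_cast hm0
    linarith
  have hdv : (volModCenter μ J).toReal / Module.finrank ℂ W = 1 / d := by
    rw [hv, ENNReal.toReal_ofReal hv0.le, hm, ← hd]
    field_simp
  refine ⟨hd0, fun x y x' y' => ⟨coeffProd π y y' x x', fun g => coeffProd_mk hZ _ _ _ _ g, ?_⟩⟩
  rw [← hdv]
  exact schur_relations_of_denseRange hZ hπ.continuous hdense
    (sqIntegrable_cInd μ hJ hΛ hirr hfin hι hιπ hπ.continuous hZ hZJ)
    (schur_relations_cInd μ hJ hΛ hirr hfin hι hιπ hπ.continuous hZ hZJ) x x' y y'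

end FormalDimension


/-! ### Topology of F and of GL₂(F) -/

section Topology

variable (F : Type*) [Field F] [ValuativeRel F] [TopologicalSpace F] [IsNonarchimedeanLocalField F]

theorem t2Space_localField : T2Space F := by
  let := IsTopologicalAddGroup.rightUniformSpace F
  have := isUniformAddGroup_of_addCommGroup (G := F)
  infer_instance

-- The rank one valuation makes F a locally compact normed field, hence a proper metric space, hence
-- second countable.
open ValuativeRel in
theorem secondCountableTopology_localField : SecondCountableTopology F := by
  let := IsTopologicalAddGroup.rightUniformSpace F
  have := isUniformAddGroup_of_addCommGroup (G := F)
  let : (Valued.v (R := F)).RankOne :=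
  { hom' := IsRankLeOne.nonempty.some.emb (R := F).comp MonoidWithZeroHom.ValueGroup₀.embedding
    strictMono' := IsRankLeOne.nonempty.some.strictMono.comp
        MonoidWithZeroHom.ValueGroup₀.embedding_strictMono }
  open scoped Valued in
  have : ProperSpace F := .of_nontriviallyNormedField_of_weaklyLocallyCompactSpace F
  open scoped Valued in
  exact secondCountable_of_proper

theorem locallyCompactSpace_GL : LocallyCompactSpace (GL (Fin 2) F) := by
  have := t2Space_localField F
  have : T2Space (Matrix (Fin 2) (Fin 2) F) := inferInstanceAs (T2Space (Fin 2 → Fin 2 → F))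
  have : LocallyCompactSpace (Matrix (Fin 2) (Fin 2) F) :=
    inferInstanceAs (LocallyCompactSpace (Fin 2 → Fin 2 → F))
  have : LocallyCompactSpace (Matrix (Fin 2) (Fin 2) F)ᵐᵒᵖ :=
    MulOpposite.opHomeomorph.symm.isClosedEmbedding.locallyCompactSpace
  exact Units.isClosedEmbedding_embedProduct.locallyCompactSpace

theorem secondCountableTopology_GL : SecondCountableTopology (GL (Fin 2) F) := by
  have := secondCountableTopology_localField F
  have : SecondCountableTopology (Matrix (Fin 2) (Fin 2) F) :=
    inferInstanceAs (SecondCountableTopology (Fin 2 → Fin 2 → F))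
  have : SecondCountableTopology (Matrix (Fin 2) (Fin 2) F)ᵐᵒᵖ :=
    MulOpposite.opHomeomorph.symm.secondCountableTopology
  exact Units.isEmbedding_embedProduct.secondCountableTopology

end Topology

/-- The quotient is discrete and separable. Its countability bounds the dimension of c-Ind, as
Schur's lemma requires. -/
theorem countable_quotient_of_isOpen {G : Type*} [Group G] [TopologicalSpace G]
    [IsTopologicalGroup G] [SecondCountableTopology G] {J : Subgroup G}
    (hJ : IsOpen (J : Set G)) : Countable (G ⧸ J) := by
  have : DiscreteTopology (G ⧸ J) := QuotientGroup.discreteTopology hJ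
  have : TopologicalSpace.SeparableSpace (G ⧸ J) :=
    (QuotientGroup.mk_surjective (s := J)).denseRange.separableSpace QuotientGroup.continuous_mk
  exact TopologicalSpace.separableSpace_iff_countable.1 this

/-! ### PGL₂(F) is unimodular -/

section Unimodular

open MeasureTheory Matrix

theorem isMulRightInvariant_of_modularCharacter {Q : Type*} [Group Q] [TopologicalSpace Q]
    [IsTopologicalGroup Q] [LocallyCompactSpace Q] [SecondCountableTopology Q]
    [MeasurableSpace Q] [BorelSpace Q] (μ : Measure Q) [μ.IsHaarMeasure]
    (h : ∀ g : Q, Measure.modularCharacter g = 1) : μ.IsMulRightInvariant := by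
  refine ⟨fun g => ?_⟩
  have h1 := Measure.isMulLeftInvariant_eq_smul (Measure.map (· * g) μ) μ
  rw [h1, ← Measure.modularCharacterFun_eq_haarScalarFactor]
  have h2 : Measure.modularCharacterFun g = 1 := h g
  rw [h2, one_smul]

/-- A homomorphism from `GL₂(F)` to a commutative group without 2-torsion which is trivial on the
center is trivial. -/
theorem monoidHom_GL_two_eq_one {F : Type*} [Field F] (hF : ∃ a : F, a ≠ 0 ∧ a ≠ 1)
    {A : Type*} [CommGroup A] (hA : ∀ a : A, a * a = 1 → a = 1) (f : GL (Fin 2) F →* A)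
    (hf : ∀ z ∈ Subgroup.center (GL (Fin 2) F), f z = 1) (g : GL (Fin 2) F) : f g = 1 := by
  have hgen : ∀ (M : Matrix (Fin 2) (Fin 2) F), M.det ≠ 0 → ∀ g : GL (Fin 2) F, g.val = M →
      f g = 1 := by
    intro M hM
    have hdiag : ∀ g : GL (Fin 2) F, g.val 0 1 = 0 → g.val 1 0 = 0 → f g = 1 := by
      intro g h01 h10
      apply hA
      have hdet : g.val 0 0 * g.val 1 1 ≠ 0 := by
        have := g.isUnit.map Matrix.detMonoidHom
        rw [isUnit_iff_ne_zero, Matrix.coe_detMonoidHom, Matrix.det_fin_two, h01, zero_mul,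
          sub_zero] at this
        exact this
      -- Conjugation by w swaps the diagonal entries, so g·wgw⁻¹ is scalar and f(g)² = 1.
      let w : GL (Fin 2) F := ⟨!![0, 1; 1, 0], !![0, 1; 1, 0], by simp [Matrix.one_fin_two],
        by simp [Matrix.one_fin_two]⟩
      have h1 : g * (w * g * w⁻¹) ∈ Subgroup.center (GL (Fin 2) F) := by
        rw [Matrix.GeneralLinearGroup.mem_center_iff_val_mem_range_scalar]
        refine ⟨g.val 0 0 * g.val 1 1, ?_⟩
        have : (w⁻¹).val = !![0, 1; 1, 0] := rfl
        have hg : g.val = !![g.val 0 0, 0; 0, g.val 1 1] := by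
          conv_lhs => rw [Matrix.eta_fin_two g.val, h01, h10]
        have hw : w.val = !![0, 1; 1, 0] := rfl
        rw [Units.val_mul, Units.val_mul, Units.val_mul, this, hw, hg]
        ext i j
        fin_cases i <;> fin_cases j <;> simp [mul_comm]
      have h2 := hf _ h1
      rw [map_mul, map_mul, map_mul, map_inv, mul_inv_cancel_comm] at h2
      exact h2
    have htr : ∀ g : GL (Fin 2) F, ∀ i j : Fin 2, i ≠ j → ∀ c : F,
        g.val = Matrix.transvection i j c → f g = 1 := by
      intro g i j hij c hg
      obtain ⟨a, ha0, ha1⟩ := hF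
      have ha1' : a - 1 ≠ 0 := sub_ne_zero.2 ha1
      -- The transvection g is the commutator of d and t: conjugation by d multiplies the parameter
      -- c/(a - 1) of t by a, and a·c/(a - 1) - c/(a - 1) = c.
      let d : GL (Fin 2) F := Matrix.GeneralLinearGroup.mkOfDetNeZero
        (Matrix.diagonal fun k => if k = i then a else 1) (by
          rw [Matrix.det_diagonal, Finset.prod_ite_eq']
          simpa using ha0)
      let t : GL (Fin 2) F := ⟨Matrix.transvection i j (c / (a - 1)),
        Matrix.transvection i j (-(c / (a - 1))), by
          rw [Matrix.transvection_mul_transvection_same _ _ hij]; simp, by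
          rw [Matrix.transvection_mul_transvection_same _ _ hij]; simp⟩
      have h1 : g * (t * d) = d * t := by
        apply Units.ext
        rw [Units.val_mul, Units.val_mul, Units.val_mul, hg]
        have hd : d.val = Matrix.diagonal fun k => if k = i then a else 1 := rfl
        have ht : t.val = Matrix.transvection i j (c / (a - 1)) := rfl
        rw [hd, ht, ← mul_assoc, Matrix.transvection_mul_transvection_same _ _ hij]
        ext k l
        rw [Matrix.mul_diagonal, Matrix.diagonal_mul]
        simp only [Matrix.transvection, Matrix.add_apply, Matrix.single_apply, Matrix.one_apply]
        fin_cases i <;> fin_cases j <;> fin_cases k <;> fin_cases l <;>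
          simp at hij ⊢ <;> field_simp <;> ring
      have h2 := congrArg f h1
      rw [map_mul, map_mul, map_mul, mul_comm (f d)] at h2
      exact mul_eq_right.1 h2
    refine Matrix.diagonal_transvection_induction_of_det_ne_zero
      (fun M => ∀ g : GL (Fin 2) F, g.val = M → f g = 1) M hM ?_ ?_ ?_
    · rintro D - g hg
      exact hdiag g (by rw [hg]; simp) (by rw [hg]; simp)
    · rintro ⟨i, j, hij, c⟩ g hg
      exact htr g i j hij c hg
    · intro A B hA hB hfA hfB g hg
      have h1 := hfA (Matrix.GeneralLinearGroup.mkOfDetNeZero A hA) rfl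
      have h2 := hfB (Matrix.GeneralLinearGroup.mkOfDetNeZero B hB) rfl
      have h3 : g = Matrix.GeneralLinearGroup.mkOfDetNeZero A hA *
          Matrix.GeneralLinearGroup.mkOfDetNeZero B hB := Units.ext hg
      rw [h3, map_mul, h1, h2, mul_one]
  exact hgen g.val (by simpa using (g.isUnit.map Matrix.detMonoidHom).ne_zero) g rfl

/-- The modular character, pulled back to GL₂(F), is trivial on the center and takes values in the
positive reals, which have no 2-torsion; hence it is trivial. -/
theorem isMulRightInvariant_PGL {F : Type*} [Field F] [ValuativeRel F] [TopologicalSpace F]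
    [IsNonarchimedeanLocalField F]
    [MeasurableSpace (GL (Fin 2) F ⧸ Subgroup.center (GL (Fin 2) F))]
    [BorelSpace (GL (Fin 2) F ⧸ Subgroup.center (GL (Fin 2) F))]
    (μ : MeasureTheory.Measure (GL (Fin 2) F ⧸ Subgroup.center (GL (Fin 2) F)))
    [μ.IsHaarMeasure] : μ.IsMulRightInvariant := by
  have := locallyCompactSpace_GL F
  have := secondCountableTopology_GL F
  refine isMulRightInvariant_of_modularCharacter μ ?_
  let f : GL (Fin 2) F →* NNRealˣ :=
    (Measure.modularCharacter (G := GL (Fin 2) F ⧸ Subgroup.center (GL (Fin 2) F))).toHomUnits.comp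
      (QuotientGroup.mk' _)
  have hF : ∃ a : F, a ≠ 0 ∧ a ≠ 1 := by
    obtain ⟨r, hr0, hr1⟩ := Valuation.IsNontrivial.exists_lt_one (v := ValuativeRel.valuation F)
    refine ⟨r, fun h => hr0 (by simp [h]), fun h => ?_⟩
    rw [h, map_one] at hr1
    exact lt_irrefl _ hr1
  have h1 := monoidHom_GL_two_eq_one hF (fun a ha => by
    have h2 : (a : NNReal) * a = 1 := by rw [← Units.val_mul, ha, Units.val_one]
    apply Units.ext
    rw [Units.val_one]
    rwa [← sq, pow_eq_one_iff_of_nonneg zero_le two_ne_zero] at h2) f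
    (fun z hz => by
      have : QuotientGroup.mk' (Subgroup.center (GL (Fin 2) F)) z = 1 :=
        (QuotientGroup.eq_one_iff z).2 hz
      simp only [f, MonoidHom.comp_apply, this, map_one])
  intro g
  obtain ⟨g, rfl⟩ := QuotientGroup.mk_surjective g
  exact congrArg Units.val (h1 g)

end Unimodular


/-! ### The orders 𝓜 and 𝓙: units, radicals, normalizers -/

section Orders

open ValuativeRel

variable {F : Type*} [Field F] [ValuativeRel F]

/-- `ϖ` is a generator of the maximal ideal of the ring of integers. -/
def IsUniformizer (ϖ : F) : Prop :=
  ϖ ≠ 0 ∧ valuation F ϖ < 1 ∧ ∀ x, valuation F x < 1 → valuation F x ≤ valuation F ϖ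

theorem exists_isUniformizer [TopologicalSpace F] [IsNonarchimedeanLocalField F] :
    ∃ ϖ : F, IsUniformizer ϖ := by
  obtain ⟨ϖ, hϖ⟩ := valuation_surjective (uniformizer F)
  refine ⟨ϖ, ?_, ?_, fun x hx => ?_⟩
  · rw [← (valuation F).ne_zero_iff, hϖ]
    exact uniformizer_ne_zero
  · rw [hϖ]
    exact uniformizer_lt_one
  · rw [hϖ]
    exact le_uniformizer_iff.2 hx

theorem IsUniformizer.pos {ϖ : F} (h : IsUniformizer ϖ) : 0 < valuation F ϖ :=
  zero_lt_iff.2 ((valuation F).ne_zero_iff.2 h.1)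

theorem IsUniformizer.zpow_le_zpow {ϖ : F} (h : IsUniformizer ϖ) {m n : ℤ} :
    valuation F ϖ ^ m ≤ valuation F ϖ ^ n ↔ n ≤ m :=
  (zpow_right_strictAnti₀ h.pos h.2.1).le_iff_ge

theorem IsUniformizer.zpow_inj {ϖ : F} (h : IsUniformizer ϖ) {m n : ℤ} :
    valuation F ϖ ^ m = valuation F ϖ ^ n ↔ m = n :=
  (zpow_right_strictAnti₀ h.pos h.2.1).injective.eq_iff

/-- The value group is archimedean, so v(x) lies between consecutive powers of v(ϖ). A value
strictly between them would yield one strictly between v(ϖ) and 1. -/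
theorem IsUniformizer.exists_zpow [TopologicalSpace F] [IsNonarchimedeanLocalField F] {ϖ : F}
    (h : IsUniformizer ϖ) {x : F} (hx : x ≠ 0) :
    ∃ m : ℤ, valuation F x = valuation F ϖ ^ m := by
  have : MulArchimedean (ValueGroupWithZero F) := isRankLeOne_iff_mulArchimedean.1 inferInstance
  have hx0 : valuation F x ≠ 0 := (valuation F).ne_zero_iff.2 hx
  have h1 : 1 < Units.mk0 _ (inv_ne_zero h.pos.ne') := by
    rw [← Units.val_lt_val]
    exact (one_lt_inv₀ h.pos).2 h.2.1
  obtain ⟨k, ⟨hk, hk'⟩, -⟩ := existsUnique_zpow_near_of_one_lt h1 (Units.mk0 _ hx0)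
  rw [← Units.val_le_val] at hk
  rw [← Units.val_lt_val] at hk'
  simp only [Units.val_zpow_eq_zpow_val, Units.val_mk0, inv_zpow', neg_add_rev] at hk hk'
  refine ⟨-k, le_antisymm ?_ hk⟩
  by_contra! hlt
  have h2 : valuation F (ϖ ^ (-k) / x) < 1 := by
    rw [map_div₀, map_zpow₀]
    exact (div_lt_one₀ (zero_lt_iff.2 hx0)).2 hlt
  have h3 := h.2.2 _ h2
  rw [map_div₀, map_zpow₀, div_le_iff₀ (zero_lt_iff.2 hx0)] at h3
  rw [add_comm, zpow_add₀ h.pos.ne', zpow_neg_one, mul_comm, ← div_eq_inv_mul,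
    lt_div_iff₀ h.pos, mul_comm] at hk'
  exact absurd h3 (not_le.2 hk')

/-- Exponents are integers: 2m ≥ N and 2k ≤ N + 1 imply m ≥ k. This rounding is what turns the
bounds on squares into sharp divisibility. -/
theorem IsUniformizer.le_of_sq_le [TopologicalSpace F] [IsNonarchimedeanLocalField F] {ϖ : F}
    (h : IsUniformizer ϖ) {x : F} {N k : ℤ} (hx : valuation F x ^ 2 ≤ valuation F ϖ ^ N)
    (hk : 2 * k ≤ N + 1) : valuation F x ≤ valuation F ϖ ^ k := by
  by_cases hx0 : x = 0
  · simp [hx0]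
  obtain ⟨m, hm⟩ := h.exists_zpow hx0
  rw [hm, ← zpow_natCast, ← zpow_mul, h.zpow_le_zpow] at hx
  rw [hm, h.zpow_le_zpow]
  push_cast at hx
  omega

theorem mem_orderM_iff {x : Matrix (Fin 2) (Fin 2) F} :
    x ∈ orderM F ↔ ∀ i j, valuation F (x i j) ≤ 1 := Iff.rfl

theorem mem_orderJ_iff {x : Matrix (Fin 2) (Fin 2) F} :
    x ∈ orderJ F ↔ (∀ i j, valuation F (x i j) ≤ 1) ∧ valuation F (x 1 0) < 1 := Iff.rfl

theorem orderJ_le_orderM : orderJ F ≤ orderM F := fun _ hx => hx.1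

theorem valuation_mul_add_mul_le {a b c d : F} {γ : ValueGroupWithZero F}
    (h1 : valuation F a * valuation F b ≤ γ) (h2 : valuation F c * valuation F d ≤ γ) :
    valuation F (a * b + c * d) ≤ γ := by
  refine (valuation F).map_add_le ?_ ?_ <;> rwa [map_mul]

theorem valuation_mul_sub_mul_le {a b c d : F} {γ : ValueGroupWithZero F}
    (h1 : valuation F a * valuation F b ≤ γ) (h2 : valuation F c * valuation F d ≤ γ) :
    valuation F (a * b - c * d) ≤ γ := by
  refine (valuation F).map_sub_le ?_ ?_ <;> rwa [map_mul]

theorem valuation_det_le {x : Matrix (Fin 2) (Fin 2) F} {γ : ValueGroupWithZero F}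
    (h : ∀ i j, valuation F (x i j) ≤ γ) : valuation F x.det ≤ γ * γ := by
  rw [Matrix.det_fin_two]
  exact valuation_mul_sub_mul_le (mul_le_mul' (h _ _) (h _ _)) (mul_le_mul' (h _ _) (h _ _))

omit [ValuativeRel F] in
theorem det_ne_zero (g : GL (Fin 2) F) : g.val.det ≠ 0 :=
  (g.isUnit.map Matrix.detMonoidHom).ne_zero

omit [ValuativeRel F] in
theorem val_inv_eq (g : GL (Fin 2) F) :
    (g⁻¹).val = g.val.det⁻¹ • !![g.val 1 1, -g.val 0 1; -g.val 1 0, g.val 0 0] := by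
  rw [Matrix.coe_units_inv, Matrix.inv_def, Matrix.adjugate_fin_two, Ring.inverse_eq_inv']

theorem valuation_det_of_mem_unitGroup {g : GL (Fin 2) F} (hg : g ∈ unitGroup (orderM F)) :
    valuation F g.val.det = 1 := by
  have h1 := valuation_det_le (mem_orderM_iff.1 hg.1)
  have h2 := valuation_det_le (mem_orderM_iff.1 hg.2)
  rw [one_mul] at h1 h2
  have h3 : valuation F g.val.det * valuation F (g⁻¹).val.det = 1 := by
    rw [← map_mul, ← Matrix.det_mul, ← Units.val_mul, mul_inv_cancel, Units.val_one,
      Matrix.det_one, map_one]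
  refine le_antisymm h1 ?_
  calc (1 : ValueGroupWithZero F) = valuation F g.val.det * valuation F (g⁻¹).val.det := h3.symm
    _ ≤ valuation F g.val.det * 1 := mul_le_mul' le_rfl h2
    _ = _ := mul_one _

theorem mem_unitGroup_orderM_iff {g : GL (Fin 2) F} :
    g ∈ unitGroup (orderM F) ↔ g.val ∈ orderM F ∧ valuation F g.val.det = 1 := by
  refine ⟨fun h => ⟨h.1, valuation_det_of_mem_unitGroup h⟩, fun h => ⟨h.1, ?_⟩⟩
  have h1 := mem_orderM_iff.1 h.1
  rw [val_inv_eq, mem_orderM_iff]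
  intro i j
  fin_cases i <;> fin_cases j <;> simp [h.2, h1]

theorem mem_unitGroup_orderJ_iff {g : GL (Fin 2) F} :
    g ∈ unitGroup (orderJ F) ↔ g.val ∈ orderJ F ∧ valuation F g.val.det = 1 := by
  refine ⟨fun h => ⟨h.1, valuation_det_of_mem_unitGroup
    ⟨orderJ_le_orderM h.1, orderJ_le_orderM h.2⟩⟩, fun h => ⟨h.1, ?_⟩⟩
  refine mem_orderJ_iff.2 ⟨(mem_unitGroup_orderM_iff.2 ⟨orderJ_le_orderM h.1, h.2⟩).2, ?_⟩
  rw [val_inv_eq]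
  simpa [h.2] using (mem_orderJ_iff.1 h.1).2

/-! #### The Jacobson radicals -/

theorem mem_radical_iff {𝔘 : Subalgebra 𝒪[F] (Matrix (Fin 2) (Fin 2) F)}
    {x : Matrix (Fin 2) (Fin 2) F} :
    x ∈ radical 𝔘 ↔ x ∈ 𝔘 ∧ ∀ y ∈ 𝔘, ∃ z ∈ 𝔘, z * (1 + y * x) = 1 := by
  have hj : ∀ a : 𝔘, a ∈ Ring.jacobson 𝔘 ↔ ∀ y ∈ 𝔘, ∃ z ∈ 𝔘, z * (1 + y * a.1) = 1 := by
    intro a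
    rw [← Ideal.jacobson_bot, Ideal.mem_jacobson_iff]
    constructor
    · intro h y hy
      obtain ⟨z, hz⟩ := h ⟨y, hy⟩
      refine ⟨z, z.2, ?_⟩
      have := congrArg Subtype.val ((Submodule.mem_bot _).1 hz)
      simp only [Subalgebra.coe_sub, Subalgebra.coe_add, Subalgebra.coe_mul, Subalgebra.coe_one,
        Subalgebra.coe_zero] at this
      rw [← sub_eq_zero, ← this]
      noncomm_ring
    · intro h y
      obtain ⟨z, hz, hzy⟩ := h y y.2
      refine ⟨⟨z, hz⟩, (Submodule.mem_bot _).2 (Subtype.ext ?_)⟩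
      simp only [Subalgebra.coe_sub, Subalgebra.coe_add, Subalgebra.coe_mul, Subalgebra.coe_one,
        Subalgebra.coe_zero]
      rw [← sub_eq_zero] at hzy
      rw [← hzy]
      noncomm_ring
  constructor
  · rintro ⟨a, ha, rfl⟩
    exact ⟨a.2, (hj a).1 ha⟩
  · rintro ⟨hx, h⟩
    exact ⟨⟨x, hx⟩, (hj ⟨x, hx⟩).2 h, rfl⟩

theorem valuation_one_add_of_lt {x : F} (hx : valuation F x < 1) : valuation F (1 + x) = 1 :=
  (valuation F).map_one_add_of_lt hx

omit [ValuativeRel F] in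
theorem not_left_inverse_of_det_eq_zero {x z : Matrix (Fin 2) (Fin 2) F} (hx : x.det = 0) :
    z * x ≠ 1 := by
  intro h
  have := congrArg Matrix.det h
  rw [Matrix.det_mul, hx, mul_zero, Matrix.det_one] at this
  exact zero_ne_one this

/-- If x_ij were a unit, put y = -x_ij⁻¹ E_ji. Then row j of 1 + yx has a zero at place j and the
other row is that of the identity, so 1 + yx is singular. -/
theorem valuation_lt_one_of_mem_radical {𝔘 : Subalgebra 𝒪[F] (Matrix (Fin 2) (Fin 2) F)}
    (h𝔘 : 𝔘 ≤ orderM F) {x : Matrix (Fin 2) (Fin 2) F} (hx : x ∈ radical 𝔘) (i j : Fin 2)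
    (hij : ∀ a : F, valuation F a ≤ 1 → Matrix.single j i a ∈ 𝔘) : valuation F (x i j) < 1 := by
  obtain ⟨hx, h⟩ := mem_radical_iff.1 hx
  by_contra! hv
  have hv1 : valuation F (x i j) = 1 := le_antisymm (h𝔘 hx i j) hv
  have h0 : x i j ≠ 0 := by
    rw [← (valuation F).ne_zero_iff, hv1]
    exact one_ne_zero
  obtain ⟨z, -, hz⟩ := h _ (hij (-(x i j)⁻¹) (by simp [hv1]))
  refine not_left_inverse_of_det_eq_zero ?_ hz
  rw [Matrix.det_fin_two]
  fin_cases i <;> fin_cases j <;> simp_all [Matrix.add_apply, Matrix.single_mul_apply_same]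

theorem mem_radical_orderM_iff {x : Matrix (Fin 2) (Fin 2) F} :
    x ∈ radical (orderM F) ↔ ∀ i j, valuation F (x i j) < 1 := by
  constructor
  · intro hx i j
    refine valuation_lt_one_of_mem_radical le_rfl hx i j fun a ha => mem_orderM_iff.2 fun k l => ?_
    rw [Matrix.single_apply]
    split_ifs
    · exact ha
    · simp
  · intro hx
    have hmul : ∀ y ∈ orderM F, ∀ i j, valuation F ((y * x) i j) < 1 := by
      intro y hy i j
      rw [Matrix.mul_apply, Fin.sum_univ_two]
      refine (valuation F).map_add_lt ?_ ?_ <;> rw [map_mul]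
      · exact mul_lt_one_of_nonneg_of_lt_one_right (hy _ _) zero_le (hx _ _)
      · exact mul_lt_one_of_nonneg_of_lt_one_right (hy _ _) zero_le (hx _ _)
    have hx' : x ∈ orderM F := fun i j => (hx i j).le
    refine mem_radical_iff.2 ⟨hx', fun y hy => ?_⟩
    have h1 : 1 + y * x ∈ orderM F := add_mem (one_mem _) (mul_mem hy hx')
    have h2 : valuation F (1 + y * x).det = 1 := by
      have hh := hmul y hy
      rw [Matrix.det_fin_two]
      simp only [Matrix.add_apply, Matrix.one_apply_eq, Matrix.one_apply_ne zero_ne_one,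
        Matrix.one_apply_ne one_ne_zero, zero_add]
      rw [sub_eq_add_neg, Valuation.map_add_eq_of_lt_left]
      · rw [map_mul, valuation_one_add_of_lt (hh _ _), valuation_one_add_of_lt (hh _ _), one_mul]
      · rw [Valuation.map_neg, map_mul, map_mul, valuation_one_add_of_lt (hh _ _),
          valuation_one_add_of_lt (hh _ _), one_mul]
        exact mul_lt_one_of_nonneg_of_lt_one_left zero_le (hh _ _) (hh _ _).le
    have h3 : (1 + y * x).det ≠ 0 := by
      rw [← (valuation F).ne_zero_iff, h2]
      exact one_ne_zero
    let g := Matrix.GeneralLinearGroup.mkOfDetNeZero _ h3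
    have hg : g ∈ unitGroup (orderM F) := mem_unitGroup_orderM_iff.2 ⟨h1, h2⟩
    exact ⟨(g⁻¹).val, hg.2, g.inv_mul⟩

theorem mem_radical_orderJ_iff {x : Matrix (Fin 2) (Fin 2) F} :
    x ∈ radical (orderJ F) ↔ valuation F (x 0 0) < 1 ∧ valuation F (x 0 1) ≤ 1 ∧
      valuation F (x 1 0) < 1 ∧ valuation F (x 1 1) < 1 := by
  constructor
  · intro hx
    have hd : ∀ i, valuation F (x i i) < 1 := by
      intro i
      refine valuation_lt_one_of_mem_radical orderJ_le_orderM hx i i fun a ha =>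
        mem_orderJ_iff.2 ⟨fun k l => ?_, ?_⟩
      · rw [Matrix.single_apply]
        split_ifs
        · exact ha
        · simp
      · rw [Matrix.single_apply, if_neg]
        · simp
        · rintro ⟨h, h'⟩
          exact zero_ne_one (h'.symm.trans h)
    have hx' := mem_orderJ_iff.1 (mem_radical_iff.1 hx).1
    exact ⟨hd 0, hx'.1 0 1, hx'.2, hd 1⟩
  · rintro ⟨h00, h01, h10, h11⟩
    have hx' : x ∈ orderJ F := by
      refine mem_orderJ_iff.2 ⟨fun i j => ?_, h10⟩
      fin_cases i <;> fin_cases j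
      exacts [h00.le, h01, h10.le, h11.le]
    refine mem_radical_iff.2 ⟨hx', fun y hy => ?_⟩
    have hyx := mem_orderJ_iff.1 (mul_mem hy hx')
    obtain ⟨hy1, hy2⟩ := mem_orderJ_iff.1 hy
    have hd0 : valuation F ((y * x) 0 0) < 1 := by
      rw [Matrix.mul_apply, Fin.sum_univ_two]
      refine (valuation F).map_add_lt ?_ ?_ <;> rw [map_mul]
      · exact mul_lt_one_of_nonneg_of_lt_one_right (hy1 _ _) zero_le h00
      · exact mul_lt_one_of_nonneg_of_lt_one_right (hy1 _ _) zero_le h10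
    have hd1 : valuation F ((y * x) 1 1) < 1 := by
      rw [Matrix.mul_apply, Fin.sum_univ_two]
      refine (valuation F).map_add_lt ?_ ?_ <;> rw [map_mul]
      · exact mul_lt_one_of_nonneg_of_lt_one_left zero_le hy2 h01
      · exact mul_lt_one_of_nonneg_of_lt_one_right (hy1 _ _) zero_le h11
    have h1 : 1 + y * x ∈ orderJ F := add_mem (one_mem _) (mul_mem hy hx')
    have h2 : valuation F (1 + y * x).det = 1 := by
      rw [Matrix.det_fin_two]
      simp only [Matrix.add_apply, Matrix.one_apply_eq, Matrix.one_apply_ne zero_ne_one,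
        Matrix.one_apply_ne one_ne_zero, zero_add]
      rw [sub_eq_add_neg, Valuation.map_add_eq_of_lt_left]
      · rw [map_mul, valuation_one_add_of_lt hd0, valuation_one_add_of_lt hd1, one_mul]
      · rw [Valuation.map_neg, map_mul, map_mul, valuation_one_add_of_lt hd0,
          valuation_one_add_of_lt hd1, one_mul]
        exact mul_lt_one_of_nonneg_of_lt_one_right (hyx.1 _ _) zero_le hyx.2
    have h3 : (1 + y * x).det ≠ 0 := by
      rw [← (valuation F).ne_zero_iff, h2]
      exact one_ne_zero
    let g := Matrix.GeneralLinearGroup.mkOfDetNeZero _ h3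
    have hg : g ∈ unitGroup (orderJ F) := mem_unitGroup_orderJ_iff.2 ⟨h1, h2⟩
    exact ⟨(g⁻¹).val, hg.2, g.inv_mul⟩

/-! #### Normalizers -/

/-- Upper unipotent matrices. -/
def upperUnip (x : F) : GL (Fin 2) F :=
  ⟨!![1, x; 0, 1], !![1, -x; 0, 1], by simp [Matrix.one_fin_two], by simp [Matrix.one_fin_two]⟩

/-- Lower unipotent matrices. -/
def lowerUnip (x : F) : GL (Fin 2) F :=
  ⟨!![1, 0; x, 1], !![1, 0; -x, 1], by simp [Matrix.one_fin_two], by simp [Matrix.one_fin_two]⟩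

-- Squares of single entries of g appear in the off-diagonal entries of conjugated unipotents. This
-- is how the normalizer condition bounds each entry of g.
omit [ValuativeRel F] in
theorem conj_upperUnip (g : GL (Fin 2) F) (x : F) :
    (g * upperUnip x * g⁻¹).val 0 1 = x * g.val 0 0 ^ 2 / g.val.det ∧
    (g * upperUnip x * g⁻¹).val 1 0 = -(x * g.val 1 0 ^ 2 / g.val.det) := by
  have h := det_ne_zero g
  rw [Units.val_mul, Units.val_mul, val_inv_eq]
  constructor <;>
  · simp [upperUnip, Matrix.mul_apply, Fin.sum_univ_two]
    field_simp
    ring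

omit [ValuativeRel F] in
theorem conj_lowerUnip (g : GL (Fin 2) F) (x : F) :
    (g * lowerUnip x * g⁻¹).val 0 1 = -(x * g.val 0 1 ^ 2 / g.val.det) ∧
    (g * lowerUnip x * g⁻¹).val 1 0 = x * g.val 1 1 ^ 2 / g.val.det := by
  have h := det_ne_zero g
  rw [Units.val_mul, Units.val_mul, val_inv_eq]
  constructor <;>
  · simp [lowerUnip, Matrix.mul_apply, Fin.sum_univ_two]
    field_simp
    ring

variable [TopologicalSpace F] [IsNonarchimedeanLocalField F]

/-- Conjugating unipotents gives v(g_ij)² ≤ v(det g) for all entries. If v(det g) = v(ϖ)^N, all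
entries are divisible by ϖ^⌈N/2⌉, hence det g by its square. So N is even, and dividing g by ϖ^(N/2)
puts it in GL₂(𝔬). -/
theorem exists_smul_mem_unitGroup_of_mem_normalizer {ϖ : F} (hϖ : IsUniformizer ϖ)
    {g : GL (Fin 2) F}
    (hg : g ∈ Subgroup.normalizer (unitGroup (orderM F) : Set (GL (Fin 2) F))) :
    ∃ (m : ℤ), ∃ u ∈ unitGroup (orderM F), g.val = ϖ ^ m • u.val := by
  have hdet := det_ne_zero g
  have hvdet : 0 < valuation F g.val.det := zero_lt_iff.2 ((valuation F).ne_zero_iff.2 hdet)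
  obtain ⟨N, hN⟩ := hϖ.exists_zpow hdet
  have hu := (Subgroup.mem_normalizer_iff.1 hg (upperUnip 1)).1 (mem_unitGroup_orderM_iff.2
    ⟨fun i j => by fin_cases i <;> fin_cases j <;> simp [upperUnip],
      by simp [upperUnip]⟩)
  have hl := (Subgroup.mem_normalizer_iff.1 hg (lowerUnip 1)).1 (mem_unitGroup_orderM_iff.2
    ⟨fun i j => by fin_cases i <;> fin_cases j <;> simp [lowerUnip],
      by simp [lowerUnip]⟩)
  have h00 := hu.1 0 1
  have h10 := hu.1 1 0
  have h01 := hl.1 0 1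
  have h11 := hl.1 1 0
  rw [(conj_upperUnip g 1).1] at h00
  rw [(conj_upperUnip g 1).2] at h10
  rw [(conj_lowerUnip g 1).1] at h01
  rw [(conj_lowerUnip g 1).2] at h11
  simp only [Valuation.mem_integer_iff, Valuation.map_neg, one_mul, map_div₀, map_pow]
    at h00 h01 h10 h11
  rw [div_le_one₀ hvdet, hN] at h00 h01 h10 h11
  have hk : 2 * ((N + 1) / 2) ≤ N + 1 := by omega
  have hall : ∀ i j, valuation F (g.val i j) ≤ valuation F ϖ ^ ((N + 1) / 2) := by
    intro i j
    fin_cases i <;> fin_cases j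
    exacts [hϖ.le_of_sq_le h00 hk, hϖ.le_of_sq_le h01 hk, hϖ.le_of_sq_le h10 hk,
      hϖ.le_of_sq_le h11 hk]
  have h1 := valuation_det_le hall
  rw [hN, ← zpow_add₀ hϖ.pos.ne', hϖ.zpow_le_zpow] at h1
  have hN2 : N = (N + 1) / 2 + (N + 1) / 2 := by omega
  generalize (N + 1) / 2 = m at hall hN2
  have hϖm : ϖ ^ (-m) ≠ 0 := zpow_ne_zero _ hϖ.1
  have hd : (ϖ ^ (-m) • g.val).det ≠ 0 := by
    rw [Matrix.det_smul]
    exact mul_ne_zero (pow_ne_zero _ hϖm) hdet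
  refine ⟨m, Matrix.GeneralLinearGroup.mkOfDetNeZero _ hd,
    mem_unitGroup_orderM_iff.2 ⟨fun i j => ?_, ?_⟩, ?_⟩
  · change valuation F (ϖ ^ (-m) * g.val i j) ≤ 1
    rw [map_mul, map_zpow₀, zpow_neg, inv_mul_le_iff₀ (zpow_pos hϖ.pos _), mul_one]
    exact hall i j
  · change valuation F (ϖ ^ (-m) • g.val).det = 1
    rw [Matrix.det_smul, map_mul, hN, hN2, map_pow, map_zpow₀, Fintype.card_fin, ← zpow_natCast,
      ← zpow_mul, ← zpow_add₀ hϖ.pos.ne']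
    convert zpow_zero _
    push_cast
    ring
  · change g.val = ϖ ^ m • (ϖ ^ (-m) • g.val)
    rw [smul_smul, ← zpow_add₀ hϖ.1, add_neg_cancel, zpow_zero, one_smul]

-- The shifts of N come from 𝓙: lower unipotents have parameter ϖ, and a lower left entry of
-- valuation < 1 has valuation at most v(ϖ).
omit [TopologicalSpace F] [IsNonarchimedeanLocalField F] in
theorem valuation_le_of_mem_normalizer_orderJ {ϖ : F} (hϖ : IsUniformizer ϖ)
    {g : GL (Fin 2) F}
    (hg : g ∈ Subgroup.normalizer (unitGroup (orderJ F) : Set (GL (Fin 2) F))) {N : ℤ}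
    (hN : valuation F g.val.det = valuation F ϖ ^ N) :
    valuation F (g.val 0 0) ^ 2 ≤ valuation F ϖ ^ N ∧
    valuation F (g.val 0 1) ^ 2 ≤ valuation F ϖ ^ (N - 1) ∧
    valuation F (g.val 1 0) ^ 2 ≤ valuation F ϖ ^ (N + 1) ∧
    valuation F (g.val 1 1) ^ 2 ≤ valuation F ϖ ^ N := by
  have hdet := det_ne_zero g
  have hvdet : 0 < valuation F g.val.det := zero_lt_iff.2 ((valuation F).ne_zero_iff.2 hdet)
  have hu := (Subgroup.mem_normalizer_iff.1 hg (upperUnip 1)).1 (mem_unitGroup_orderJ_iff.2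
    ⟨⟨fun i j => by fin_cases i <;> fin_cases j <;> simp [upperUnip], by simp [upperUnip]⟩,
      by simp [upperUnip]⟩)
  have hϖ' : ϖ ∈ 𝒪[F] := hϖ.2.1.le
  have hl := (Subgroup.mem_normalizer_iff.1 hg (lowerUnip ϖ)).1 (mem_unitGroup_orderJ_iff.2
    ⟨⟨fun i j => by fin_cases i <;> fin_cases j <;> simp [lowerUnip, hϖ'],
      by simp [lowerUnip, hϖ.2.1]⟩, by simp [lowerUnip]⟩)
  have h00 := hu.1.1 0 1
  have h10 := hu.1.2
  have h01 := hl.1.1 0 1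
  have h11 := hl.1.2
  rw [(conj_upperUnip g 1).1] at h00
  rw [(conj_upperUnip g 1).2] at h10
  rw [(conj_lowerUnip g ϖ).1] at h01
  rw [(conj_lowerUnip g ϖ).2] at h11
  simp only [Valuation.mem_integer_iff, Valuation.map_neg, one_mul, map_div₀, map_pow, map_mul]
    at h00 h01 h10 h11
  rw [div_le_one₀ hvdet, hN] at h00 h01
  have hle := hϖ.2.2 (g.val 1 0 ^ 2 / g.val.det) (by simpa using h10)
  have hle' := hϖ.2.2 (ϖ * g.val 1 1 ^ 2 / g.val.det) (by simpa using h11)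
  rw [map_div₀, div_le_iff₀ hvdet, map_pow, hN] at hle
  rw [map_div₀, div_le_iff₀ hvdet, map_mul, map_pow, hN] at hle'
  refine ⟨h00, ?_, ?_, ?_⟩
  · rw [zpow_sub_one₀ hϖ.pos.ne', ← div_eq_mul_inv, le_div_iff₀ hϖ.pos, mul_comm]
    exact h01
  · rw [zpow_add_one₀ hϖ.pos.ne', mul_comm]
    exact hle
  · exact le_of_mul_le_mul_left hle' hϖ.pos

theorem mem_unitGroup_of_mem_normalizer_orderJ {g : GL (Fin 2) F}
    (hg : g ∈ Subgroup.normalizer (unitGroup (orderJ F) : Set (GL (Fin 2) F)))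
    (hdet : valuation F g.val.det = 1) : g ∈ unitGroup (orderJ F) := by
  obtain ⟨ϖ, hϖ⟩ := exists_isUniformizer (F := F)
  obtain ⟨h00, h01, h10, h11⟩ := valuation_le_of_mem_normalizer_orderJ hϖ hg (N := 0)
    (by rw [hdet, zpow_zero])
  replace h00 := hϖ.le_of_sq_le (k := 0) h00 (by norm_num)
  replace h01 := hϖ.le_of_sq_le (k := 0) h01 (by norm_num)
  replace h10 := hϖ.le_of_sq_le (k := 1) h10 (by norm_num)
  replace h11 := hϖ.le_of_sq_le (k := 0) h11 (by norm_num)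
  rw [zpow_zero] at h00 h01 h11
  rw [zpow_one] at h10
  refine mem_unitGroup_orderJ_iff.2 ⟨mem_orderJ_iff.2 ⟨fun i j => ?_, h10.trans_lt hϖ.2.1⟩, hdet⟩
  fin_cases i <;> fin_cases j
  exacts [h00, h01, h10.trans hϖ.2.1.le, h11]

theorem mem_radical_of_mem_normalizer_orderJ {ϖ : F} (hϖ : IsUniformizer ϖ) {g : GL (Fin 2) F}
    (hg : g ∈ Subgroup.normalizer (unitGroup (orderJ F) : Set (GL (Fin 2) F)))
    (hdet : valuation F g.val.det = valuation F ϖ) : g.val ∈ radical (orderJ F) := by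
  obtain ⟨h00, h01, h10, h11⟩ := valuation_le_of_mem_normalizer_orderJ hϖ hg (N := 1)
    (by rw [hdet, zpow_one])
  replace h00 := hϖ.le_of_sq_le (k := 1) h00 (by norm_num)
  replace h01 := hϖ.le_of_sq_le (k := 0) h01 (by norm_num)
  replace h10 := hϖ.le_of_sq_le (k := 1) h10 (by norm_num)
  replace h11 := hϖ.le_of_sq_le (k := 1) h11 (by norm_num)
  rw [zpow_zero] at h01
  rw [zpow_one] at h00 h10 h11
  exact mem_radical_orderJ_iff.2 ⟨h00.trans_lt hϖ.2.1, h01, h10.trans_lt hϖ.2.1,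
    h11.trans_lt hϖ.2.1⟩

end Orders


/-! ### Counting cosets in unit filtrations -/

section CosetCounting

/-- The index of the subgroup of the elements of `H` congruent to `1` modulo `L`. -/
theorem relIndex_eq_card_image {R : Type*} [Ring R] (L : AddSubgroup R) (H N : Subgroup Rˣ)
    (hL : ∀ h ∈ H, ∀ l ∈ L, (h : R) * l ∈ L) (hN : ∀ h ∈ H, h ∈ N ↔ (h : R) - 1 ∈ L) :
    N.relIndex H = Nat.card ((fun h : Rˣ => ((h : R) : R ⧸ L)) '' (H : Set Rˣ)) := by
  have key : ∀ a b : H, (a⁻¹ * b ∈ N.subgroupOf H) ↔ (((a : Rˣ) : R) : R ⧸ L) = ((b : Rˣ) : R) := by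
    intro a b
    rw [Subgroup.mem_subgroupOf, hN _ (a⁻¹ * b).2, QuotientAddGroup.eq]
    have e1 : (((a⁻¹ * b : H) : Rˣ) : R) - 1 = ((a⁻¹ : H) : Rˣ) * (-((a : Rˣ) : R) + (b : Rˣ)) := by
      rw [mul_add, mul_neg, Subgroup.coe_mul, Units.val_mul, Subgroup.coe_inv, Units.inv_mul]
      abel
    have e2 : -((a : Rˣ) : R) + (b : Rˣ) = (a : Rˣ) * ((((a⁻¹ * b : H) : Rˣ) : R) - 1) := by
      rw [mul_sub, mul_one, Subgroup.coe_mul, Subgroup.coe_inv, Units.val_mul,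
        Units.mul_inv_cancel_left]
      abel
    constructor
    · intro h
      rw [e2]
      exact hL _ a.2 _ h
    · intro h
      rw [e1]
      exact hL _ (a⁻¹).2 _ h
  let f : H ⧸ N.subgroupOf H → (fun h : Rˣ => ((h : R) : R ⧸ L)) '' (H : Set Rˣ) :=
    Quotient.lift (fun h : H => ⟨(((h : Rˣ) : R) : R ⧸ L), h, h.2, rfl⟩) fun a b hab =>
      Subtype.ext ((key a b).1 (QuotientGroup.leftRel_apply.1 hab))
  refine Nat.card_congr (Equiv.ofBijective f ⟨?_, ?_⟩)
  · intro x y hxy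
    obtain ⟨a, rfl⟩ := QuotientGroup.mk_surjective x
    obtain ⟨b, rfl⟩ := QuotientGroup.mk_surjective y
    exact QuotientGroup.eq.2 ((key a b).2 (congrArg Subtype.val hxy))
  · rintro ⟨_, h, hh, rfl⟩
    exact ⟨QuotientGroup.mk ⟨h, hh⟩, rfl⟩

theorem addRelIndex_eq_card_image {R : Type*} [AddCommGroup R] (L M : AddSubgroup R) :
    L.relIndex M = Nat.card ((fun x : R => (x : R ⧸ L)) '' (M : Set R)) := by
  have := AddSubgroup.relIndex_ker M (QuotientAddGroup.mk' L)
  rw [QuotientAddGroup.ker_mk'] at this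
  exact this

variable {R : Type*} [Ring R]

/-- The lattice `τ^i A`. -/
def latticePow (A : Subring R) (τ : Rˣ) (i : ℕ) : AddSubgroup R :=
  A.toAddSubgroup.comap (AddMonoidHom.mulLeft ((τ⁻¹ ^ i : Rˣ) : R))

theorem mem_latticePow {A : Subring R} {τ : Rˣ} {i : ℕ} {x : R} :
    x ∈ latticePow A τ i ↔ ((τ⁻¹ ^ i : Rˣ) : R) * x ∈ A := Iff.rfl

theorem mem_latticePow_zero {A : Subring R} {τ : Rˣ} {x : R} :
    x ∈ latticePow A τ 0 ↔ x ∈ A := by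
  rw [mem_latticePow, pow_zero, Units.val_one, one_mul]

variable {A : Subring R} {τ : Rˣ}

/-- Multiplication by τ^(-i) carries the pair τ^(i+1)A ⊆ τ^i A to τA ⊆ A. -/
theorem relIndex_latticePow_succ (i : ℕ) :
    (latticePow A τ (i + 1)).relIndex (latticePow A τ i) =
      (latticePow A τ 1).relIndex (latticePow A τ 0) := by
  have h1 : latticePow A τ (i + 1) =
      (latticePow A τ 1).comap (AddMonoidHom.mulLeft ((τ⁻¹ ^ i : Rˣ) : R)) := by
    ext x
    rw [AddSubgroup.mem_comap, mem_latticePow, mem_latticePow, AddMonoidHom.coe_mulLeft,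
      ← mul_assoc, ← Units.val_mul, pow_one, pow_succ']
  rw [h1, AddSubgroup.relIndex_comap]
  congr 1
  ext x
  rw [mem_latticePow_zero]
  constructor
  · rintro ⟨y, hy, rfl⟩
    exact hy
  · intro hx
    refine ⟨((τ ^ i : Rˣ) : R) * x, ?_, ?_⟩
    · rw [SetLike.mem_coe, mem_latticePow, ← mul_assoc, ← Units.val_mul, inv_pow, inv_mul_cancel,
        Units.val_one, one_mul]
      exact hx
    · rw [AddMonoidHom.coe_mulLeft, ← mul_assoc, ← Units.val_mul, inv_pow, inv_mul_cancel,
        Units.val_one, one_mul]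

theorem latticePow_le {τ : Rˣ} (hτ : (τ : R) ∈ A) {i j : ℕ} (hij : i ≤ j) :
    latticePow A τ j ≤ latticePow A τ i := by
  induction hij with
  | refl => exact le_rfl
  | step _ ih =>
    refine le_trans (fun x hx => ?_) ih
    rw [mem_latticePow] at hx ⊢
    have := A.mul_mem hτ hx
    rwa [← mul_assoc, ← Units.val_mul, pow_succ', mul_inv_cancel_left] at this

theorem relIndex_latticePow_one (hτ : (τ : R) ∈ A) (i : ℕ) :
    (latticePow A τ (i + 1)).relIndex (latticePow A τ 1) =
      (latticePow A τ 1).relIndex (latticePow A τ 0) ^ i := by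
  induction i with
  | zero => rw [pow_zero, zero_add, AddSubgroup.relIndex_self]
  | succ i ih =>
    rw [← AddSubgroup.relIndex_mul_relIndex _ (latticePow A τ (i + 1)) _
      (latticePow_le hτ (by omega)) (latticePow_le hτ (by omega)), ih, relIndex_latticePow_succ,
      pow_succ']

/-- `A` is stable under conjugation by `τ`, so that the lattices `τ^i A` are two-sided ideals. -/
theorem mul_mem_latticePow (hconj : ∀ x ∈ A, ((τ⁻¹ : Rˣ) : R) * x * τ ∈ A) (i : ℕ) {a x : R}
    (ha : a ∈ A) (hx : x ∈ latticePow A τ i) : a * x ∈ latticePow A τ i := by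
  have hpow : ∀ i : ℕ, ∀ x ∈ A, ((τ⁻¹ ^ i : Rˣ) : R) * x * (τ ^ i : Rˣ) ∈ A := by
    intro i
    induction i with
    | zero => intro x hx; simpa using hx
    | succ i ih =>
      intro x hx
      have := hconj _ (ih x hx)
      rw [pow_succ', pow_succ, Units.val_mul, Units.val_mul]
      simpa only [mul_assoc] using this
  rw [mem_latticePow] at hx ⊢
  have := A.mul_mem (hpow i a ha) hx
  rwa [mul_assoc, ← mul_assoc ((τ ^ i : Rˣ) : R), ← Units.val_mul, inv_pow, mul_inv_cancel,
    Units.val_one, one_mul, mul_assoc, ← inv_pow] at this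

/-- Modulo τ^(i+1)A the group 1 + τA has as image the translate by 1 of the image of τA. So the
multiplicative index equals the additive index [τA : τ^(i+1)A]. -/
theorem relIndex_unit_filtration (hτ : (τ : R) ∈ A)
    (hconj : ∀ x ∈ A, ((τ⁻¹ : Rˣ) : R) * x * τ ∈ A)
    (hunit : ∀ x ∈ latticePow A τ 1, ∃ g ∈ A.toSubmonoid.units, (g : R) = 1 + x)
    {N : ℕ → Subgroup Rˣ}
    (hN : ∀ i g, g ∈ N i ↔ g ∈ A.toSubmonoid.units ∧ (g : R) - 1 ∈ latticePow A τ i) (i : ℕ) :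
    (N (i + 1)).relIndex (N 1) = (latticePow A τ 1).relIndex (latticePow A τ 0) ^ i := by
  rw [relIndex_eq_card_image (latticePow A τ (i + 1)) (N 1) (N (i + 1)),
    ← relIndex_latticePow_one hτ,
    addRelIndex_eq_card_image]
  · have h1 : (fun h : Rˣ => ((h : R) : R ⧸ latticePow A τ (i + 1))) '' (N 1 : Set Rˣ) =
        (Equiv.addRight ((1 : R) : R ⧸ latticePow A τ (i + 1))) ''
          ((fun x : R => (x : R ⧸ latticePow A τ (i + 1))) '' (latticePow A τ 1 : Set R)) := by
      ext z
      constructor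
      · rintro ⟨g, hg, rfl⟩
        refine ⟨_, ⟨(g : R) - 1, ((hN 1 g).1 hg).2, rfl⟩, ?_⟩
        simp only [Equiv.coe_addRight]
        rw [← QuotientAddGroup.mk_add, sub_add_cancel]
      · rintro ⟨_, ⟨x, hx, rfl⟩, rfl⟩
        obtain ⟨g, hg, hgx⟩ := hunit x hx
        refine ⟨g, (hN 1 g).2 ⟨hg, by rwa [hgx, add_sub_cancel_left]⟩, ?_⟩
        simp only [Equiv.coe_addRight]
        rw [← QuotientAddGroup.mk_add, hgx, add_comm x 1]
    rw [h1]
    exact Nat.card_image_of_injective (Equiv.injective _) _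
  · intro h hh l hl
    exact mul_mem_latticePow hconj _ ((hN 1 h).1 hh).1.1 hl
  · intro h hh
    rw [hN]
    exact ⟨fun h' => h'.2, fun h' => ⟨((hN 1 h).1 hh).1, h'⟩⟩

/-- The units of a local ring modulo the principal units. -/
theorem relIndex_units_of_isLocal (hA : (1 : R) ∉ latticePow A τ 1)
    (hconj : ∀ x ∈ A, ((τ⁻¹ : Rˣ) : R) * x * τ ∈ A)
    (hlocal : ∀ x ∈ A, x ∉ latticePow A τ 1 → ∃ g ∈ A.toSubmonoid.units, (g : R) = x)
    {N : ℕ → Subgroup Rˣ}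
    (hN : ∀ i g, g ∈ N i ↔ g ∈ A.toSubmonoid.units ∧ (g : R) - 1 ∈ latticePow A τ i) :
    (N 1).relIndex A.toSubmonoid.units =
      (latticePow A τ 1).relIndex (latticePow A τ 0) - 1 := by
  rw [relIndex_eq_card_image (latticePow A τ 1) _ (N 1), addRelIndex_eq_card_image,
    Nat.card_coe_set_eq, Nat.card_coe_set_eq]
  · have h1 : (fun h : Rˣ => ((h : R) : R ⧸ latticePow A τ 1)) '' (A.toSubmonoid.units : Set Rˣ) =
        ((fun x : R => (x : R ⧸ latticePow A τ 1)) '' (latticePow A τ 0 : Set R)) \ {0} := by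
      ext z
      constructor
      · rintro ⟨g, hg, rfl⟩
        refine ⟨⟨g, mem_latticePow_zero.2 hg.1, rfl⟩, fun h0 => hA ?_⟩
        have h2 : (g : R) ∈ latticePow A τ 1 := (QuotientAddGroup.eq_zero_iff _).1 h0
        have := mul_mem_latticePow hconj 1 hg.2 h2
        rwa [Units.coeHom_apply, Units.inv_mul] at this
      · rintro ⟨⟨x, hx, rfl⟩, h0⟩
        obtain ⟨g, hg, rfl⟩ := hlocal x (mem_latticePow_zero.1 hx) fun h =>
          h0 ((QuotientAddGroup.eq_zero_iff _).2 h)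
        exact ⟨g, hg, rfl⟩
    rw [h1]
    exact Set.ncard_sdiff_singleton_of_mem ⟨0, zero_mem _, rfl⟩
  · intro h hh l hl
    exact mul_mem_latticePow hconj _ hh.1 hl
  · intro h hh
    rw [hN]
    exact ⟨fun h' => h'.2, fun h' => ⟨hh, h'⟩⟩

theorem card_mul_relIndex_map_comap {A B C : Type*} [Group A] [Group B] [Group C] {f : A →* B}
    (hf : Function.Injective f) {r : A →* C} (hr : Function.Surjective r) {X Y : Subgroup C}
    (hXY : X ≤ Y) :
    Nat.card X * ((X.comap r).map f).relIndex ((Y.comap r).map f) = Nat.card Y := by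
  rw [Subgroup.relIndex_map_map_of_injective _ _ hf, Subgroup.relIndex_comap,
    Subgroup.map_comap_eq_self_of_surjective hr, ← Subgroup.relIndex_bot_left,
    ← Subgroup.relIndex_bot_left, Subgroup.relIndex_mul_relIndex _ _ _ bot_le hXY]

/-- Every coset of K ∩ L in L has a representative in H: the second isomorphism theorem for coset
spaces, without normality. -/
theorem relIndex_eq_of_forall_exists {G : Type*} [Group G] {H K L : Subgroup G} (hHL : H ≤ L)
    (h : ∀ l ∈ L, ∃ x ∈ H, x⁻¹ * l ∈ K) : K.relIndex L = K.relIndex H := by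
  symm
  let f : H ⧸ K.subgroupOf H → L ⧸ K.subgroupOf L :=
    Quotient.map' (Subgroup.inclusion hHL) fun a b hab => by
      rw [QuotientGroup.leftRel_apply] at hab ⊢
      exact hab
  refine Nat.card_congr (Equiv.ofBijective f ⟨?_, ?_⟩)
  · intro x y hxy
    obtain ⟨a, rfl⟩ := QuotientGroup.mk_surjective x
    obtain ⟨b, rfl⟩ := QuotientGroup.mk_surjective y
    have h1 := QuotientGroup.eq.1 (show (QuotientGroup.mk (Subgroup.inclusion hHL a) :
      L ⧸ K.subgroupOf L) = QuotientGroup.mk (Subgroup.inclusion hHL b) from hxy)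
    exact QuotientGroup.eq.2 h1
  · intro y
    obtain ⟨l, rfl⟩ := QuotientGroup.mk_surjective y
    obtain ⟨x, hx, hxl⟩ := h l l.2
    exact ⟨QuotientGroup.mk ⟨x, hx⟩, QuotientGroup.eq.2 hxl⟩

end CosetCounting


/-! ### Subgroups of GL₂ of the residue field -/

section FiniteField

variable (k : Type*) [Field k]

/-- The Borel subgroup of upper triangular matrices. -/
def borelSubgroup : Subgroup (GL (Fin 2) k) where
  carrier := {h | h.val 1 0 = 0}
  one_mem' := by simp
  mul_mem' := by
    intro a b ha hb
    simp only [Set.mem_ofPred_eq] at ha hb ⊢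
    rw [Units.val_mul, Matrix.mul_apply, Fin.sum_univ_two, ha, hb]
    simp
  inv_mem' := by
    intro a ha
    simp only [Set.mem_ofPred_eq] at ha ⊢
    rw [val_inv_eq]
    simp [ha]

/-- The subgroup of upper unipotent matrices. -/
def unipotentSubgroup : Subgroup (GL (Fin 2) k) where
  carrier := {h | h.val 1 0 = 0 ∧ h.val 0 0 = 1 ∧ h.val 1 1 = 1}
  one_mem' := by simp
  mul_mem' := by
    rintro a b ⟨ha, ha', ha''⟩ ⟨hb, hb', hb''⟩
    simp only [Set.mem_ofPred_eq, Units.val_mul, Matrix.mul_apply, Fin.sum_univ_two]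
    simp [*]
  inv_mem' := by
    rintro a ⟨ha, ha', ha''⟩
    simp only [Set.mem_ofPred_eq]
    rw [val_inv_eq, Matrix.det_fin_two]
    simp [*]

variable {k}

theorem mem_borelSubgroup_iff {h : GL (Fin 2) k} : h ∈ borelSubgroup k ↔ h.val 1 0 = 0 := Iff.rfl

theorem mem_unipotentSubgroup_iff {h : GL (Fin 2) k} : h ∈ unipotentSubgroup k ↔
    h.val 1 0 = 0 ∧ h.val 0 0 = 1 ∧ h.val 1 1 = 1 := Iff.rfl

variable (k)

theorem card_unipotentSubgroup : Nat.card (unipotentSubgroup k) = Nat.card k := by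
  refine Nat.card_congr (Equiv.ofBijective (fun h : unipotentSubgroup k => h.1.val 0 1) ⟨?_, ?_⟩)
  · rintro ⟨a, ha, ha', ha''⟩ ⟨b, hb, hb', hb''⟩ hab
    refine Subtype.ext (Units.ext (Matrix.ext fun i j => ?_))
    have : a.val 0 1 = b.val 0 1 := hab
    fin_cases i <;> fin_cases j <;> simp [*]
  · intro x
    refine ⟨⟨Matrix.GeneralLinearGroup.mkOfDetNeZero !![1, x; 0, 1] (by simp), ?_⟩, ?_⟩
    · exact ⟨rfl, rfl, rfl⟩
    · rfl

theorem card_borelSubgroup [Finite k] :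
    Nat.card (borelSubgroup k) = (Nat.card k - 1) ^ 2 * Nat.card k := by
  have e : (borelSubgroup k) ≃ (kˣ × kˣ) × k := by
    refine Equiv.ofBijective (fun h : borelSubgroup k =>
      ((Units.mk0 (h.1.val 0 0) ?_, Units.mk0 (h.1.val 1 1) ?_), h.1.val 0 1)) ⟨?_, ?_⟩
    · intro h0
      have := det_ne_zero h.1
      rw [Matrix.det_fin_two, h0, mem_borelSubgroup_iff.1 h.2] at this
      simp at this
    · intro h0
      have := det_ne_zero h.1
      rw [Matrix.det_fin_two, h0, mem_borelSubgroup_iff.1 h.2] at this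
      simp at this
    · rintro ⟨a, ha⟩ ⟨b, hb⟩ hab
      simp only [Prod.mk.injEq, Units.ext_iff, Units.val_mk0] at hab
      rw [mem_borelSubgroup_iff] at ha hb
      obtain ⟨⟨h0, h1⟩, h2⟩ := hab
      refine Subtype.ext (Units.ext (Matrix.ext fun i j => ?_))
      fin_cases i <;> fin_cases j <;> simp [*]
    · rintro ⟨⟨x, y⟩, z⟩
      refine ⟨⟨Matrix.GeneralLinearGroup.mkOfDetNeZero !![(x : k), z; 0, y] (by simp), rfl⟩, ?_⟩
      ext <;> rfl
  rw [Nat.card_congr e, Nat.card_prod, Nat.card_prod, Nat.card_units, sq]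

end FiniteField

/-! ### Reduction modulo 𝔭 and the indices at level one -/

section Reduction

open ValuativeRel

variable (F : Type*) [Field F] [ValuativeRel F]

/-- The inclusion of `GL₂(𝔬)` in `GL₂(F)`. -/
noncomputable abbrev integralInclusion : GL (Fin 2) 𝒪[F] →* GL (Fin 2) F :=
  Matrix.GeneralLinearGroup.map 𝒪[F].subtype

theorem integralInclusion_injective : Function.Injective (integralInclusion F) := by
  intro a b h
  refine Units.ext (Matrix.ext fun i j => Subtype.ext ?_)
  exact congrArg (fun g : GL (Fin 2) F => g.val i j) h

variable {F}

theorem exists_integralInclusion_eq {g : GL (Fin 2) F} (hg : g ∈ unitGroup (orderM F)) :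
    ∃ h, integralInclusion F h = g := by
  let x : Matrix (Fin 2) (Fin 2) 𝒪[F] := Matrix.of fun i j => ⟨g.val i j, hg.1 i j⟩
  let y : Matrix (Fin 2) (Fin 2) 𝒪[F] := Matrix.of fun i j => ⟨(g⁻¹).val i j, hg.2 i j⟩
  have hinj : Function.Injective (𝒪[F].subtype.mapMatrix : Matrix (Fin 2) (Fin 2) 𝒪[F] →+* _) :=
    Matrix.map_injective Subtype.val_injective
  have hx : 𝒪[F].subtype.mapMatrix x = g.val := rfl
  have hy : 𝒪[F].subtype.mapMatrix y = (g⁻¹).val := rfl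
  exact ⟨⟨x, y, hinj (by rw [map_mul, hx, hy, map_one, Units.mul_inv]),
    hinj (by rw [map_mul, hx, hy, map_one, Units.inv_mul])⟩, Units.ext rfl⟩

theorem integralInclusion_mem (h : GL (Fin 2) 𝒪[F]) :
    integralInclusion F h ∈ unitGroup (orderM F) := by
  refine ⟨fun i j => (h.val i j).2, fun i j => ?_⟩
  rw [← map_inv]
  exact ((h⁻¹).val i j).2

theorem toSubmodule_mul_radical (𝔘 : Subalgebra 𝒪[F] (Matrix (Fin 2) (Fin 2) F)) :
    Subalgebra.toSubmodule 𝔘 * radical 𝔘 = radical 𝔘 := by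
  refine le_antisymm (Submodule.mul_le.2 ?_) fun x hx => ?_
  · rintro a ha _ ⟨b, hb, rfl⟩
    exact ⟨⟨a, ha⟩ * b, Ideal.mul_mem_left _ _ hb, rfl⟩
  · have := Submodule.mul_mem_mul (show (1 : Matrix (Fin 2) (Fin 2) F) ∈
      Subalgebra.toSubmodule 𝔘 from one_mem 𝔘) hx
    rwa [one_mul] at this

theorem mem_unitFiltration_one_iff {𝔘 : Subalgebra 𝒪[F] (Matrix (Fin 2) (Fin 2) F)}
    {g : GL (Fin 2) F} :
    g ∈ unitFiltration 𝔘 1 ↔ g ∈ unitGroup 𝔘 ∧ g.val - 1 ∈ radical 𝔘 := by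
  have : g ∈ unitFiltration 𝔘 1 ↔ g ∈ unitGroup 𝔘 ∧
    g.val - 1 ∈ Subalgebra.toSubmodule 𝔘 * radical 𝔘 ^ 1 := Iff.rfl
  rw [this, pow_one, toSubmodule_mul_radical]

theorem unitGroup_orderJ_le : unitGroup (orderJ F) ≤ unitGroup (orderM F) :=
  fun _ hg => ⟨orderJ_le_orderM hg.1, orderJ_le_orderM hg.2⟩

variable (F) [TopologicalSpace F] [IsNonarchimedeanLocalField F]

theorem residue_eq_zero_iff_valuation_lt (x : 𝒪[F]) :
    IsLocalRing.residue 𝒪[F] x = 0 ↔ valuation F x < 1 := by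
  rw [IsLocalRing.residue_eq_zero_iff, IsLocalRing.mem_maximalIdeal, mem_nonunits_iff,
    Valuation.Integers.isUnit_iff_valuation_eq_one (Valuation.integer.integers (valuation F))]
  have : valuation F x ≤ 1 := x.2
  exact ⟨fun h => lt_of_le_of_ne this h, fun h => h.ne⟩

theorem residue_eq_one_iff_valuation_lt (x : 𝒪[F]) :
    IsLocalRing.residue 𝒪[F] x = 1 ↔ valuation F (x - 1) < 1 := by
  rw [← sub_eq_zero, ← map_one (IsLocalRing.residue 𝒪[F]), ← map_sub,
    residue_eq_zero_iff_valuation_lt]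
  simp

/-- The reduction of `GL₂(𝔬)` modulo the maximal ideal. -/
noncomputable abbrev integralReduction : GL (Fin 2) 𝒪[F] →* GL (Fin 2) 𝓀[F] :=
  Matrix.GeneralLinearGroup.map (IsLocalRing.residue 𝒪[F])

theorem integralReduction_surjective : Function.Surjective (integralReduction F) := by
  intro h
  choose s hs using IsLocalRing.residue_surjective (R := 𝒪[F])
  let x : Matrix (Fin 2) (Fin 2) 𝒪[F] := Matrix.of fun i j => s (h.val i j)
  have hx : x.map (IsLocalRing.residue 𝒪[F]) = h.val := by
    ext i j
    simp [x, hs]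
  have hdet : IsUnit x.det := by
    by_contra hu
    have h1 : IsLocalRing.residue 𝒪[F] x.det = 0 := by
      rw [IsLocalRing.residue_eq_zero_iff]
      exact hu
    rw [RingHom.map_det, RingHom.mapMatrix_apply, hx] at h1
    exact det_ne_zero h h1
  refine ⟨Matrix.GeneralLinearGroup.mk'' x hdet, Units.ext ?_⟩
  exact hx

variable {F}

/-- Used to match GL₂(𝔬), U_𝓜^1, U_𝓙 and U_𝓙^1 with the full group, the trivial group, the Borel and
the unipotent subgroup over the residue field, so that indices become quotients of finite orders. -/
theorem map_comap_reduction {X : Subgroup (GL (Fin 2) 𝓀[F])} {Y : Subgroup (GL (Fin 2) F)}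
    (hY : Y ≤ unitGroup (orderM F))
    (h : ∀ h : GL (Fin 2) 𝒪[F], integralReduction F h ∈ X ↔ integralInclusion F h ∈ Y) :
    (X.comap (integralReduction F)).map (integralInclusion F) = Y := by
  ext g
  constructor
  · rintro ⟨a, ha, rfl⟩
    exact (h a).1 ha
  · intro hg
    obtain ⟨a, rfl⟩ := exists_integralInclusion_eq (hY hg)
    exact ⟨a, (h a).2 hg, rfl⟩

theorem map_comap_top :
    ((⊤ : Subgroup (GL (Fin 2) 𝓀[F])).comap (integralReduction F)).map (integralInclusion F) =
      unitGroup (orderM F) :=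
  map_comap_reduction le_rfl fun h => by simp [integralInclusion_mem]

theorem map_comap_bot :
    ((⊥ : Subgroup (GL (Fin 2) 𝓀[F])).comap (integralReduction F)).map (integralInclusion F) =
      unitFiltration (orderM F) 1 := by
  refine map_comap_reduction (fun g hg => hg.1) fun h => ?_
  rw [mem_unitFiltration_one_iff, mem_radical_orderM_iff, Subgroup.mem_bot]
  have e : ∀ i j, valuation F (((integralInclusion F h).val - 1) i j) < 1 ↔
      (integralReduction F h).val i j = (1 : Matrix (Fin 2) (Fin 2) 𝓀[F]) i j := by
    intro i j
    have h1 : ((integralInclusion F h).val - 1) i j =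
        ((h.val i j - (1 : Matrix (Fin 2) (Fin 2) 𝒪[F]) i j : 𝒪[F]) : F) := by
      rw [Matrix.sub_apply, AddSubgroupClass.coe_sub]
      congr 1
      rw [Matrix.one_apply, Matrix.one_apply]
      split_ifs <;> rfl
    rw [h1, ← residue_eq_zero_iff_valuation_lt, map_sub, sub_eq_zero]
    have h2 : IsLocalRing.residue 𝒪[F] ((1 : Matrix (Fin 2) (Fin 2) 𝒪[F]) i j) =
        (1 : Matrix (Fin 2) (Fin 2) 𝓀[F]) i j := by
      rw [Matrix.one_apply, Matrix.one_apply]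
      split_ifs <;> simp
    rw [h2]
    rfl
  constructor
  · intro h0
    refine ⟨integralInclusion_mem h, fun i j => (e i j).2 ?_⟩
    rw [h0]
    rfl
  · rintro ⟨-, h0⟩
    exact Units.ext (Matrix.ext fun i j => (e i j).1 (h0 i j))

theorem map_comap_borel :
    ((borelSubgroup 𝓀[F]).comap (integralReduction F)).map (integralInclusion F) =
      unitGroup (orderJ F) := by
  refine map_comap_reduction unitGroup_orderJ_le fun h => ?_
  rw [mem_borelSubgroup_iff, mem_unitGroup_orderJ_iff]
  have hm := mem_unitGroup_orderM_iff.1 (integralInclusion_mem h)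
  have e : (integralReduction F h).val 1 0 = 0 ↔
    valuation F ((integralInclusion F h).val 1 0) < 1 := residue_eq_zero_iff_valuation_lt F _
  rw [e]
  exact ⟨fun h' => ⟨mem_orderJ_iff.2 ⟨hm.1, h'⟩, hm.2⟩, fun h' => (mem_orderJ_iff.1 h'.1).2⟩

theorem map_comap_unipotent :
    ((unipotentSubgroup 𝓀[F]).comap (integralReduction F)).map (integralInclusion F) =
      unitFiltration (orderJ F) 1 := by
  refine map_comap_reduction (fun g hg => unitGroup_orderJ_le hg.1) fun h => ?_
  rw [mem_unipotentSubgroup_iff, mem_unitFiltration_one_iff, mem_unitGroup_orderJ_iff,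
    mem_radical_orderJ_iff]
  have hm := mem_unitGroup_orderM_iff.1 (integralInclusion_mem h)
  have e : (integralReduction F h).val 1 0 = 0 ↔
    valuation F ((integralInclusion F h).val 1 0) < 1 := residue_eq_zero_iff_valuation_lt F _
  have e1 : ∀ i, (integralReduction F h).val i i = 1 ↔
      valuation F ((integralInclusion F h).val i i - 1) < 1 :=
    fun i => residue_eq_one_iff_valuation_lt F _
  rw [e, e1, e1]
  simp only [Matrix.sub_apply, Matrix.one_apply_eq, Matrix.one_apply_ne zero_ne_one,
    Matrix.one_apply_ne one_ne_zero, sub_zero]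
  exact ⟨fun ⟨h1, h2, h3⟩ => ⟨⟨mem_orderJ_iff.2 ⟨hm.1, h1⟩, hm.2⟩, h2, hm.1 0 1, h1, h3⟩,
    fun ⟨_, h2, _, h1, h3⟩ => ⟨h1, h2, h3⟩⟩

variable (F)

theorem two_le_card_residueField : 2 ≤ Nat.card 𝓀[F] := Finite.one_lt_card

theorem relIndex_unitFiltration_orderM :
    (unitFiltration (orderM F) 1).relIndex (unitGroup (orderM F)) =
      (Nat.card 𝓀[F] ^ 2 - 1) * (Nat.card 𝓀[F] ^ 2 - Nat.card 𝓀[F]) := by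
  have h := card_mul_relIndex_map_comap (integralInclusion_injective F)
    (integralReduction_surjective F) (bot_le (a := (⊤ : Subgroup (GL (Fin 2) 𝓀[F]))))
  rw [map_comap_top, map_comap_bot, Subgroup.card_bot, one_mul, Subgroup.card_top] at h
  have : Fintype 𝓀[F] := Fintype.ofFinite _
  rw [h, Matrix.card_GL_field, Fin.prod_univ_two, Nat.card_eq_fintype_card]
  simp

theorem relIndex_unitFiltration_orderJ :
    (unitFiltration (orderJ F) 1).relIndex (unitGroup (orderJ F)) =
      (Nat.card 𝓀[F] - 1) ^ 2 := by
  have h := card_mul_relIndex_map_comap (integralInclusion_injective F)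
    (integralReduction_surjective F) (X := unipotentSubgroup 𝓀[F]) (Y := borelSubgroup 𝓀[F])
    fun _ h => h.1
  rw [map_comap_borel, map_comap_unipotent, card_unipotentSubgroup, card_borelSubgroup,
    mul_comm] at h
  exact Nat.eq_of_mul_eq_mul_right (by have := two_le_card_residueField F; omega) h

theorem relIndex_unitGroup_orderJ :
    (unitGroup (orderJ F)).relIndex (unitGroup (orderM F)) = Nat.card 𝓀[F] + 1 := by
  have h := card_mul_relIndex_map_comap (integralInclusion_injective F)
    (integralReduction_surjective F) (le_top (a := borelSubgroup 𝓀[F]))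
  have : Fintype 𝓀[F] := Fintype.ofFinite _
  rw [map_comap_borel, map_comap_top, card_borelSubgroup, Subgroup.card_top, Matrix.card_GL_field,
    Fin.prod_univ_two, ← Nat.card_eq_fintype_card] at h
  have hq := two_le_card_residueField F
  -- With q = 2 + m the truncated subtractions in the order of GL₂ become products.
  obtain ⟨m, hm⟩ := Nat.exists_eq_add_of_le hq
  rw [hm] at h ⊢
  have e1 : (2 + m) ^ 2 - (2 + m) ^ ((0 : Fin 2) : ℕ) = (1 + m) * (3 + m) := by
    simp only [Fin.val_zero, pow_zero]
    rw [Nat.sub_eq_iff_eq_add (by nlinarith)]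
    ring
  have e2 : (2 + m) ^ 2 - (2 + m) ^ ((1 : Fin 2) : ℕ) = (1 + m) * (2 + m) := by
    simp only [Fin.val_one, pow_one]
    rw [Nat.sub_eq_iff_eq_add (by nlinarith)]
    ring
  rw [e1, e2, show 2 + m - 1 = 1 + m by omega] at h
  have hpos : 0 < (1 + m) ^ 2 * (2 + m) := by positivity
  refine Nat.eq_of_mul_eq_mul_left hpos (h.trans ?_)
  ring

/-! #### Additive indices -/

theorem addRelIndex_eq_card_of_surjective {R C : Type*} [AddCommGroup R] [AddGroup C]
    {L M : AddSubgroup R} (r : M →+ C) (hr : Function.Surjective r)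
    (h : ∀ x : M, r x = 0 ↔ (x : R) ∈ L) : L.relIndex M = Nat.card C := by
  have : L.addSubgroupOf M = r.ker := by
    ext x
    rw [AddSubgroup.mem_addSubgroupOf, AddMonoidHom.mem_ker, h]
  rw [AddSubgroup.relIndex, this, AddSubgroup.index_ker, AddMonoidHom.range_eq_top.2 hr]
  exact Nat.card_congr AddSubgroup.topEquiv.toEquiv

theorem relIndex_radical_orderM :
    (radical (orderM F)).toAddSubgroup.relIndex (orderM F).toSubring.toAddSubgroup =
      Nat.card 𝓀[F] ^ 4 := by
  let r : (orderM F).toSubring.toAddSubgroup →+ (Fin 2 → Fin 2 → 𝓀[F]) :=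
    { toFun := fun x i j => IsLocalRing.residue 𝒪[F] ⟨x.1 i j, x.2 i j⟩
      map_zero' := by
        ext i j
        exact map_zero (IsLocalRing.residue 𝒪[F])
      map_add' := fun x y => by
        ext i j
        exact map_add (IsLocalRing.residue 𝒪[F]) ⟨x.1 i j, x.2 i j⟩ ⟨y.1 i j, y.2 i j⟩ }
  have hr : Function.Surjective r := by
    intro y
    choose s hs using IsLocalRing.residue_surjective (R := 𝒪[F])
    refine ⟨⟨Matrix.of fun i j => (s (y i j) : F), fun i j => (s (y i j)).2⟩, ?_⟩
    ext i j
    exact hs _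
  rw [addRelIndex_eq_card_of_surjective r hr fun x => ?_]
  · rw [Nat.card_fun, Nat.card_fun, Nat.card_fin, ← pow_mul]
  · rw [Submodule.mem_toAddSubgroup, mem_radical_orderM_iff]
    simp only [funext_iff]
    exact forall_congr' fun i => forall_congr' fun j =>
      residue_eq_zero_iff_valuation_lt F ⟨x.1 i j, x.2 i j⟩

theorem relIndex_radical_orderJ :
    (radical (orderJ F)).toAddSubgroup.relIndex (orderJ F).toSubring.toAddSubgroup =
      Nat.card 𝓀[F] ^ 2 := by
  -- Only the diagonal matters: the upper right entry is unrestricted in the radical, and the lower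
  -- left entry lies in 𝔭 already in 𝓙.
  let r : (orderJ F).toSubring.toAddSubgroup →+ (Fin 2 → 𝓀[F]) :=
    { toFun := fun x i => IsLocalRing.residue 𝒪[F] ⟨x.1 i i, x.2.1 i i⟩
      map_zero' := by
        ext i
        exact map_zero (IsLocalRing.residue 𝒪[F])
      map_add' := fun x y => by
        ext i
        exact map_add (IsLocalRing.residue 𝒪[F]) ⟨x.1 i i, x.2.1 i i⟩ ⟨y.1 i i, y.2.1 i i⟩ }
  have hr : Function.Surjective r := by
    intro y
    choose s hs using IsLocalRing.residue_surjective (R := 𝒪[F])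
    refine ⟨⟨Matrix.diagonal fun i => (s (y i) : F), fun i j => ?_, ?_⟩, ?_⟩
    · rw [Matrix.diagonal_apply]
      split_ifs
      · exact (s (y i)).2
      · exact zero_mem _
    · simp
    · ext i
      simp [r, hs]
  rw [addRelIndex_eq_card_of_surjective r hr fun x => ?_]
  · rw [Nat.card_fun, Nat.card_fin]
  · have h := fun i => residue_eq_zero_iff_valuation_lt F ⟨x.1 i i, x.2.1 i i⟩
    rw [Submodule.mem_toAddSubgroup, mem_radical_orderJ_iff, ← h 0, ← h 1, funext_iff,
      Fin.forall_fin_two]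
    exact ⟨fun ⟨h1, h2⟩ => ⟨h1, x.2.1 0 1, x.2.2, h2⟩, fun ⟨h1, _, _, h2⟩ => ⟨h1, h2⟩⟩

end Reduction


/-! ### Orders whose radical is principal -/

section OrderUniformizer

open ValuativeRel

variable {F : Type*} [Field F] [ValuativeRel F]

/-- `τ` generates the Jacobson radical of the order `𝔘` as a left and as a right ideal. -/
structure IsOrderUniformizer (𝔘 : Subalgebra 𝒪[F] (Matrix (Fin 2) (Fin 2) F))
    (τ : GL (Fin 2) F) : Prop where
  left : ∀ x, x ∈ radical 𝔘 ↔ (τ⁻¹).val * x ∈ 𝔘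
  right : ∀ x, x ∈ radical 𝔘 ↔ x * (τ⁻¹).val ∈ 𝔘

variable {𝔘 : Subalgebra 𝒪[F] (Matrix (Fin 2) (Fin 2) F)} {τ : GL (Fin 2) F}

theorem IsOrderUniformizer.mem_radical (h : IsOrderUniformizer 𝔘 τ) : τ.val ∈ radical 𝔘 :=
  (h.left _).2 (by rw [Units.inv_mul]; exact one_mem 𝔘)

theorem IsOrderUniformizer.mem (h : IsOrderUniformizer 𝔘 τ) : τ.val ∈ 𝔘 :=
  (mem_radical_iff.1 h.mem_radical).1

theorem IsOrderUniformizer.conj_mem (h : IsOrderUniformizer 𝔘 τ) {x : Matrix (Fin 2) (Fin 2) F}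
    (hx : x ∈ 𝔘) : (τ⁻¹).val * x * τ.val ∈ 𝔘 := by
  rw [mul_assoc, ← h.left, h.right, mul_assoc, Units.mul_inv, mul_one]
  exact hx

theorem IsOrderUniformizer.conj_inv_mem (h : IsOrderUniformizer 𝔘 τ)
    {x : Matrix (Fin 2) (Fin 2) F} (hx : x ∈ 𝔘) : τ.val * x * (τ⁻¹).val ∈ 𝔘 := by
  rw [← h.right, h.left, ← mul_assoc, Units.inv_mul, one_mul]
  exact hx

/-- Since 𝔓 = τ𝔘, the product 𝔘𝔓^i is τ^i 𝔘. This replaces powers of submodules by the lattices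
whose indices are known. -/
theorem IsOrderUniformizer.mem_mul_radical_pow (h : IsOrderUniformizer 𝔘 τ) (i : ℕ)
    (x : Matrix (Fin 2) (Fin 2) F) : x ∈ Subalgebra.toSubmodule 𝔘 * radical 𝔘 ^ i ↔
      ((τ⁻¹ ^ i : GL (Fin 2) F)).val * x ∈ 𝔘 := by
  induction i generalizing x with
  | zero =>
    rw [pow_zero, mul_one, pow_zero, Units.val_one, one_mul]
    rfl
  | succ i ih =>
    have h1 : ((τ⁻¹ ^ (i + 1) : GL (Fin 2) F)).val * x =
        (τ⁻¹).val * (((τ⁻¹ ^ i : GL (Fin 2) F)).val * x) := by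
      rw [pow_succ', Units.val_mul, mul_assoc]
    rw [h1, ← h.left, pow_succ, ← mul_assoc]
    clear h1
    constructor
    · intro hx
      induction hx using Submodule.mul_induction_on' with
      | mem_mul_mem a ha b hb =>
        rw [← mul_assoc, ← toSubmodule_mul_radical]
        exact Submodule.mul_mem_mul ((ih a).1 ha) hb
      | add a _ b _ ha hb =>
        rw [mul_add]
        exact add_mem ha hb
    · intro hx
      have h2 : ((τ ^ i : GL (Fin 2) F)).val ∈ Subalgebra.toSubmodule 𝔘 * radical 𝔘 ^ i := by
        rw [ih, inv_pow, Units.inv_mul]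
        exact one_mem 𝔘
      have := Submodule.mul_mem_mul h2 hx
      rwa [inv_pow, Units.mul_inv_cancel_left] at this

theorem IsOrderUniformizer.mem_unitFiltration_iff (h : IsOrderUniformizer 𝔘 τ) (i : ℕ)
    (g : GL (Fin 2) F) : g ∈ unitFiltration 𝔘 i ↔
      g ∈ 𝔘.toSubring.toSubmonoid.units ∧ g.val - 1 ∈ latticePow 𝔘.toSubring τ i :=
  and_congr Iff.rfl (h.mem_mul_radical_pow i _)

theorem exists_unit_eq_one_add {x : Matrix (Fin 2) (Fin 2) F} (hx : x ∈ radical 𝔘) :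
    ∃ g ∈ unitGroup 𝔘, g.val = 1 + x := by
  obtain ⟨hx, h⟩ := mem_radical_iff.1 hx
  obtain ⟨z, hz, hzx⟩ := h 1 (one_mem _)
  rw [one_mul] at hzx
  exact ⟨⟨1 + x, z, mul_eq_one_comm.1 hzx, hzx⟩, ⟨add_mem (one_mem _) hx, hz⟩, rfl⟩

theorem IsOrderUniformizer.latticePow_one (h : IsOrderUniformizer 𝔘 τ) :
    latticePow 𝔘.toSubring τ 1 = (radical 𝔘).toAddSubgroup := by
  ext x
  rw [mem_latticePow, pow_one]
  exact (h.left x).symm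

theorem latticePow_zero {R : Type*} [Ring R] (A : Subring R) (τ : Rˣ) :
    latticePow A τ 0 = A.toAddSubgroup := by
  ext x
  exact mem_latticePow_zero

theorem IsOrderUniformizer.unitFiltration_antitone (h : IsOrderUniformizer 𝔘 τ) :
    Antitone (unitFiltration 𝔘) := by
  intro i j hij g hg
  rw [h.mem_unitFiltration_iff] at hg ⊢
  exact ⟨hg.1, latticePow_le h.mem hij hg.2⟩

/-- Pass through level one: the index of U^(i+1) in U^1 is [𝔘 : 𝔓]^i. -/
theorem IsOrderUniformizer.relIndex_unitFiltration (h : IsOrderUniformizer 𝔘 τ) (i : ℕ) :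
    (unitFiltration 𝔘 (i + 1)).relIndex (unitGroup 𝔘) =
      (radical 𝔘).toAddSubgroup.relIndex 𝔘.toSubring.toAddSubgroup ^ i *
        (unitFiltration 𝔘 1).relIndex (unitGroup 𝔘) := by
  rw [← Subgroup.relIndex_mul_relIndex _ (unitFiltration 𝔘 1) (unitGroup 𝔘)
    (h.unitFiltration_antitone (by omega)) fun _ hg => hg.1,
    relIndex_unit_filtration (A := 𝔘.toSubring) (N := unitFiltration 𝔘) h.mem
      (fun x hx => h.conj_mem hx) ?_ h.mem_unitFiltration_iff, h.latticePow_one, latticePow_zero]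
  intro x hx
  rw [h.latticePow_one] at hx
  exact exists_unit_eq_one_add hx

end OrderUniformizer

/-! ### The order of E and the group Eˣ U_𝔘^i -/

section FieldUnits

open ValuativeRel

variable {F : Type*} [Field F] [ValuativeRel F] {E : Type*} [Field E] [Algebra F E]
  (φ : E →ₐ[F] Matrix (Fin 2) (Fin 2) F) (𝔘 : Subalgebra 𝒪[F] (Matrix (Fin 2) (Fin 2) F))

/-- The embedding of the unit group of `E` in `GL₂(F)`. -/
abbrev unitsMap : Eˣ →* GL (Fin 2) F := Units.map (φ : E →* Matrix (Fin 2) (Fin 2) F)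

/-- The order of `E` defined by an order of `M₂(F)`. -/
noncomputable abbrev fieldOrder : Subring E :=
  𝔘.toSubring.comap (φ : E →+* Matrix (Fin 2) (Fin 2) F)

/-- `t` is a uniformizer of `E` such that `φ t` generates the radical of `𝔘`. -/
structure IsFieldUniformizer (t : Eˣ) : Prop where
  isOrderUniformizer : IsOrderUniformizer 𝔘 (unitsMap φ t)
  exists_zpow : ∀ x : Eˣ, ∃ m : ℤ, unitsMap φ (x * t ^ m) ∈ unitGroup 𝔘
  one_notMem : (1 : Matrix (Fin 2) (Fin 2) F) ∉ radical 𝔘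

variable {φ 𝔘}

theorem mem_fieldOrder_iff {x : E} : x ∈ fieldOrder φ 𝔘 ↔ φ x ∈ 𝔘 := Iff.rfl

theorem mem_units_fieldOrder_iff {x : Eˣ} :
    x ∈ (fieldOrder φ 𝔘).toSubmonoid.units ↔ unitsMap φ x ∈ unitGroup 𝔘 := Iff.rfl

variable {t : Eˣ}

theorem mem_latticePow_fieldOrder_iff {i : ℕ} {x : E} : x ∈ latticePow (fieldOrder φ 𝔘) t i ↔
    φ x ∈ latticePow 𝔘.toSubring (unitsMap φ t) i := by
  rw [mem_latticePow, mem_latticePow, mem_fieldOrder_iff, map_mul]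
  have : φ ((t⁻¹ ^ i : Eˣ) : E) = (((unitsMap φ t)⁻¹ ^ i : GL (Fin 2) F)).val := by
    rw [← map_inv, ← map_pow]
    rfl
  rw [this]
  rfl

namespace IsFieldUniformizer

variable (h : IsFieldUniformizer φ 𝔘 t)
include h

theorem mem_comap_unitFiltration_iff (i : ℕ) (x : Eˣ) :
    x ∈ (unitFiltration 𝔘 i).comap (unitsMap φ) ↔
      x ∈ (fieldOrder φ 𝔘).toSubmonoid.units ∧ (x : E) - 1 ∈ latticePow (fieldOrder φ 𝔘) t i := by
  rw [Subgroup.mem_comap, h.isOrderUniformizer.mem_unitFiltration_iff,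
    mem_latticePow_fieldOrder_iff, map_sub, map_one]
  rfl

theorem one_notMem_latticePow : (1 : E) ∉ latticePow (fieldOrder φ 𝔘) t 1 := by
  rw [mem_latticePow_fieldOrder_iff, h.isOrderUniformizer.latticePow_one, map_one]
  exact h.one_notMem

theorem inv_notMem : ((t⁻¹ : Eˣ) : E) ∉ fieldOrder φ 𝔘 := by
  have := h.one_notMem_latticePow
  rwa [mem_latticePow, pow_one, mul_one] at this

theorem mem_fieldOrder : (t : E) ∈ fieldOrder φ 𝔘 := h.isOrderUniformizer.mem

theorem zpow_mem_iff {m : ℤ} : ((t ^ m : Eˣ) : E) ∈ fieldOrder φ 𝔘 ↔ 0 ≤ m := by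
  constructor
  · intro hm
    by_contra! hneg
    obtain ⟨k, hk⟩ := Int.exists_add_of_le (show m + 1 ≤ 0 by omega)
    have h1 : ((t ^ m : Eˣ) : E) * (t : E) ^ k ∈ fieldOrder φ 𝔘 :=
      mul_mem hm (pow_mem h.mem_fieldOrder k)
    have h2 : ((t ^ m : Eˣ) : E) * (t : E) ^ k = ((t⁻¹ : Eˣ) : E) := by
      rw [← Units.val_pow_eq_pow_val, ← Units.val_mul, ← zpow_natCast, ← zpow_add, ← zpow_neg_one]
      congr 2
      omega
    exact h.inv_notMem (h2 ▸ h1)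
  · intro hm
    lift m to ℕ using hm
    rw [zpow_natCast, Units.val_pow_eq_pow_val]
    exact pow_mem h.mem_fieldOrder m

theorem exists_eq_zpow_mul (x : Eˣ) :
    ∃ m : ℤ, ∃ u ∈ (fieldOrder φ 𝔘).toSubmonoid.units, x = t ^ m * u := by
  obtain ⟨m, hm⟩ := h.exists_zpow x
  exact ⟨-m, x * t ^ m, hm, by rw [mul_comm x, zpow_neg, inv_mul_cancel_left]⟩

theorem zpow_mul_mem_iff {m : ℤ} {u : Eˣ} (hu : u ∈ (fieldOrder φ 𝔘).toSubmonoid.units) :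
    ((t ^ m * u : Eˣ) : E) ∈ fieldOrder φ 𝔘 ↔ 0 ≤ m := by
  rw [← h.zpow_mem_iff, Units.val_mul]
  refine ⟨fun h' => ?_, fun h' => mul_mem h' hu.1⟩
  have := mul_mem h' hu.2
  rwa [Units.coeHom_apply, Units.mul_inv_cancel_right] at this

/-- Write x = t^m u with u a unit. Membership in the order means m ≥ 0, and not being divisible by t
means m ≤ 0. -/
theorem exists_unit_eq {x : E} (hx : x ∈ fieldOrder φ 𝔘)
    (hx' : x ∉ latticePow (fieldOrder φ 𝔘) t 1) :
    ∃ g ∈ (fieldOrder φ 𝔘).toSubmonoid.units, (g : E) = x := by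
  have hx0 : x ≠ 0 := by
    rintro rfl
    exact hx' (zero_mem _)
  obtain ⟨m, u, hu, hxu⟩ := h.exists_eq_zpow_mul (Units.mk0 x hx0)
  have hxe : x = ((t ^ m * u : Eˣ) : E) := by rw [← hxu, Units.val_mk0]
  have hm : 0 ≤ m := (h.zpow_mul_mem_iff hu).1 (hxe ▸ hx)
  have hm' : ¬ 0 ≤ m - 1 := by
    rw [← h.zpow_mul_mem_iff hu]
    intro h'
    refine hx' ?_
    rw [mem_latticePow, hxe, pow_one, ← Units.val_mul, ← mul_assoc]
    rwa [zpow_sub_one, mul_comm _ t⁻¹] at h'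
  obtain rfl : m = 0 := by omega
  exact ⟨u, hu, by rw [hxe, zpow_zero, one_mul]⟩

/-- The order of E is local with uniformizer t. With residue field of order q_E this is the usual
count (q_E - 1) q_E^i of units modulo level i + 1. -/
theorem relIndex_units (i : ℕ) :
    ((unitFiltration 𝔘 (i + 1)).comap (unitsMap φ)).relIndex
        (fieldOrder φ 𝔘).toSubmonoid.units =
      (latticePow (fieldOrder φ 𝔘) t 1).relIndex (fieldOrder φ 𝔘).toAddSubgroup ^ i *
        ((latticePow (fieldOrder φ 𝔘) t 1).relIndex (fieldOrder φ 𝔘).toAddSubgroup - 1) := by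
  have hconj : ∀ x ∈ fieldOrder φ 𝔘, ((t⁻¹ : Eˣ) : E) * x * t ∈ fieldOrder φ 𝔘 := by
    intro x hx
    rwa [mul_comm, Units.mul_inv_cancel_left]
  rw [← latticePow_zero _ t, ← relIndex_units_of_isLocal (A := fieldOrder φ 𝔘)
    (N := fun i => (unitFiltration 𝔘 i).comap (unitsMap φ)) h.one_notMem_latticePow hconj
    (fun x hx => h.exists_unit_eq hx) h.mem_comap_unitFiltration_iff,
    ← relIndex_unit_filtration (A := fieldOrder φ 𝔘)
      (N := fun i => (unitFiltration 𝔘 i).comap (unitsMap φ)) h.mem_fieldOrder hconj ?_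
      h.mem_comap_unitFiltration_iff, Subgroup.relIndex_mul_relIndex]
  · exact Subgroup.comap_mono (h.isOrderUniformizer.unitFiltration_antitone (by omega))
  · exact fun x hx => ((h.mem_comap_unitFiltration_iff 1 x).1 hx).1
  · intro x hx
    refine h.exists_unit_eq (add_mem (one_mem _) ?_) fun h1 => h.one_notMem_latticePow ?_
    · rw [← mem_latticePow_zero (τ := t)]
      exact latticePow_le h.mem_fieldOrder zero_le_one hx
    · have := sub_mem h1 hx
      rwa [add_sub_cancel_right] at this

/-- The multiplicative group of `E` normalizes the order. -/
theorem conj_mem (x : Eˣ) {y : Matrix (Fin 2) (Fin 2) F} (hy : y ∈ 𝔘) :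
    (unitsMap φ x).val * y * (unitsMap φ x)⁻¹.val ∈ 𝔘 := by
  let N : Subgroup (GL (Fin 2) F) :=
    { carrier := {g | ∀ y, g.val * y * g⁻¹.val ∈ 𝔘 ↔ y ∈ 𝔘}
      one_mem' := by simp
      mul_mem' := by
        intro a b ha hb y
        rw [← hb y, ← ha (b.val * y * b⁻¹.val), mul_inv_rev, Units.val_mul, Units.val_mul]
        simp only [mul_assoc]
      inv_mem' := by
        intro a ha y
        rw [← ha, inv_inv, mul_assoc, mul_assoc, mul_assoc, Units.mul_inv, mul_one,
          Units.mul_inv_cancel_left] }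
  have ht : unitsMap φ t ∈ N := by
    intro y
    refine ⟨fun hy => ?_, h.isOrderUniformizer.conj_inv_mem⟩
    have := h.isOrderUniformizer.conj_mem hy
    rwa [mul_assoc, mul_assoc, mul_assoc, Units.inv_mul, mul_one, Units.inv_mul_cancel_left] at this
  have hU : unitGroup 𝔘 ≤ N := by
    intro g hg y
    refine ⟨fun hy => ?_, fun hy => mul_mem (mul_mem hg.1 hy) hg.2⟩
    have := mul_mem (mul_mem hg.2 hy) hg.1
    rwa [mul_assoc, mul_assoc, mul_assoc, Units.inv_mul, mul_one, Units.inv_mul_cancel_left] at this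
  obtain ⟨m, u, hu, rfl⟩ := h.exists_eq_zpow_mul x
  have hx : unitsMap φ (t ^ m * u) ∈ N := by
    rw [map_mul, map_zpow]
    exact mul_mem (zpow_mem ht m) (hU hu)
  exact (hx y).2 hy

/-- Eˣ normalizes 𝔘 and commutes with the image of t, so it preserves every lattice t^i 𝔘. -/
theorem fieldUnits_le_normalizer (i : ℕ) : fieldUnits φ ≤
    Subgroup.normalizer (unitFiltration 𝔘 i : Set (GL (Fin 2) F)) := by
  have key : ∀ x : Eˣ, ∀ g ∈ unitFiltration 𝔘 i,
      unitsMap φ x * g * (unitsMap φ x)⁻¹ ∈ unitFiltration 𝔘 i := by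
    intro x g hg
    rw [h.isOrderUniformizer.mem_unitFiltration_iff] at hg ⊢
    refine ⟨⟨h.conj_mem x hg.1.1, ?_⟩, ?_⟩
    · have := h.conj_mem x hg.1.2
      have e : (unitsMap φ x * g * (unitsMap φ x)⁻¹)⁻¹ = unitsMap φ x * g⁻¹ * (unitsMap φ x)⁻¹ := by
        group
      show (unitsMap φ x * g * (unitsMap φ x)⁻¹)⁻¹.val ∈ 𝔘
      rw [e]
      exact this
    · rw [mem_latticePow]
      have h1 : (unitsMap φ x * g * (unitsMap φ x)⁻¹).val - 1 =
          (unitsMap φ x).val * (g.val - 1) * (unitsMap φ x)⁻¹.val := by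
        rw [mul_sub, sub_mul, mul_one, Units.mul_inv, Units.val_mul, Units.val_mul]
      have h2 : ((unitsMap φ t)⁻¹ ^ i).val * (unitsMap φ x).val =
          (unitsMap φ x).val * ((unitsMap φ t)⁻¹ ^ i).val := by
        rw [← Units.val_mul, ← Units.val_mul, ← map_inv, ← map_pow, ← map_mul, mul_comm, map_mul]
      rw [h1, ← mul_assoc, ← mul_assoc, h2, mul_assoc (unitsMap φ x).val]
      exact h.conj_mem x hg.2
  rintro _ ⟨x, rfl⟩
  refine Subgroup.mem_normalizer_iff.2 fun g => ⟨key x g, fun hg => ?_⟩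
  have := key x⁻¹ _ hg
  rwa [map_inv, inv_inv, mul_assoc, mul_assoc, mul_assoc, inv_mul_cancel, mul_one,
    inv_mul_cancel_left] at this

theorem mem_inducingGroup_iff {i : ℕ} {g : GL (Fin 2) F} : g ∈ inducingGroup φ 𝔘 i ↔
    ∃ x : Eˣ, ∃ u ∈ unitFiltration 𝔘 i, g = unitsMap φ x * u := by
  constructor
  · intro hg
    rw [inducingGroup, ← SetLike.mem_coe,
      Subgroup.coe_mul_of_left_le_normalizer_right _ _ (h.fieldUnits_le_normalizer i)] at hg
    obtain ⟨_, ⟨x, rfl⟩, u, hu, rfl⟩ := hg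
    exact ⟨x, u, hu, rfl⟩
  · rintro ⟨x, u, hu, rfl⟩
    exact mul_mem (Subgroup.mem_sup_left ⟨x, rfl⟩) (Subgroup.mem_sup_right hu)

/-- Within U = U_𝔘 the intersection J ∩ U is 𝔬_Eˣ U^(i+1). Hence [U : U^(i+1)] = [𝔬_Eˣ : 𝔬_Eˣ ∩
U^(i+1)]·[U : J ∩ U]. -/
theorem relIndex_inducingGroup (i : ℕ) :
    ((latticePow (fieldOrder φ 𝔘) t 1).relIndex (fieldOrder φ 𝔘).toAddSubgroup ^ i *
        ((latticePow (fieldOrder φ 𝔘) t 1).relIndex (fieldOrder φ 𝔘).toAddSubgroup - 1)) *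
      (inducingGroup φ 𝔘 (i + 1)).relIndex (unitGroup 𝔘) =
      (radical 𝔘).toAddSubgroup.relIndex 𝔘.toSubring.toAddSubgroup ^ i *
        (unitFiltration 𝔘 1).relIndex (unitGroup 𝔘) := by
  have hle : unitFiltration 𝔘 (i + 1) ≤ unitGroup 𝔘 := fun _ hg => hg.1
  rw [← h.isOrderUniformizer.relIndex_unitFiltration, ← h.relIndex_units, Subgroup.relIndex_comap,
    ← relIndex_eq_of_forall_exists (L := inducingGroup φ 𝔘 (i + 1) ⊓ unitGroup 𝔘),
    ← Subgroup.inf_relIndex_right (inducingGroup φ 𝔘 (i + 1)), Subgroup.relIndex_mul_relIndex]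
  · exact le_inf le_sup_right hle
  · exact inf_le_right
  · rintro _ ⟨x, hx, rfl⟩
    exact ⟨Subgroup.mem_sup_left ⟨x, rfl⟩, hx⟩
  · rintro l ⟨hl, hl'⟩
    obtain ⟨x, u, hu, rfl⟩ := h.mem_inducingGroup_iff.1 hl
    refine ⟨unitsMap φ x, ⟨x, ?_, rfl⟩, by rwa [inv_mul_cancel_left]⟩
    have : unitsMap φ x * u * u⁻¹ ∈ unitGroup 𝔘 := mul_mem hl' (inv_mem (hle hu))
    rwa [mul_inv_cancel_right] at this

end IsFieldUniformizer

end FieldUnits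


/-! ### Uniformizers in the two cases and the residue field of E -/

section Uniformizers

open ValuativeRel

variable {F : Type*} [Field F] [ValuativeRel F]

theorem isOrderUniformizer_orderM {ϖ : F} (hϖ : IsUniformizer ϖ) {τ : GL (Fin 2) F}
    (hτ : (τ⁻¹).val = ϖ⁻¹ • (1 : Matrix (Fin 2) (Fin 2) F)) :
    IsOrderUniformizer (orderM F) τ := by
  have key : ∀ x : Matrix (Fin 2) (Fin 2) F, x ∈ radical (orderM F) ↔ ϖ⁻¹ • x ∈ orderM F := by
    intro x
    rw [mem_radical_orderM_iff, mem_orderM_iff]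
    refine forall_congr' fun i => forall_congr' fun j => ?_
    rw [Matrix.smul_apply, smul_eq_mul, map_mul, map_inv₀, inv_mul_le_iff₀ hϖ.pos, mul_one]
    exact ⟨hϖ.2.2 _, fun h => h.trans_lt hϖ.2.1⟩
  constructor
  · intro x
    rw [hτ, smul_mul_assoc, one_mul, key]
  · intro x
    rw [hτ, mul_smul_comm, mul_one, key]

theorem mul_mem_radical {𝔘 : Subalgebra 𝒪[F] (Matrix (Fin 2) (Fin 2) F)}
    {x y : Matrix (Fin 2) (Fin 2) F} (hx : x ∈ 𝔘) (hy : y ∈ radical 𝔘) : x * y ∈ radical 𝔘 := by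
  rw [← toSubmodule_mul_radical]
  exact Submodule.mul_mem_mul hx hy

theorem mul_mem_radical_left {𝔘 : Subalgebra 𝒪[F] (Matrix (Fin 2) (Fin 2) F)}
    {x y : Matrix (Fin 2) (Fin 2) F} (hx : x ∈ radical 𝔘) (hy : y ∈ 𝔘) : x * y ∈ radical 𝔘 := by
  obtain ⟨a, ha, rfl⟩ := hx
  exact ⟨a * ⟨y, hy⟩, Ideal.IsTwoSided.mul_mem_of_left _ ha, rfl⟩

/-- By Cramer τ⁻¹ is adj(τ)/det τ, and for x ∈ 𝔓 the entries of adj(τ)x and x adj(τ) are divisible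
by ϖ, the lower left one with something to spare. Conversely τ𝔘 and 𝔘τ lie in the two-sided ideal 𝔓.
-/
theorem isOrderUniformizer_orderJ {ϖ : F} (hϖ : IsUniformizer ϖ) {τ : GL (Fin 2) F}
    (hτ : τ.val ∈ radical (orderJ F)) (hdet : valuation F τ.val.det = valuation F ϖ) :
    IsOrderUniformizer (orderJ F) τ := by
  obtain ⟨h00, h01, h10, h11⟩ := mem_radical_orderJ_iff.1 hτ
  replace h00 := hϖ.2.2 _ h00
  replace h10 := hϖ.2.2 _ h10
  replace h11 := hϖ.2.2 _ h11
  have hdiv : ∀ {a b c d : F}, valuation F a ≤ valuation F ϖ → valuation F b ≤ 1 →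
      valuation F c ≤ 1 → valuation F d ≤ valuation F ϖ →
      valuation F (τ.val.det⁻¹ * (a * b + c * d)) ≤ 1 := by
    intro a b c d ha hb hc hd
    rw [map_mul, map_inv₀, hdet, inv_mul_le_iff₀ hϖ.pos, mul_one]
    refine valuation_mul_add_mul_le ?_ ?_
    · exact (mul_le_mul' ha hb).trans_eq (mul_one _)
    · exact (mul_le_mul' hc hd).trans_eq (one_mul _)
  have hdiv' : ∀ {a b c d : F}, valuation F a ≤ valuation F ϖ → valuation F b < 1 →
      valuation F c ≤ valuation F ϖ → valuation F d < 1 →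
      valuation F (τ.val.det⁻¹ * (a * b + c * d)) < 1 := by
    intro a b c d ha hb hc hd
    rw [map_mul, map_inv₀, hdet, inv_mul_lt_iff₀ hϖ.pos, mul_one]
    refine Valuation.map_add_lt _ ?_ ?_
    · rw [map_mul]
      exact (mul_le_mul_left ha _).trans_lt
        (mul_lt_of_lt_one_right hϖ.pos hb)
    · rw [map_mul]
      exact (mul_le_mul_left hc _).trans_lt
        (mul_lt_of_lt_one_right hϖ.pos hd)
  have hneg : ∀ {a : F} {γ : ValueGroupWithZero F}, valuation F a ≤ γ → valuation F (-a) ≤ γ :=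
    fun h => (Valuation.map_neg _ _).trans_le h
  constructor
  · refine fun x => ⟨fun hx => ?_, fun hx => ?_⟩
    · obtain ⟨x00, x01, x10, x11⟩ := mem_radical_orderJ_iff.1 hx
      rw [val_inv_eq, smul_mul_assoc]
      refine mem_orderJ_iff.2 ⟨fun i j => ?_, ?_⟩
      · fin_cases i <;> fin_cases j <;> simp only [Fin.zero_eta, Fin.mk_one, Matrix.smul_apply,
          Matrix.mul_apply, Fin.sum_univ_two, smul_eq_mul, Matrix.of_apply, Matrix.cons_val_zero,
          Matrix.cons_val_one, Matrix.cons_val_fin_one, Matrix.cons_val']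
        · exact hdiv h11 x00.le (hneg h01) (hϖ.2.2 _ x10)
        · exact hdiv h11 x01 (hneg h01) (hϖ.2.2 _ x11)
        · exact (hdiv' (hneg h10) x00 h00 x10).le
        · exact hdiv (hneg h10) x01 (h00.trans hϖ.2.1.le) (hϖ.2.2 _ x11)
      · simp only [Matrix.smul_apply,
          Matrix.mul_apply, Fin.sum_univ_two, smul_eq_mul, Matrix.of_apply, Matrix.cons_val_zero,
          Matrix.cons_val_one, Matrix.cons_val_fin_one, Matrix.cons_val']
        exact hdiv' (hneg h10) x00 h00 x10
    · have := mul_mem_radical_left hτ hx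
      rwa [Units.mul_inv_cancel_left] at this
  · refine fun x => ⟨fun hx => ?_, fun hx => ?_⟩
    · obtain ⟨x00, x01, x10, x11⟩ := mem_radical_orderJ_iff.1 hx
      rw [val_inv_eq, mul_smul_comm]
      refine mem_orderJ_iff.2 ⟨fun i j => ?_, ?_⟩
      · fin_cases i <;> fin_cases j <;> simp only [Fin.zero_eta, Fin.mk_one, Matrix.smul_apply,
          Matrix.mul_apply, Fin.sum_univ_two, smul_eq_mul, Matrix.of_apply, Matrix.cons_val_zero,
          Matrix.cons_val_one, Matrix.cons_val_fin_one, Matrix.cons_val']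
        · exact hdiv (hϖ.2.2 _ x00) (h11.trans hϖ.2.1.le) x01 (hneg h10)
        · exact hdiv (hϖ.2.2 _ x00) (hneg h01) x01 h00
        · rw [mul_comm (x 1 0), mul_comm (x 1 1)]
          exact (hdiv' h11 x10 (hneg h10) x11).le
        · exact hdiv (hϖ.2.2 _ x10) (hneg h01) x11.le h00
      · simp only [Matrix.smul_apply,
          Matrix.mul_apply, Fin.sum_univ_two, smul_eq_mul, Matrix.of_apply, Matrix.cons_val_zero,
          Matrix.cons_val_one, Matrix.cons_val_fin_one, Matrix.cons_val']
        rw [mul_comm (x 1 0), mul_comm (x 1 1)]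
        exact hdiv' h11 x10 (hneg h10) x11
    · have := mul_mem_radical hx hτ
      rwa [Units.inv_mul_cancel_right] at this

theorem exists_valuation_eq_one_of_mem_unitGroup {g : GL (Fin 2) F}
    (hg : g ∈ unitGroup (orderM F)) (j : Fin 2) : ∃ i, valuation F (g.val i j) = 1 := by
  obtain ⟨hg, hdet⟩ := mem_unitGroup_orderM_iff.1 hg
  by_contra! hne
  have hlt : ∀ i, valuation F (g.val i j) < 1 := fun i => lt_of_le_of_ne (hg i j) (hne i)
  refine hdet.not_lt ?_
  rw [Matrix.det_fin_two]
  refine Valuation.map_sub_lt _ ?_ ?_ <;> rw [map_mul] <;> fin_cases j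
  · exact mul_lt_one_of_nonneg_of_lt_one_left zero_le (hlt 0) (hg _ _)
  · exact mul_lt_one_of_nonneg_of_lt_one_right (hg _ _) zero_le (hlt 1)
  · exact mul_lt_one_of_nonneg_of_lt_one_right (hg _ _) zero_le (hlt 1)
  · exact mul_lt_one_of_nonneg_of_lt_one_left zero_le (hlt 0) (hg _ _)

variable {E : Type*} [Field E] [Algebra F E] {φ : E →ₐ[F] Matrix (Fin 2) (Fin 2) F}

omit [ValuativeRel F] in
theorem unitsMap_algebraMap_val (a : Fˣ) :
    (unitsMap φ (Units.map (algebraMap F E : F →* E) a)).val =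
      (a : F) • (1 : Matrix (Fin 2) (Fin 2) F) := by
  rw [← Algebra.algebraMap_eq_smul_one]
  exact φ.commutes _

-- A nonzero x has an invertible image, so x ↦ (column j of φ x) is injective from E to F², and
-- bijective because both have dimension 2.
omit [ValuativeRel F] in
theorem exists_column_eq (hE : Module.finrank F E = 2) (φ : E →ₐ[F] Matrix (Fin 2) (Fin 2) F)
    (j : Fin 2) (w : Fin 2 → F) : ∃ x : E, ∀ i, φ x i j = w i := by
  have : FiniteDimensional F E := Module.finite_of_finrank_eq_succ hE
  let ev : E →ₗ[F] (Fin 2 → F) :=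
    { toFun := fun x i => φ x i j
      map_add' := fun x y => by ext; simp
      map_smul' := fun a x => by ext; simp }
  have hinj : Function.Injective ev := by
    rw [injective_iff_map_eq_zero]
    intro x hx
    by_contra h0
    refine det_ne_zero (unitsMap φ (Units.mk0 x h0)) (Matrix.det_eq_zero_of_column_eq_zero j ?_)
    exact fun i => congrFun hx i
  obtain ⟨x, hx⟩ := (LinearMap.injective_iff_surjective_of_finrank_eq_finrank
    (by rw [hE, Module.finrank_fin_fun])).1 hinj w
  exact ⟨x, congrFun hx⟩

variable [TopologicalSpace F] [IsNonarchimedeanLocalField F]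

theorem isFieldUniformizer_orderM
    (hφ : fieldUnits φ ≤ Subgroup.normalizer (unitGroup (orderM F) : Set (GL (Fin 2) F)))
    {ϖ : F} (hϖ : IsUniformizer ϖ) :
    IsFieldUniformizer φ (orderM F) (Units.map (algebraMap F E : F →* E) (Units.mk0 ϖ hϖ.1)) := by
  refine ⟨isOrderUniformizer_orderM hϖ ?_, fun x => ?_, fun h1 => ?_⟩
  · rw [← map_inv, ← map_inv, unitsMap_algebraMap_val]
    rw [Units.val_inv_eq_inv_val, Units.val_mk0]
  · obtain ⟨m, u, hu, hxu⟩ := exists_smul_mem_unitGroup_of_mem_normalizer hϖ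
      (hφ ⟨x, rfl⟩ : unitsMap φ x ∈ _)
    refine ⟨-m, ?_⟩
    have e : unitsMap φ
        (x * Units.map (algebraMap F E : F →* E) (Units.mk0 ϖ hϖ.1) ^ (-m)) = u := by
      ext1
      rw [map_mul, Units.val_mul, ← map_zpow, unitsMap_algebraMap_val, hxu, mul_smul_comm, mul_one,
        smul_smul, Units.val_zpow_eq_zpow_val, Units.val_mk0, zpow_neg,
        inv_mul_cancel₀ (zpow_ne_zero m hϖ.1), one_smul]
    rw [e]
    exact hu
  · have := mem_radical_orderM_iff.1 h1 0 0
    rw [Matrix.one_apply_eq, map_one] at this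
    exact lt_irrefl _ this

theorem isFieldUniformizer_orderJ
    (hφ : fieldUnits φ ≤ Subgroup.normalizer (unitGroup (orderJ F) : Set (GL (Fin 2) F)))
    {ϖ : F} (hϖ : IsUniformizer ϖ) {t : Eˣ}
    (ht : valuation F (φ t).det = valuation F ϖ) : IsFieldUniformizer φ (orderJ F) t := by
  refine ⟨isOrderUniformizer_orderJ hϖ (mem_radical_of_mem_normalizer_orderJ hϖ (hφ ⟨t, rfl⟩) ht)
    ht, fun x => ?_, fun h1 => ?_⟩
  · obtain ⟨m, hm⟩ := hϖ.exists_zpow (det_ne_zero (unitsMap φ x))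
    refine ⟨-m, mem_unitGroup_of_mem_normalizer_orderJ (hφ ⟨_, rfl⟩) ?_⟩
    have e : ∀ y : Eˣ, (unitsMap φ y).val.det =
        ((Matrix.GeneralLinearGroup.det (unitsMap φ y) : Fˣ) : F) := fun _ => rfl
    have ht' : valuation F (unitsMap φ t).val.det = valuation F ϖ := ht
    rw [e] at hm ht' ⊢
    rw [map_mul, map_mul, Units.val_mul, map_mul, map_zpow, map_zpow, Units.val_zpow_eq_zpow_val,
      map_zpow₀, hm, ht', ← zpow_add₀ hϖ.pos.ne', add_neg_cancel, zpow_zero]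
  · have := (mem_radical_orderJ_iff.1 h1).1
    rw [Matrix.one_apply_eq, map_one] at this
    exact lt_irrefl _ this

/-- Matrices in GL₂(𝔬) have primitive columns, so φ x = ϖ^m u is integral as soon as its second
column is. That column identifies the order of E with 𝔬² and its multiples of ϖ with 𝔭². -/
theorem relIndex_fieldOrder_orderM (hE : Module.finrank F E = 2)
    (hφ : fieldUnits φ ≤ Subgroup.normalizer (unitGroup (orderM F) : Set (GL (Fin 2) F)))
    {ϖ : F} (hϖ : IsUniformizer ϖ) :
    (latticePow (fieldOrder φ (orderM F))
      (Units.map (algebraMap F E : F →* E) (Units.mk0 ϖ hϖ.1)) 1).relIndex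
      (fieldOrder φ (orderM F)).toAddSubgroup = Nat.card 𝓀[F] ^ 2 := by
  have h := isFieldUniformizer_orderM hφ hϖ
  let r : (fieldOrder φ (orderM F)).toAddSubgroup →+ (Fin 2 → 𝓀[F]) :=
    { toFun := fun x i => IsLocalRing.residue 𝒪[F] ⟨φ x.1 i 1, x.2 i 1⟩
      map_zero' := by
        ext i
        rw [Pi.zero_apply, residue_eq_zero_iff_valuation_lt]
        simp
      map_add' := fun x y => by
        ext i
        rw [Pi.add_apply, ← map_add]
        congr 2
        simp }
  have hr : Function.Surjective r := by
    intro y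
    choose s hs using IsLocalRing.residue_surjective (R := 𝒪[F])
    obtain ⟨x, hx⟩ := exists_column_eq hE φ 1 fun i => (s (y i) : F)
    have hxS : x ∈ fieldOrder φ (orderM F) := by
      by_cases hx0 : x = 0
      · rw [hx0]
        exact zero_mem _
      obtain ⟨m, u, hu, hxu⟩ := h.exists_eq_zpow_mul (Units.mk0 x hx0)
      have hxe : x = _ := congrArg Units.val hxu
      rw [hxe, h.zpow_mul_mem_iff hu]
      obtain ⟨i, hi⟩ := exists_valuation_eq_one_of_mem_unitGroup (mem_units_fieldOrder_iff.1 hu) 1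
      have h1 : φ x = ϖ ^ m • (unitsMap φ u).val := by
        rw [hxe, Units.val_mul, map_mul, ← map_zpow]
        have := unitsMap_algebraMap_val (φ := φ) (Units.mk0 ϖ hϖ.1 ^ m)
        rw [Units.val_zpow_eq_zpow_val, Units.val_mk0] at this
        refine (congrArg (· * φ u) this).trans ?_
        rw [smul_mul_assoc, one_mul]
        rfl
      have h2 : valuation F (φ x i 1) ≤ 1 := by
        rw [hx i]
        exact (s (y i)).2
      rwa [h1, Matrix.smul_apply, smul_eq_mul, map_mul, hi, mul_one, map_zpow₀,
        ← zpow_zero (valuation F ϖ), hϖ.zpow_le_zpow] at h2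
    refine ⟨⟨x, hxS⟩, ?_⟩
    ext i
    rw [← hs (y i)]
    exact congrArg _ (Subtype.ext (hx i))
  rw [addRelIndex_eq_card_of_surjective r hr fun x => ?_, Nat.card_fun, Nat.card_fin]
  have h0 := fun i => residue_eq_zero_iff_valuation_lt F ⟨φ x.1 i 1, x.2 i 1⟩
  have h1 : r x = 0 ↔ ∀ i, valuation F (φ x.1 i 1) < 1 := by
    rw [funext_iff]
    exact forall_congr' h0
  rw [h1]
  constructor
  · intro hx
    by_contra hx'
    obtain ⟨g, hg, hgx⟩ := h.exists_unit_eq x.2 hx'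
    obtain ⟨i, hi⟩ := exists_valuation_eq_one_of_mem_unitGroup (mem_units_fieldOrder_iff.1 hg) 1
    refine hi.not_lt ?_
    have := hx i
    rwa [← hgx] at this
  · intro hx i
    rw [mem_latticePow_fieldOrder_iff, h.isOrderUniformizer.latticePow_one] at hx
    exact mem_radical_orderM_iff.1 hx i 1

/-- The lower right entry modulo 𝔭 is the residue map, surjective already on 𝔬_F. It does not vanish
on units, because the lower left entry is in 𝔭 and the determinant is a unit. -/
theorem relIndex_fieldOrder_orderJ {t : Eˣ} (h : IsFieldUniformizer φ (orderJ F) t) :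
    (latticePow (fieldOrder φ (orderJ F)) t 1).relIndex (fieldOrder φ (orderJ F)).toAddSubgroup =
      Nat.card 𝓀[F] := by
  let r : (fieldOrder φ (orderJ F)).toAddSubgroup →+ 𝓀[F] :=
    { toFun := fun x => IsLocalRing.residue 𝒪[F] ⟨φ x.1 1 1, x.2.1 1 1⟩
      map_zero' := by
        rw [residue_eq_zero_iff_valuation_lt]
        simp
      map_add' := fun x y => by
        rw [← map_add]
        congr 2
        simp }
  have hr : Function.Surjective r := by
    intro y
    obtain ⟨a, rfl⟩ := IsLocalRing.residue_surjective y
    refine ⟨⟨algebraMap F E a, ?_⟩, ?_⟩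
    · rw [Subring.mem_toAddSubgroup, mem_fieldOrder_iff, AlgHom.commutes]
      exact (orderJ F).algebraMap_mem a
    · refine congrArg (IsLocalRing.residue 𝒪[F]) (Subtype.ext ?_)
      dsimp only
      rw [AlgHom.commutes, Matrix.algebraMap_matrix_apply, if_pos rfl]
      rfl
  refine addRelIndex_eq_card_of_surjective r hr fun x => ?_
  have h1 : r x = 0 ↔ valuation F (φ x.1 1 1) < 1 :=
    residue_eq_zero_iff_valuation_lt F ⟨φ x.1 1 1, x.2.1 1 1⟩
  rw [h1]
  constructor
  · intro hx
    by_contra hx'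
    obtain ⟨g, hg, hgx⟩ := h.exists_unit_eq x.2 hx'
    obtain ⟨hg1, hdet⟩ := mem_unitGroup_orderJ_iff.1 (mem_units_fieldOrder_iff.1 hg)
    rw [← hgx] at hx
    refine hdet.not_lt ?_
    rw [Matrix.det_fin_two]
    refine Valuation.map_sub_lt _ ?_ ?_ <;> rw [map_mul]
    · exact mul_lt_one_of_nonneg_of_lt_one_right (hg1.1 _ _) zero_le hx
    · exact mul_lt_one_of_nonneg_of_lt_one_right (hg1.1 _ _) zero_le hg1.2
  · intro hx
    rw [mem_latticePow_fieldOrder_iff, h.isOrderUniformizer.latticePow_one] at hx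
    exact (mem_radical_orderJ_iff.1 hx).2.2.2

end Uniformizers


/-! ### A ramified E contains an element whose norm is a uniformizer -/

section Ramified

open ValuativeRel

variable {F : Type*} [Field F] [ValuativeRel F] {E : Type*} [Field E] [Algebra F E]
  {φ : E →ₐ[F] Matrix (Fin 2) (Fin 2) F}

theorem isIntegral_of_mem_orderM {x : E} (hx : φ x ∈ orderM F) : IsIntegral 𝒪[F] x := by
  let y : Matrix (Fin 2) (Fin 2) 𝒪[F] := Matrix.of fun i j => ⟨φ x i j, hx i j⟩
  have h1 := (Matrix.isIntegral y).map (Algebra.ofId 𝒪[F] F).mapMatrix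
  have h2 : (Algebra.ofId 𝒪[F] F).mapMatrix y = φ.restrictScalars 𝒪[F] x := rfl
  rw [h2] at h1
  exact (isIntegral_algHom_iff (φ.restrictScalars 𝒪[F]) φ.toRingHom.injective).1 h1

theorem not_isIntegral_inv {ϖ : F} (hϖ : IsUniformizer ϖ) :
    ¬ IsIntegral 𝒪[F] (algebraMap F E ϖ⁻¹) := by
  intro h
  have h1 : IsIntegral 𝒪[F] ϖ⁻¹ := (isIntegral_algHom_iff
    ((Algebra.ofId F E).restrictScalars 𝒪[F]) (algebraMap F E).injective).1 h
  obtain ⟨y, hy⟩ := IsIntegrallyClosed.isIntegral_iff.1 h1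
  have h2 : valuation F (y : F) ≤ 1 := y.2
  have h3 : (y : F) = ϖ⁻¹ := hy
  rw [h3, map_inv₀, inv_le_one₀ hϖ.pos] at h2
  exact absurd hϖ.2.1 (not_lt.2 h2)

variable [TopologicalSpace F] [IsNonarchimedeanLocalField F]

/-- As ϖ⁻¹ is not integral, an integral x = ϖ^m u has m ≥ 0: it is a unit for m = 0 and a multiple
of ϖ otherwise. So ϖ generates a maximal ideal. -/
theorem isUnramifiedExt_of_forall_exists {ϖ : F} (hϖ : IsUniformizer ϖ)
    (h : ∀ x : E, x ≠ 0 → ∃ m : ℤ, ∃ u : E, u ≠ 0 ∧ IsIntegral 𝒪[F] u ∧ IsIntegral 𝒪[F] u⁻¹ ∧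
      x = algebraMap F E (ϖ ^ m) * u) : IsUnramifiedExt F E := by
  have hϖ0 : algebraMap F E ϖ ≠ 0 := (map_ne_zero _).2 hϖ.1
  have hϖint : IsIntegral 𝒪[F] (algebraMap F E ϖ) :=
    isIntegral_algebraMap (R := 𝒪[F]) (A := E) (x := ⟨ϖ, hϖ.2.1.le⟩)
  let p : 𝒪[F] := ⟨ϖ, hϖ.2.1.le⟩
  have hp : p ∈ 𝓂[F] := (IsLocalRing.residue_eq_zero_iff _).1
    ((residue_eq_zero_iff_valuation_lt F p).2 hϖ.2.1)
  refine Ideal.isMaximal_iff.2 ⟨fun h1 => ?_, fun J x hJ hx hxJ => ?_⟩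
  · have hle : Ideal.map (algebraMap 𝒪[F] (integralClosure 𝒪[F] E)) 𝓂[F] ≤
        Ideal.span {algebraMap 𝒪[F] (integralClosure 𝒪[F] E) p} := by
      rw [Ideal.map_le_iff_le_comap]
      intro a ha
      have hva := hϖ.2.2 _ ((residue_eq_zero_iff_valuation_lt F a).1
        ((IsLocalRing.residue_eq_zero_iff _).2 ha))
      have hb : valuation F (ϖ⁻¹ * a) ≤ 1 := by
        rwa [map_mul, map_inv₀, inv_mul_le_iff₀ hϖ.pos, mul_one]
      have he : a = p * ⟨ϖ⁻¹ * a, hb⟩ := Subtype.ext (mul_inv_cancel_left₀ hϖ.1 _).symm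
      rw [Ideal.mem_comap, Ideal.mem_span_singleton, he, map_mul]
      exact dvd_mul_right _ _
    obtain ⟨y, hy⟩ := Ideal.mem_span_singleton.1 (hle h1)
    have hy' : 1 = algebraMap F E ϖ * (y : E) := congrArg Subtype.val hy
    refine not_isIntegral_inv (E := E) hϖ ?_
    rw [map_inv₀, inv_eq_of_mul_eq_one_right hy'.symm]
    exact y.2
  · have hx0 : (x : E) ≠ 0 := by
      intro h0
      refine hx ?_
      rw [show x = 0 from Subtype.ext h0]
      exact zero_mem _
    obtain ⟨m, u, hu0, hu, hu', hxu⟩ := h x hx0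
    have hm : 0 ≤ m := by
      by_contra! hm
      obtain ⟨k, hk⟩ := Int.exists_add_of_le (show m + 1 ≤ 0 by omega)
      refine not_isIntegral_inv (E := E) hϖ ?_
      have h2 := (x.2.mul hu').mul (hϖint.pow k)
      have hmk : -1 = m + k := by omega
      rw [hxu, mul_inv_cancel_right₀ hu0, ← map_pow, ← map_mul, ← zpow_natCast,
        ← zpow_add₀ hϖ.1, ← hmk, zpow_neg_one] at h2
      exact h2
    obtain rfl | hm1 := hm.eq_or_lt
    · rw [zpow_zero, map_one, one_mul] at hxu
      have h3 : (⟨u⁻¹, hu'⟩ : integralClosure 𝒪[F] E) * x = 1 := by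
        refine Subtype.ext ?_
        change u⁻¹ * (x : E) = 1
        rw [hxu, inv_mul_cancel₀ hu0]
      rw [← h3]
      exact J.mul_mem_left _ hxJ
    · obtain ⟨k, hk⟩ := Int.exists_add_of_le (show 1 ≤ m by omega)
      refine absurd ?_ hx
      have h4 : x = algebraMap 𝒪[F] (integralClosure 𝒪[F] E) p *
          ⟨algebraMap F E ϖ ^ k * u, (hϖint.pow k).mul hu⟩ := by
        refine Subtype.ext ?_
        change (x : E) = algebraMap F E ϖ * (algebraMap F E ϖ ^ k * u)
        rw [hxu, hk, zpow_add₀ hϖ.1, zpow_one, zpow_natCast, map_mul, map_pow, mul_assoc]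
      rw [h4]
      exact Ideal.mul_mem_right _ _ (Ideal.mem_map_of_mem _ hp)

/-- The image of `ϖ ∈ Fˣ` in `Eˣ`. -/
noncomputable abbrev IsUniformizer.toUnits (E : Type*) [Field E] [Algebra F E] {ϖ : F}
    (hϖ : IsUniformizer ϖ) : Eˣ :=
  Units.map (algebraMap F E : F →* E) (Units.mk0 ϖ hϖ.1)

omit [TopologicalSpace F] [IsNonarchimedeanLocalField F] in
theorem valuation_det_mul_zpow {ϖ : F} (hϖ : IsUniformizer ϖ) (x : Eˣ) (m : ℤ) :
    valuation F (unitsMap φ (x * hϖ.toUnits E ^ m)).val.det =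
      valuation F (unitsMap φ x).val.det * valuation F ϖ ^ (2 * m) := by
  rw [map_mul, Units.val_mul, Matrix.det_mul, ← map_zpow, unitsMap_algebraMap_val, Matrix.det_smul,
    Matrix.det_one, mul_one, map_mul, map_pow, Fintype.card_fin, Units.val_zpow_eq_zpow_val,
    Units.val_mk0, map_zpow₀, ← zpow_natCast, ← zpow_mul]
  congr 2
  push_cast
  ring

/-- Scaling by ϖ changes the exponent of v(det φ x) by 2. If 1 is not attained, no odd exponent is,
so every x is a power of ϖ times an element of unit determinant. The latter lies in U_𝓙 by the
normalizer condition, hence is an integral unit, and E/F would be unramified. -/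
theorem exists_valuation_det_eq (hE : ¬ IsUnramifiedExt F E)
    (hφ : fieldUnits φ ≤ Subgroup.normalizer (unitGroup (orderJ F) : Set (GL (Fin 2) F)))
    {ϖ : F} (hϖ : IsUniformizer ϖ) : ∃ t : Eˣ, valuation F (φ t).det = valuation F ϖ := by
  by_contra! hne
  refine hE (isUnramifiedExt_of_forall_exists hϖ fun x hx => ?_)
  obtain ⟨n, hn⟩ := hϖ.exists_zpow (det_ne_zero (unitsMap φ (Units.mk0 x hx)))
  obtain ⟨m, rfl | rfl⟩ := Int.even_or_odd' n
  · have hu := mem_unitGroup_of_mem_normalizer_orderJ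
      (hφ ⟨Units.mk0 x hx * hϖ.toUnits E ^ (-m), rfl⟩)
      ((valuation_det_mul_zpow hϖ _ _).trans (by
        rw [hn, ← zpow_add₀ hϖ.pos.ne', ← zpow_zero (valuation F ϖ)]; congr 1; ring))
    refine ⟨m, _, Units.ne_zero (Units.mk0 x hx * hϖ.toUnits E ^ (-m)),
      isIntegral_of_mem_orderM (φ := φ) (orderJ_le_orderM hu.1), ?_, ?_⟩
    · rw [← Units.val_inv_eq_inv_val]
      refine isIntegral_of_mem_orderM (φ := φ) (orderJ_le_orderM ?_)
      have := hu.2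
      rw [← map_inv] at this
      exact this
    · have : algebraMap F E (ϖ ^ m) = (hϖ.toUnits E ^ m : Eˣ) := by
        rw [← map_zpow, Units.coe_map, Units.val_zpow_eq_zpow_val]
        rfl
      rw [this, ← Units.val_mul, mul_comm, zpow_neg, inv_mul_cancel_right, Units.val_mk0]
  · refine (hne (Units.mk0 x hx * hϖ.toUnits E ^ (-m))
      ((valuation_det_mul_zpow hϖ _ _).trans ?_)).elim
    rw [hn, ← zpow_add₀ hϖ.pos.ne']
    conv_rhs => rw [← zpow_one (valuation F ϖ)]
    congr 1
    ring

end Ramified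

/-! ### Openness of the groups -/

section Openness

open ValuativeRel

variable {F : Type*} [Field F] [ValuativeRel F] [TopologicalSpace F] [IsNonarchimedeanLocalField F]

variable (F) in
theorem isOpen_orderM : IsOpen (orderM F : Set (Matrix (Fin 2) (Fin 2) F)) := by
  have : (orderM F : Set (Matrix (Fin 2) (Fin 2) F)) = ⋂ i, ⋂ j, (fun x => x i j) ⁻¹' 𝒪[F] := by
    ext x
    simp only [Set.mem_iInter]
    rfl
  rw [this]
  exact isOpen_iInter_of_finite fun i => isOpen_iInter_of_finite fun j =>
    Valuation.isOpen_integer.preimage (continuous_id.matrix_elem i j)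

variable (F) in
theorem isOpen_orderJ : IsOpen (orderJ F : Set (Matrix (Fin 2) (Fin 2) F)) := by
  obtain ⟨ϖ, hϖ⟩ := exists_isUniformizer (F := F)
  have : (orderJ F : Set (Matrix (Fin 2) (Fin 2) F)) =
      (orderM F : Set (Matrix (Fin 2) (Fin 2) F)) ∩ (fun x => ϖ⁻¹ * x 1 0) ⁻¹' 𝒪[F] := by
    ext x
    refine and_congr Iff.rfl ?_
    rw [Set.mem_preimage, SetLike.mem_coe, Valuation.mem_integer_iff, map_mul, map_inv₀,
      inv_mul_le_iff₀ hϖ.pos, mul_one]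
    exact ⟨hϖ.2.2 _, fun h => h.trans_lt hϖ.2.1⟩
  rw [this]
  exact (isOpen_orderM F).inter (Valuation.isOpen_integer.preimage
    (continuous_const.mul (continuous_id.matrix_elem 1 0)))

variable {𝔘 : Subalgebra 𝒪[F] (Matrix (Fin 2) (Fin 2) F)}

theorem isOpen_unitGroup (h𝔘 : IsOpen (𝔘 : Set (Matrix (Fin 2) (Fin 2) F))) :
    IsOpen (unitGroup 𝔘 : Set (GL (Fin 2) F)) :=
  (h𝔘.preimage Units.continuous_val).inter
    (h𝔘.preimage (Units.continuous_val.comp continuous_inv))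

theorem IsOrderUniformizer.isOpen_unitFiltration {τ : GL (Fin 2) F}
    (h : IsOrderUniformizer 𝔘 τ) (h𝔘 : IsOpen (𝔘 : Set (Matrix (Fin 2) (Fin 2) F))) (i : ℕ) :
    IsOpen (unitFiltration 𝔘 i : Set (GL (Fin 2) F)) := by
  have : (unitFiltration 𝔘 i : Set (GL (Fin 2) F)) =
      (unitGroup 𝔘 : Set (GL (Fin 2) F)) ∩
      (fun g : GL (Fin 2) F => ((τ⁻¹ ^ i : GL (Fin 2) F)).val * (g.val - 1)) ⁻¹' 𝔘 := by
    ext g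
    exact h.mem_unitFiltration_iff i g
  rw [this]
  exact (isOpen_unitGroup h𝔘).inter (h𝔘.preimage
    (continuous_const.mul (Units.continuous_val.sub continuous_const)))

end Openness


/-! ### The volume of J/Z -/

section Volume

/-- With bars for images in G/Z, both sides equal [J̄ : J̄ ∩ T̄]·[T̄ : J̄ ∩ T̄]·μ(J̄ ∩ T̄).
Finiteness of the first index is assumed because the volume of J is not known to be finite
beforehand. -/
theorem volModCenter_mul_relIndex {G : Type*} [Group G] [TopologicalSpace G]
    [IsTopologicalGroup G] [MeasurableSpace (G ⧸ Subgroup.center G)]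
    [BorelSpace (G ⧸ Subgroup.center G)] (μ : MeasureTheory.Measure (G ⧸ Subgroup.center G))
    [μ.IsHaarMeasure] {J T : Subgroup G} (hZJ : Subgroup.center G ≤ J)
    (hJ : IsOpen (J : Set G)) (hT : IsOpen (T : Set G)) (hfin : volModCenter μ T ≠ ⊤)
    (hd : ((T.map (QuotientGroup.mk' (Subgroup.center G))).comap
      (QuotientGroup.mk' (Subgroup.center G))).relIndex J ≠ 0) :
    volModCenter μ J * J.relIndex T =
      ((T.map (QuotientGroup.mk' (Subgroup.center G))).comap
        (QuotientGroup.mk' (Subgroup.center G))).relIndex J * volModCenter μ T := by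
  have hJT : (J.map (QuotientGroup.mk' (Subgroup.center G))).relIndex
      (T.map (QuotientGroup.mk' (Subgroup.center G))) = J.relIndex T := by
    rw [← Subgroup.relIndex_comap, Subgroup.comap_map_eq_self]
    rwa [QuotientGroup.ker_mk']
  rw [Subgroup.relIndex_comap] at hd ⊢
  have hopen := (isOpen_map_mk hJ).inter (isOpen_map_mk hT)
  have h1 := (relIndex_ne_zero_and_measure_eq μ (inf_le_left (a := J.map _) (b := T.map _)) hopen
    (Or.inr (by rwa [Subgroup.inf_relIndex_left]))).2
  have h2 := (relIndex_ne_zero_and_measure_eq μ (inf_le_right (a := J.map _) (b := T.map _)) hopen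
    (Or.inl hfin)).2
  rw [Subgroup.inf_relIndex_left] at h1
  rw [Subgroup.inf_relIndex_right, hJT] at h2
  rw [volModCenter_eq, volModCenter_eq, h1, h2]
  ring

theorem eq_ofReal_of_mul_eq {V : ENNReal} {c d : ℕ} {r v : ℝ} (hc : c ≠ 0)
    (h : V * c = d * ENNReal.ofReal r) (hv : v * c = d * r) : V = ENNReal.ofReal v := by
  have hc' : (c : ENNReal) ≠ 0 := Nat.cast_ne_zero.2 hc
  refine (ENNReal.mul_left_inj hc' (ENNReal.natCast_ne_top c)).1 ?_
  rw [h, ← ENNReal.ofReal_natCast c, ← ENNReal.ofReal_mul' (Nat.cast_nonneg c), hv,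
    ENNReal.ofReal_mul (Nat.cast_nonneg d), ENNReal.ofReal_natCast]

open ValuativeRel

variable {F : Type*} [Field F] [ValuativeRel F] {E : Type*} [Field E] [Algebra F E]
  {φ : E →ₐ[F] Matrix (Fin 2) (Fin 2) F}

omit [ValuativeRel F] in
theorem exists_val_eq_smul_one {g : GL (Fin 2) F} (hg : g ∈ Subgroup.center (GL (Fin 2) F)) :
    ∃ a : Fˣ, g.val = (a : F) • (1 : Matrix (Fin 2) (Fin 2) F) := by
  rw [Matrix.GeneralLinearGroup.mem_center_iff_val_mem_range_scalar] at hg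
  obtain ⟨a, ha⟩ := hg
  rw [Matrix.scalar_apply, ← Matrix.smul_one_eq_diagonal] at ha
  have ha0 : a ≠ 0 := by
    rintro rfl
    refine det_ne_zero g ?_
    rw [← ha]
    simp
  exact ⟨Units.mk0 a ha0, ha.symm⟩

omit [ValuativeRel F] in
theorem unitsMap_algebraMap_mem_center (a : Fˣ) :
    unitsMap φ (Units.map (algebraMap F E : F →* E) a) ∈ Subgroup.center (GL (Fin 2) F) := by
  refine Subgroup.mem_center_iff.2 fun g => Units.ext ?_
  rw [Units.val_mul, Units.val_mul, unitsMap_algebraMap_val, smul_mul_assoc, mul_smul_comm, one_mul,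
    mul_one]

variable (φ) in
theorem center_le_inducingGroup (𝔘 : Subalgebra 𝒪[F] (Matrix (Fin 2) (Fin 2) F)) (i : ℕ) :
    Subgroup.center (GL (Fin 2) F) ≤ inducingGroup φ 𝔘 i := by
  intro g hg
  obtain ⟨a, ha⟩ := exists_val_eq_smul_one hg
  refine Subgroup.mem_sup_left ⟨Units.map (algebraMap F E : F →* E) a, Units.ext ?_⟩
  rw [ha]
  exact unitsMap_algebraMap_val a

variable [TopologicalSpace F] [IsNonarchimedeanLocalField F]

theorem isOpen_inducingGroup {𝔘 : Subalgebra 𝒪[F] (Matrix (Fin 2) (Fin 2) F)} {t : Eˣ}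
    (h : IsFieldUniformizer φ 𝔘 t) (h𝔘 : IsOpen (𝔘 : Set (Matrix (Fin 2) (Fin 2) F))) (i : ℕ) :
    IsOpen (inducingGroup φ 𝔘 i : Set (GL (Fin 2) F)) :=
  Subgroup.isOpen_mono le_sup_right (h.isOrderUniformizer.isOpen_unitFiltration h𝔘 i)

theorem mem_comap_map_of_mul_mem {G : Type*} [Group G] {T : Subgroup G} {z g : G}
    (hz : z ∈ Subgroup.center G) (hg : g ∈ T) :
    z * g ∈ (T.map (QuotientGroup.mk' (Subgroup.center G))).comap
      (QuotientGroup.mk' (Subgroup.center G)) := by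
  refine ⟨g, hg, ?_⟩
  rw [map_mul, QuotientGroup.mk'_apply, QuotientGroup.mk'_apply, (QuotientGroup.eq_one_iff z).2 hz,
    one_mul]

/-- Here Eˣ is generated by the central element ϖ and the units of its order, so J lies in ZK. -/
theorem relIndex_comap_map_orderM
    (hφ : fieldUnits φ ≤ Subgroup.normalizer (unitGroup (orderM F) : Set (GL (Fin 2) F)))
    (i : ℕ) :
    (((unitGroup (orderM F)).map (QuotientGroup.mk' (Subgroup.center (GL (Fin 2) F)))).comap
      (QuotientGroup.mk' (Subgroup.center (GL (Fin 2) F)))).relIndex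
        (inducingGroup φ (orderM F) i) = 1 := by
  obtain ⟨ϖ, hϖ⟩ := exists_isUniformizer (F := F)
  have h := isFieldUniformizer_orderM hφ hϖ
  rw [Subgroup.relIndex_eq_one]
  intro g hg
  obtain ⟨x, u, hu, rfl⟩ := h.mem_inducingGroup_iff.1 hg
  obtain ⟨m, y, hy, rfl⟩ := h.exists_eq_zpow_mul x
  rw [map_mul, mul_assoc, ← map_zpow]
  exact mem_comap_map_of_mul_mem (unitsMap_algebraMap_mem_center _)
    (mul_mem (mem_units_fieldOrder_iff.1 hy) hu.1)

/-- The quotient of q^(4i)(q² - 1)(q² - q) by q^(2i)(q² - 1). -/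
theorem relIndex_inducingGroup_orderM (hE : Module.finrank F E = 2)
    (hφ : fieldUnits φ ≤ Subgroup.normalizer (unitGroup (orderM F) : Set (GL (Fin 2) F)))
    (i : ℕ) :
    (inducingGroup φ (orderM F) (i + 1)).relIndex (unitGroup (orderM F)) =
      Nat.card 𝓀[F] ^ (2 * i + 1) * (Nat.card 𝓀[F] - 1) := by
  obtain ⟨ϖ, hϖ⟩ := exists_isUniformizer (F := F)
  have h := (isFieldUniformizer_orderM hφ hϖ).relIndex_inducingGroup i
  rw [relIndex_fieldOrder_orderM hE hφ hϖ, relIndex_radical_orderM,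
    relIndex_unitFiltration_orderM] at h
  have hq := two_le_card_residueField F
  have hq0 : 0 < Nat.card 𝓀[F] := by omega
  have h1 : 0 < Nat.card 𝓀[F] ^ 2 - 1 := by
    have : 2 ^ 2 ≤ Nat.card 𝓀[F] ^ 2 := Nat.pow_le_pow_left hq 2
    omega
  have h2 : Nat.card 𝓀[F] ^ 2 - Nat.card 𝓀[F] = Nat.card 𝓀[F] * (Nat.card 𝓀[F] - 1) := by
    rw [Nat.mul_sub, mul_one, sq]
  refine Nat.eq_of_mul_eq_mul_left (n := (Nat.card 𝓀[F] ^ 2) ^ i * (Nat.card 𝓀[F] ^ 2 - 1))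
    (by positivity) (h.trans ?_)
  rw [h2]
  ring

section Ramified

variable {t : Eˣ} {ϖ : F}

omit [TopologicalSpace F] [IsNonarchimedeanLocalField F] in
theorem inducingGroup_le_normalizer {𝔘 : Subalgebra 𝒪[F] (Matrix (Fin 2) (Fin 2) F)}
    (hφ : fieldUnits φ ≤ Subgroup.normalizer (unitGroup 𝔘 : Set (GL (Fin 2) F))) (i : ℕ) :
    inducingGroup φ 𝔘 i ≤ Subgroup.normalizer (unitGroup 𝔘 : Set (GL (Fin 2) F)) :=
  sup_le hφ fun _ hg => Subgroup.le_normalizer hg.1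

/-- J normalizes U_𝓙, and elements of the normalizer with unit determinant lie in U_𝓙, so J ∩ K = J
∩ U_𝓙. Its index in U_𝓙 is q^(2i)(q - 1)² / (q^i (q - 1)), and U_𝓙 has index q + 1 in K. -/
theorem relIndex_inducingGroup_orderJ
    (hφ : fieldUnits φ ≤ Subgroup.normalizer (unitGroup (orderJ F) : Set (GL (Fin 2) F)))
    (h : IsFieldUniformizer φ (orderJ F) t) (i : ℕ) :
    (inducingGroup φ (orderJ F) (i + 1)).relIndex (unitGroup (orderM F)) =
      Nat.card 𝓀[F] ^ i * (Nat.card 𝓀[F] - 1) * (Nat.card 𝓀[F] + 1) := by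
  have h1 := h.relIndex_inducingGroup i
  rw [relIndex_fieldOrder_orderJ h, relIndex_radical_orderJ, relIndex_unitFiltration_orderJ] at h1
  have hq := two_le_card_residueField F
  have hq0 : 0 < Nat.card 𝓀[F] := by omega
  have hq1 : 0 < Nat.card 𝓀[F] - 1 := by omega
  have h2 : inducingGroup φ (orderJ F) (i + 1) ⊓ unitGroup (orderM F) =
      inducingGroup φ (orderJ F) (i + 1) ⊓ unitGroup (orderJ F) := by
    refine le_antisymm (fun g hg => ⟨hg.1, ?_⟩) (inf_le_inf_left _ unitGroup_orderJ_le)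
    exact mem_unitGroup_of_mem_normalizer_orderJ (inducingGroup_le_normalizer hφ _ hg.1)
      (mem_unitGroup_orderM_iff.1 hg.2).2
  rw [← Subgroup.inf_relIndex_right, h2, ← Subgroup.relIndex_mul_relIndex _ (unitGroup (orderJ F))
    _ inf_le_right unitGroup_orderJ_le, Subgroup.inf_relIndex_right, relIndex_unitGroup_orderJ]
  congr 1
  refine Nat.eq_of_mul_eq_mul_left (n := Nat.card 𝓀[F] ^ i * (Nat.card 𝓀[F] - 1))
    (by positivity) (h1.trans ?_)
  ring

theorem mem_comap_map_iff_even
    (hφ : fieldUnits φ ≤ Subgroup.normalizer (unitGroup (orderJ F) : Set (GL (Fin 2) F)))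
    (hϖ : IsUniformizer ϖ) {i : ℕ} (h : IsFieldUniformizer φ (orderJ F) t) {g : GL (Fin 2) F}
    (hg : g ∈ inducingGroup φ (orderJ F) i) {n : ℤ}
    (hn : valuation F g.val.det = valuation F ϖ ^ n) :
    g ∈ ((unitGroup (orderM F)).map (QuotientGroup.mk' (Subgroup.center (GL (Fin 2) F)))).comap
      (QuotientGroup.mk' (Subgroup.center (GL (Fin 2) F))) ↔ Even n := by
  constructor
  · rintro ⟨u, hu, hug⟩
    obtain ⟨a, ha⟩ := exists_val_eq_smul_one (QuotientGroup.eq.1 hug)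
    obtain ⟨k, hk⟩ := hϖ.exists_zpow a.ne_zero
    have h1 : g.val = u.val * ((a : F) • 1) := by
      rw [← ha, ← Units.val_mul, mul_inv_cancel_left]
    rw [h1, Matrix.det_mul, map_mul, (mem_unitGroup_orderM_iff.1 hu).2, one_mul, Matrix.det_smul,
      Matrix.det_one, mul_one, map_pow, Fintype.card_fin, hk, ← zpow_natCast, ← zpow_mul,
      hϖ.zpow_inj] at hn
    exact ⟨k, by rw [← hn]; push_cast; ring⟩
  · rintro ⟨k, rfl⟩
    obtain ⟨x, u, hu, rfl⟩ := h.mem_inducingGroup_iff.1 hg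
    have hu1 := unitGroup_orderJ_le hu.1
    rw [Units.val_mul, Matrix.det_mul, map_mul, (mem_unitGroup_orderM_iff.1 hu1).2, mul_one] at hn
    have hy := mem_unitGroup_of_mem_normalizer_orderJ (hφ ⟨x * hϖ.toUnits E ^ (-k), rfl⟩)
      ((valuation_det_mul_zpow hϖ _ _).trans (by
        rw [hn, ← zpow_add₀ hϖ.pos.ne', ← zpow_zero (valuation F ϖ)]; congr 1; ring))
    have e : unitsMap φ x * u = unitsMap φ (hϖ.toUnits E ^ k) *
        (unitsMap φ (x * hϖ.toUnits E ^ (-k)) * u) := by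
      rw [← mul_assoc, ← map_mul, mul_comm x, zpow_neg, mul_inv_cancel_left]
    rw [e, ← map_zpow]
    exact mem_comap_map_of_mul_mem (unitsMap_algebraMap_mem_center _)
      (mul_mem (unitGroup_orderJ_le hy) hu1)

/-- J ∩ ZK consists of the elements whose determinant has even exponent, and t changes the parity.
-/
theorem relIndex_comap_map_orderJ
    (hφ : fieldUnits φ ≤ Subgroup.normalizer (unitGroup (orderJ F) : Set (GL (Fin 2) F)))
    (hϖ : IsUniformizer ϖ) (ht : valuation F (φ t).det = valuation F ϖ) (i : ℕ) :
    (((unitGroup (orderM F)).map (QuotientGroup.mk' (Subgroup.center (GL (Fin 2) F)))).comap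
      (QuotientGroup.mk' (Subgroup.center (GL (Fin 2) F)))).relIndex
        (inducingGroup φ (orderJ F) i) = 2 := by
  have h := isFieldUniformizer_orderJ hφ hϖ ht
  have htJ : unitsMap φ t ∈ inducingGroup φ (orderJ F) i := Subgroup.mem_sup_left ⟨t, rfl⟩
  refine Subgroup.index_eq_two_iff.2 ⟨⟨unitsMap φ t, htJ⟩, fun b => ?_⟩
  obtain ⟨n, hn⟩ := hϖ.exists_zpow (det_ne_zero b.1)
  have hn' : valuation F (b.1 * unitsMap φ t).val.det = valuation F ϖ ^ (n + 1) := by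
    rw [Units.val_mul, Matrix.det_mul, map_mul, hn, zpow_add_one₀ hϖ.pos.ne']
    exact congrArg (valuation F ϖ ^ n * ·) ht
  rw [Subgroup.mem_subgroupOf, Subgroup.mem_subgroupOf,
    mem_comap_map_iff_even hφ hϖ h b.2 hn,
    Subgroup.coe_mul, mem_comap_map_iff_even hφ hϖ h (mul_mem b.2 htJ) hn', Int.even_add_one]
  by_cases hb : Even n <;> simp [Xor, hb]

end Ramified

section Main

variable [MeasurableSpace (GL (Fin 2) F ⧸ Subgroup.center (GL (Fin 2) F))]
  [BorelSpace (GL (Fin 2) F ⧸ Subgroup.center (GL (Fin 2) F))]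
  (μ : MeasureTheory.Measure (GL (Fin 2) F ⧸ Subgroup.center (GL (Fin 2) F))) [μ.IsHaarMeasure]
  (hμ : volModCenter μ (unitGroup (orderM F)) =
    ENNReal.ofReal (((Nat.card 𝓀[F] : ℝ) - 1) / 2))
include hμ

theorem volModCenter_inducingGroup_orderM (hE : Module.finrank F E = 2)
    (hφ : fieldUnits φ ≤ Subgroup.normalizer (unitGroup (orderM F) : Set (GL (Fin 2) F)))
    (i : ℕ) :
    volModCenter μ (inducingGroup φ (orderM F) (i + 1)) =
      ENNReal.ofReal (1 / 2 * ((Nat.card 𝓀[F] : ℝ) ^ (2 * i + 1))⁻¹) := by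
  obtain ⟨ϖ, hϖ⟩ := exists_isUniformizer (F := F)
  have h := isFieldUniformizer_orderM hφ hϖ
  have hV := volModCenter_mul_relIndex μ (center_le_inducingGroup φ (orderM F) (i + 1))
    (isOpen_inducingGroup h (isOpen_orderM F) _) (isOpen_unitGroup (isOpen_orderM F))
    (by rw [hμ]; exact ENNReal.ofReal_ne_top)
    (by rw [relIndex_comap_map_orderM hφ]; exact one_ne_zero)
  rw [relIndex_comap_map_orderM hφ, relIndex_inducingGroup_orderM hE hφ, hμ] at hV
  have hq := two_le_card_residueField F
  have hq1 : 0 < Nat.card 𝓀[F] - 1 := by omega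
  refine eq_ofReal_of_mul_eq (by positivity) hV ?_
  rw [Nat.cast_mul, Nat.cast_sub (by omega), Nat.cast_pow, Nat.cast_one]
  have : (Nat.card 𝓀[F] : ℝ) ≠ 0 := by positivity
  field_simp

theorem volModCenter_inducingGroup_orderJ
    (hφ : fieldUnits φ ≤ Subgroup.normalizer (unitGroup (orderJ F) : Set (GL (Fin 2) F)))
    {ϖ : F} (hϖ : IsUniformizer ϖ) {t : Eˣ} (ht : valuation F (φ t).det = valuation F ϖ) (i : ℕ) :
    volModCenter μ (inducingGroup φ (orderJ F) (i + 1)) =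
      ENNReal.ofReal (1 / ((Nat.card 𝓀[F] : ℝ) + 1) * ((Nat.card 𝓀[F] : ℝ) ^ i)⁻¹) := by
  have h := isFieldUniformizer_orderJ hφ hϖ ht
  have hV := volModCenter_mul_relIndex μ (center_le_inducingGroup φ (orderJ F) (i + 1))
    (isOpen_inducingGroup h (isOpen_orderJ F) _) (isOpen_unitGroup (isOpen_orderM F))
    (by rw [hμ]; exact ENNReal.ofReal_ne_top)
    (by rw [relIndex_comap_map_orderJ hφ hϖ ht]; exact two_ne_zero)
  rw [relIndex_comap_map_orderJ hφ hϖ ht, relIndex_inducingGroup_orderJ hφ h, hμ] at hV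
  have hq := two_le_card_residueField F
  have hq1 : 0 < Nat.card 𝓀[F] - 1 := by omega
  refine eq_ofReal_of_mul_eq (by positivity) hV ?_
  rw [Nat.cast_mul, Nat.cast_mul, Nat.cast_sub (by omega), Nat.cast_pow, Nat.cast_one,
    Nat.cast_add, Nat.cast_one, Nat.cast_two]
  have : (Nat.card 𝓀[F] : ℝ) ≠ 0 := by positivity
  have : (Nat.card 𝓀[F] : ℝ) + 1 ≠ 0 := by positivity
  field_simp

end Main

end Volume

end PadicGLTwo

open PadicGLTwo

theorem mainTheorem5
    {F : Type uF} [Field F] [ValuativeRel F] [TopologicalSpace F] [IsNonarchimedeanLocalField F]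
    (q : ℕ) (hq : q = Nat.card 𝓀[F])
    [MeasurableSpace (GL (Fin 2) F ⧸ Subgroup.center (GL (Fin 2) F))]
    [BorelSpace (GL (Fin 2) F ⧸ Subgroup.center (GL (Fin 2) F))]
    (μ : MeasureTheory.Measure (GL (Fin 2) F ⧸ Subgroup.center (GL (Fin 2) F)))
    [μ.IsHaarMeasure]
    (hμ : volModCenter μ (unitGroup (orderM F)) =
      ENNReal.ofReal (((q : ℝ) - 1) / 2))
    {E : Type uE} [Field E] [Algebra F E] (hE : Module.finrank F E = 2)
    (φ : E →ₐ[F] Matrix (Fin 2) (Fin 2) F)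
    (n i : ℕ) (hn : 1 ≤ n) (hi : i = (n + 1) / 2) :
    -- `𝔘 = 𝓜`, `E/F` unramified: the volume, `n` even, `n` odd
    (IsUnramifiedExt F E →
      fieldUnits φ ≤
        Subgroup.normalizer (unitGroup (orderM F) : Set (GL (Fin 2) F)) →
      volModCenter μ (inducingGroup φ (orderM F) i) =
          ENNReal.ofReal (1 / 2 * ((q : ℝ) ^ (2 * i - 1))⁻¹) ∧
        (Even n → InducedFormalDimension.{uF, uW, uH} μ
          (inducingGroup φ (orderM F) i) q (2 * (q : ℝ) ^ (2 * i))) ∧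
        (Odd n → InducedFormalDimension.{uF, uW, uH} μ
          (inducingGroup φ (orderM F) i) 1
            (2 * (q : ℝ) ^ (2 * i - 1)))) ∧
    -- `𝔘 = 𝓙`, `E/F` ramified, `n` odd
    (¬ IsUnramifiedExt F E →
      fieldUnits φ ≤
        Subgroup.normalizer (unitGroup (orderJ F) : Set (GL (Fin 2) F)) →
      Odd n →
      volModCenter μ (inducingGroup φ (orderJ F) i) =
          ENNReal.ofReal (1 / ((q : ℝ) + 1) * ((q : ℝ) ^ (i - 1))⁻¹) ∧
        InducedFormalDimension.{uF, uW, uH} μ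
          (inducingGroup φ (orderJ F) i) 1
            (((q : ℝ) + 1) * (q : ℝ) ^ (i - 1))) := by
  subst hq
  have := isMulRightInvariant_PGL μ
  have := secondCountableTopology_GL F
  obtain ⟨ϖ, hϖ⟩ := exists_isUniformizer (F := F)
  have hq : (Nat.card 𝓀[F] : ℝ) ≠ 0 := by
    have := two_le_card_residueField F
    positivity
  have hq1 : (Nat.card 𝓀[F] : ℝ) + 1 ≠ 0 := by positivity
  -- As n ≥ 1, also i ≥ 1; with i = k + 1 the truncated exponents 2i - 1 and i - 1 become 2k + 1 and
  -- k.
  obtain ⟨k, rfl⟩ : ∃ k, i = k + 1 := ⟨i - 1, by omega⟩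
  have e1 : 2 * (k + 1) - 1 = 2 * k + 1 := by omega
  have e2 : 2 * (k + 1) = 2 * k + 1 + 1 := by omega
  rw [e1, e2, Nat.add_sub_cancel]
  refine ⟨fun _ hφ => ?_, fun hram hφ _ => ?_⟩
  · have hJ := isOpen_inducingGroup (isFieldUniformizer_orderM hφ hϖ) (isOpen_orderM F) (k + 1)
    have := countable_quotient_of_isOpen hJ
    have hZ := center_le_inducingGroup φ (orderM F) (k + 1)
    have hv := volModCenter_inducingGroup_orderM μ hμ hE hφ k
    -- What remains in each parity is d · vol(J/Z) = dim Λ, with dim Λ equal to q for n even and to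
    -- 1 for n odd.
    refine ⟨hv, fun _ => inducedFormalDimension_of_volModCenter μ hJ hZ hv ?_,
      fun _ => inducedFormalDimension_of_volModCenter μ hJ hZ hv ?_⟩
    · rw [pow_succ]
      field_simp
    · rw [Nat.cast_one]
      field_simp
  · obtain ⟨t, ht⟩ := exists_valuation_det_eq hram hφ hϖ
    have hJ := isOpen_inducingGroup (isFieldUniformizer_orderJ hφ hϖ ht) (isOpen_orderJ F) (k + 1)
    have := countable_quotient_of_isOpen hJ
    have hZ := center_le_inducingGroup φ (orderJ F) (k + 1)
    have hv := volModCenter_inducingGroup_orderJ μ hμ hφ hϖ ht k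
    refine ⟨hv, inducedFormalDimension_of_volModCenter μ hJ hZ hv ?_⟩
    rw [Nat.cast_one]
    field_simp
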